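/- **Setting.** Let $A=(A_{p,p'})_{p,p'\in\mathbb Z^2}$ be a real matrix with $\sum_p|A_{p,0}|<\infty$; for $k\in\mathbb R^2$ put $\hat A(k)=\sum_{p\in\mathbb Z^2}A_{p,0}e^{-ip\cdot k}$ (a $2\pi$-periodic function in each coordinate) and $\hat R(k)=\hat A(k)+\hat A(-k)\in\mathbb R$. Assume: (1) $A_{p+r,p'+r}=A_{p,p'}$ for all $p,p',r$; (2) $\sum_{p'}A_{p,p'}=0$; (3) $\hat R\le 0$, and $k=0$ is the only zero of $\hat R$ in $[-\pi,\pi]^2$; (4) $\hat R(k)=k\cdot\hat Wk+O(|k|^3)$ as $k\to0$ for a symmetric, strictly negative definite $2\times2$ matrix $\hat W$; (5) $\hat A$ is $C^\infty$ on $\mathbb R^2$. Let $v>0$, $w=\sqrt{\det\hat W}>0$, and let $V$ be a real $2\times 2$ matrix with $V\hat WV^T=-I$. For integers $0<m_2<m$ let $\mathcal R_m=\mathbb Z^2/\!\sim$, where $p\sim p'$ iff $p-p'=(j_1m-j_2m_2,\,j_2m)$ for some $j_1,j_2\in\mathbb Z$ (this set has $m^2$ elements), let $$\mathcal K_m=\Big\{\tfrac{2\pi}{m}\big(r_1,\tfrac{m_2}{m}r_1+r_2\big):\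 r_1,r_2\in\mathbb Z,\ -\tfrac m2\le r_1,r_2<\tfrac m2\Big\},$$ and consider on $\mathbb R^{\mathcal R_m}$ the linear system of SDEs $d\xi_{p,t}=\sqrt v\,dW_{p,t}+\sum_{p'\in\mathcal R_m}A_{p,p'}\xi_{p',t}\,dt$, where the $W_p$ are independent standard Brownian motions, independent of $\xi_{\cdot,0}$, and where on $\mathcal R_m$ the matrix is the periodization of $A$ (the entry at classes $P,P'$ is $\sum_{q\in P}A_{q,p'}$ for any $p'\in P'$). A stationary measure for the gradients is a law of $(\xi_p-\xi_{p'})_{p,p'\in\mathcal R_m}$ that is preserved in time by the SDE. **Theorem.** (a) For all integers $0<m_2<m$ there is a unique stationary measure $\mu=\mu_{m,m_2}$ for the gradients: solutions whose gradients have law $\mu$ at time $0$ have gradients of law $\mu$ at all times, and any solution whose gradients have a law that does not depend on time has gradients of law $\mu$. The measure $\mu$ is Gaussian, $\mathbb E_\mu(\xi_p-\xi_{p'})=0$ for all $p,p'$, and for all $y_1,\dots,y_4\in\mathbb Z^2$ $$\mathrm{Cov}_\mu[\xi_{y_1}-\xi_{y_2};\,\xi_{y_3}-\xi_{y_4}]=-\frac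 v{m^2}\sum_{k\in\mathcal K_m,\,k\ne0}\frac{(e^{iky_1}-e^{iky_2})(e^{-iky_3}-e^{-iky_4})}{\hat R(k)}.$$ (b) For fixed $y_1,\dots,y_4$, as $m\to\infty$ (with any choice of $0<m_2<m$ depending on $m$) this converges to $$C_\infty(y_1,y_2,y_3,y_4):=-\frac v{(2\pi)^2}\int_{[-\pi,\pi]^2}\frac{(e^{iky_1}-e^{iky_2})(e^{-iky_3}-e^{-iky_4})}{\hat R(k)}\,dk ,$$ the integral being absolutely convergent. (c) There is a constant $K$ such that for all $y_1,\dots,y_4\in\mathbb Z^2$ $$\Big|C_\infty(y_1,y_2,y_3,y_4)-\frac v{2\pi w}\log\frac{(1+|V(y_1-y_4)|)(1+|V(y_3-y_2)|)}{(1+|V(y_1-y_3)|)(1+|V(y_2-y_4)|)}\Big|\le\frac K{1+\min(|y_1-y_3|,|y_2-y_4|,|y_1-y_4|,|y_2-y_3|)},$$ and, whenever ($y_1=y_3\Leftrightarrow y_2=y_4$) and ($y_1=y_4\Leftrightarrow y_2=y_3$), also $$\Big|C_\infty(y_1,y_2,y_3,y_4)-\frac v{2\pi w}\log\frac{1+|V(y_1-y_4)||V(y_3-y_2)|}{1+|V(y_1-y_3)||V(y_2-y_4)|}\Big|\le\frac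 K{1+\min(|y_1-y_3|,|y_2-y_4|,|y_1-y_4|,|y_2-y_3|)}.$$ (d) Let $\phi:\mathbb R^2\to\mathbb R$ be $C^\infty$ with compact support and $\int\phi=0$. Then $\xi_\phi=\delta^2\sum_{p\in\mathbb Z^2}\phi(\delta p)(\xi_p-\xi_0)$, under $\mu_{m,m_2}$, converges in law as $m\to\infty$ for every fixed $\delta>0$ (to a limit that does not depend on the choice of $m_2$), and as $\delta\to0$ these limit laws converge to the centred Gaussian law of variance $$-\frac v{2\pi w}\int\!\!\int\phi(x)\phi(y)\log|V(x-y)|\,dx\,dy\ \ge0,$$ the integral being absolutely convergent. -/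

import Mathlib

open MeasureTheory ProbabilityTheory Filter Topology
open scoped NNReal Matrix

/-- The Euclidean plane `ℝ²`. -/
abbrev Plane : Type := EuclideanSpace ℝ (Fin 2)

/-- A lattice point of `ℤ²` viewed as a vector of `ℝ²`. -/
noncomputable def latticePoint (p : ℤ × ℤ) : Plane := !₂[(p.1 : ℝ), (p.2 : ℝ)]

/-- The character `e^{i k·p}`. -/
noncomputable def wave (k : Plane) (p : ℤ × ℤ) : ℂ :=
  Complex.exp (Complex.I * ((inner ℝ k (latticePoint p) : ℝ) : ℂ))

/-- The square `[-π, π]²`. -/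
def brillouin : Set Plane := {k | ∀ i, k i ∈ Set.Icc (-Real.pi) Real.pi}

/-! ### The drift matrix -/

/-- `Â(k) = ∑_p A_{p,0} e^{-i p·k}`, for every `k ∈ ℝ²`. -/
noncomputable def Ahat (A : ℤ × ℤ → ℤ × ℤ → ℝ) (k : Plane) : ℂ :=
  ∑' p : ℤ × ℤ, (A p 0 : ℂ) * wave (-k) p

/-- `R̂(k) = Â(k) + Â(-k)`. As `A` is real, `Â(-k)` is the conjugate of `Â(k)`, so that this sum
is a real number. -/
noncomputable def Rhat (A : ℤ × ℤ → ℤ × ℤ → ℝ) (k : Plane) : ℝ :=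
  (Ahat A k + Ahat A (-k)).re

/-- The conditions on the drift. `A` is an infinite real matrix indexed by `ℤ²` (the matrix on a
finite torus is its periodization, see `torusMatrix`), with summable rows, so that `Â` makes sense;
`What` is the symmetric matrix of the quadratic part of `R̂` at `0`. The function `Â` is `2π`-periodic in each
coordinate by definition. -/
structure IsAdmissible (A : ℤ × ℤ → ℤ × ℤ → ℝ) (What : Matrix (Fin 2) (Fin 2) ℝ) : Prop where
  summable : Summable fun p => A p 0
  translation : ∀ p p' r, A (p + r) (p' + r) = A p p'
  sum_eq_zero : ∀ p, ∑' p', A p p' = 0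
  nonpos : ∀ k, Rhat A k ≤ 0
  eq_zero : ∀ k ∈ brillouin, Rhat A k = 0 → k = 0
  negDef : (-What).PosDef
  expansion : (fun k : Plane => Rhat A k - k.ofLp ⬝ᵥ (What *ᵥ k.ofLp))
    =O[𝓝 0] fun k : Plane => ‖k‖ ^ 3
  smooth : ContDiff ℝ (⊤ : ℕ∞) (Ahat A)

/-! ### The torus -/

/-- The lattice of the vectors `(j₁ m - j₂ m₂, j₂ m)`, `j₁, j₂ ∈ ℤ`. -/
def torusLattice (m m₂ : ℕ) : AddSubgroup (ℤ × ℤ) where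
  carrier := {x | ∃ j₁ j₂ : ℤ, x = (j₁ * m - j₂ * m₂, j₂ * m)}
  zero_mem' := ⟨0, 0, by simp; rfl⟩
  add_mem' := by
    rintro _ _ ⟨a, b, rfl⟩ ⟨c, d, rfl⟩
    exact ⟨a + c, b + d, by ext <;> simp <;> ring⟩
  neg_mem' := by
    rintro _ ⟨a, b, rfl⟩
    exact ⟨-a, -b, by ext <;> simp <;> ring⟩

/-- The set of labels `𝓡_m = ℤ² / ∼`, with `p ∼ p'` iff `p - p' = (j₁ m - j₂ m₂, j₂ m)`. -/
abbrev Torus (m m₂ : ℕ) : Type := (ℤ × ℤ) ⧸ torusLattice m m₂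

/-- The label of the class of a lattice point. -/
abbrev toTorus (m m₂ : ℕ) (p : ℤ × ℤ) : Torus m m₂ := QuotientAddGroup.mk p

instance finiteTorus (m m₂ : ℕ) [NeZero m] : Finite (Torus m m₂) := by
  have hm : (0 : ℤ) < m := by exact_mod_cast Nat.pos_of_ne_zero (NeZero.ne m)
  refine Finite.of_surjective
    (fun x : (Set.Ico (0 : ℤ) m) × (Set.Ico (0 : ℤ) m) => toTorus m m₂ (x.1.1, x.2.1)) ?_
  intro P
  obtain ⟨⟨a, b⟩, rfl⟩ := QuotientAddGroup.mk_surjective P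
  refine ⟨(⟨(a + (b / m) * m₂) % m, Int.emod_nonneg _ hm.ne', Int.emod_lt_of_pos _ hm⟩,
    ⟨b % m, Int.emod_nonneg _ hm.ne', Int.emod_lt_of_pos _ hm⟩), ?_⟩
  refine (QuotientAddGroup.eq).2 ⟨(a + (b / m) * m₂) / m, b / m, ?_⟩
  have h1 := Int.emod_add_mul_ediv (a + (b / m) * m₂) m
  have h2 := Int.emod_add_mul_ediv b m
  ext
  · simp only [Prod.fst_add, Prod.fst_neg]
    linarith
  · simp only [Prod.snd_add, Prod.snd_neg]
    linarith

noncomputable instance fintypeTorus (m m₂ : ℕ) [NeZero m] : Fintype (Torus m m₂) :=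
  Fintype.ofFinite _

open Classical in
/-- The matrix on the torus: `A_{P,P'} = ∑_{q ∈ P} A_{q,p'}`, where `p'` is a point of the class
`P'` (by translation invariance the choice of `p'` does not matter). -/
noncomputable def torusMatrix (A : ℤ × ℤ → ℤ × ℤ → ℝ) (m m₂ : ℕ) :
    Matrix (Torus m m₂) (Torus m m₂) ℝ :=
  fun P P' => ∑' q : ℤ × ℤ, if toTorus m m₂ q = P then A q (Quotient.out P') else 0

/-! ### The system of SDEs and its gradients -/

/-- `ξ` solves `dξ_p = √v dW_p + ∑_{p'} A_{p,p'} ξ_{p'} dt` on the torus, where the `W_p` are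
independent standard Brownian motions, independent of the initial condition. As the noise is
additive, the equation is a pathwise integral equation. -/
structure IsSolution {Ω : Type} [MeasurableSpace Ω] (P : Measure Ω) (A : ℤ × ℤ → ℤ × ℤ → ℝ)
    (v : ℝ) (m m₂ : ℕ) [NeZero m] (W : Torus m m₂ → ℝ≥0 → Ω → ℝ)
    (ξ : ℝ≥0 → Ω → Torus m m₂ → ℝ) : Prop where
  measurable_noise : ∀ p t, Measurable (W p t)
  brownian : ∀ p, IsBrownianReal (W p) P
  indep : iIndepFun (fun p ω t => W p t ω) P
  measurable : ∀ t, Measurable (ξ t)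
  indep_init : IndepFun (ξ 0) (fun ω p t => W p t ω) P
  continuous : ∀ᵐ ω ∂P, Continuous fun t => ξ t ω
  equation : ∀ᵐ ω ∂P, ∀ (t : ℝ≥0) (p : Torus m m₂),
    ξ t ω p = ξ 0 ω p + √v * W p t ω +
      ∫ s in (0 : ℝ)..t, ∑ p', torusMatrix A m m₂ p p' * ξ s.toNNReal ω p'

/-- The space where the families `(ξ_p - ξ_{p'})_{p,p'}` live. -/
abbrev GradientSpace (m m₂ : ℕ) : Type := Torus m m₂ × Torus m m₂ → ℝ

/-- The gradients `(ξ_p - ξ_{p'})_{p,p'}` of a configuration. -/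
def fieldGradient {m m₂ : ℕ} (ξ : Torus m m₂ → ℝ) : GradientSpace m m₂ := fun q => ξ q.1 - ξ q.2

/-- `μ` is stationary for the gradients of the SDE: it is the law of the gradients of a random
configuration, and whenever the gradients of a solution have law `μ` at time `0`, they have
law `μ` at all times. -/
structure IsStationaryGradientLaw (A : ℤ × ℤ → ℤ × ℤ → ℝ) (v : ℝ) (m m₂ : ℕ) [NeZero m]
    (μ : Measure (GradientSpace m m₂)) : Prop where
  isGradient : ∃ ρ : Measure (Torus m m₂ → ℝ), IsProbabilityMeasure ρ ∧ ρ.map fieldGradient = μ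
  invariant : ∀ (Ω : Type) [MeasurableSpace Ω] (P : Measure Ω) [IsProbabilityMeasure P]
    (W : Torus m m₂ → ℝ≥0 → Ω → ℝ) (ξ : ℝ≥0 → Ω → Torus m m₂ → ℝ),
    IsSolution P A v m m₂ W ξ → P.map (fun ω => fieldGradient (ξ 0 ω)) = μ →
      ∀ t, P.map (fun ω => fieldGradient (ξ t ω)) = μ

/-! ### Covariances -/

/-- The pairs `(r₁, r₂)` of integers with `-m/2 ≤ r₁, r₂ < m/2`. -/
noncomputable def waveIndex (m : ℕ) : Finset (ℤ × ℤ) :=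
  ((Finset.Icc (-(m : ℤ)) m) ×ˢ (Finset.Icc (-(m : ℤ)) m)).filter fun r =>
    (-(m : ℤ) ≤ 2 * r.1 ∧ 2 * r.1 < m) ∧ (-(m : ℤ) ≤ 2 * r.2 ∧ 2 * r.2 < m)

/-- The wave vector `(2π/m) (r₁, (m₂/m) r₁ + r₂)`. -/
noncomputable def waveVector (m m₂ : ℕ) (r : ℤ × ℤ) : Plane :=
  !₂[2 * Real.pi / m * r.1, 2 * Real.pi / m * ((m₂ : ℝ) / m * r.1 + r.2)]

/-- `(e^{i k y₁} - e^{i k y₂}) (e^{-i k y₃} - e^{-i k y₄}) / R̂(k)`. -/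
noncomputable def covSummand (A : ℤ × ℤ → ℤ × ℤ → ℝ) (y₁ y₂ y₃ y₄ : ℤ × ℤ) (k : Plane) : ℂ :=
  (wave k y₁ - wave k y₂) * (wave (-k) y₃ - wave (-k) y₄) / (Rhat A k : ℂ)

/-- The Fourier sum for the covariances on the torus, over the nonzero wave vectors (the numerator
vanishes at `k = 0`). -/
noncomputable def torusCov (A : ℤ × ℤ → ℤ × ℤ → ℝ) (v : ℝ) (m m₂ : ℕ)
    (y₁ y₂ y₃ y₄ : ℤ × ℤ) : ℂ :=
  -((v : ℂ) / (m : ℂ) ^ 2) *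
    ∑ r ∈ (waveIndex m).erase (0, 0), covSummand A y₁ y₂ y₃ y₄ (waveVector m m₂ r)

/-- The Fourier integral for the covariances in infinite volume. -/
noncomputable def limitCov (A : ℤ × ℤ → ℤ × ℤ → ℝ) (v : ℝ) (y₁ y₂ y₃ y₄ : ℤ × ℤ) : ℂ :=
  -((v : ℂ) / (2 * (Real.pi : ℂ)) ^ 2) * ∫ k in brillouin, covSummand A y₁ y₂ y₃ y₄ k

/-- `|V x|`, the Euclidean norm. -/
noncomputable def normV (V : Matrix (Fin 2) (Fin 2) ℝ) (x : Plane) : ℝ :=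
  ‖(WithLp.toLp 2 (V *ᵥ x.ofLp) : Plane)‖

/-- `|V (y - z)|` for lattice points. -/
noncomputable def latNormV (V : Matrix (Fin 2) (Fin 2) ℝ) (y z : ℤ × ℤ) : ℝ :=
  normV V (latticePoint y - latticePoint z)

/-- The Euclidean distance of two lattice points. -/
noncomputable def latDist (y z : ℤ × ℤ) : ℝ := ‖latticePoint y - latticePoint z‖

/-- `min (|y₁-y₃|, |y₂-y₄|, |y₁-y₄|, |y₂-y₃|)`. -/
noncomputable def minDist (y₁ y₂ y₃ y₄ : ℤ × ℤ) : ℝ :=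
  min (min (latDist y₁ y₃) (latDist y₂ y₄)) (min (latDist y₁ y₄) (latDist y₂ y₃))

/-! ### The smoothed field -/

/-- `ξ_φ = δ² ∑_{p ∈ ℤ²} φ(δ p) (ξ_p - ξ_0)` as a function of the gradients; the sum is finite
when `φ` has compact support and `δ > 0`. -/
noncomputable def smoothedField (φ : Plane → ℝ) (δ : ℝ) {m m₂ : ℕ} (g : GradientSpace m m₂) : ℝ :=
  δ ^ 2 * ∑' p : ℤ × ℤ, φ (δ • latticePoint p) * g (toTorus m m₂ p, toTorus m m₂ 0)

/-- The integrand `φ(x) φ(y) log |V (x - y)|`. -/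
noncomputable def logEnergy (V : Matrix (Fin 2) (Fin 2) ℝ) (φ : Plane → ℝ) (z : Plane × Plane) :
    ℝ :=
  φ z.1 * φ z.2 * Real.log (normV V (z.1 - z.2))

/-- `-(v / (2 π w)) ∫∫ φ(x) φ(y) log |V (x - y)| dx dy`. -/
noncomputable def gffVariance (v w : ℝ) (V : Matrix (Fin 2) (Fin 2) ℝ) (φ : Plane → ℝ) : ℝ :=
  -(v / (2 * Real.pi * w)) * ∫ z : Plane × Plane, logEnergy V φ z

/-! ### Riemann sums and Wiener integrals of deterministic functions -/

lemma tendsto_sum_mul_integral {g h : ℝ → ℝ} (hg : Continuous g) (hh : Continuous h) {t σ : ℝ}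
    (ht : 0 ≤ t) (hσ : σ ∈ Set.Icc (0 : ℝ) 1) :
    Tendsto (fun n : ℕ => ∑ i ∈ Finset.range (n + 1), g (t * (i + σ) / (n + 1)) *
      ∫ s in (t * i / (n + 1))..(t * (i + 1) / (n + 1)), h s) atTop
      (𝓝 (∫ s in (0 : ℝ)..t, g s * h s)) := by
  obtain ⟨M, hM⟩ := (isCompact_Icc (a := (0 : ℝ)) (b := t)).exists_bound_of_continuousOn
    hh.continuousOn
  have hM0 : 0 ≤ M := (norm_nonneg _).trans (hM 0 ⟨le_rfl, ht⟩)
  have hu := (isCompact_Icc (a := (0 : ℝ)) (b := t)).uniformContinuousOn_of_continuous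
    hg.continuousOn
  rw [Metric.uniformContinuousOn_iff] at hu
  rw [Metric.tendsto_atTop]
  intro ε hε
  have hK : 0 < M * t + 1 := by positivity
  obtain ⟨δ, hδ, hδ'⟩ := hu (ε / (M * t + 1)) (by positivity)
  obtain ⟨N, hN⟩ := exists_nat_gt (t / δ)
  refine ⟨N, fun n hn => ?_⟩
  have hn1 : (0 : ℝ) < n + 1 := by positivity
  have hstep : t / (n + 1) < δ := by
    rw [div_lt_iff₀ hn1, ← div_lt_iff₀' hδ]
    have : (N : ℝ) ≤ n := by exact_mod_cast hn
    linarith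
  have hsplit : ∫ s in (0 : ℝ)..t, g s * h s = ∑ i ∈ Finset.range (n + 1),
      ∫ s in (t * i / (n + 1))..(t * (i + 1) / (n + 1)), g s * h s := by
    have := intervalIntegral.sum_integral_adjacent_intervals (f := fun s => g s * h s)
      (μ := volume) (a := fun i : ℕ => t * i / (n + 1)) (n := n + 1)
      (fun k _ => (hg.mul hh).intervalIntegrable _ _)
    push_cast at this
    rw [this]
    congr 1
    · simp
    · field_simp
  rw [dist_eq_norm, hsplit, ← Finset.sum_sub_distrib]
  have key : ∀ i ∈ Finset.range (n + 1), ‖g (t * (i + σ) / (n + 1)) *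
      (∫ s in (t * i / (n + 1))..(t * (i + 1) / (n + 1)), h s) -
      ∫ s in (t * i / (n + 1))..(t * (i + 1) / (n + 1)), g s * h s‖ ≤
      (ε / (M * t + 1) * M) * (t / (n + 1)) := by
    intro i hi
    have hi' : (i : ℝ) + 1 ≤ n + 1 := by
      exact_mod_cast Finset.mem_range.1 hi
    have hle : t * i / (n + 1) ≤ t * (i + 1) / (n + 1) := by gcongr; linarith
    have h0 : 0 ≤ t * i / (n + 1) := by positivity
    have h1 : t * (i + 1) / (n + 1) ≤ t := by
      rw [div_le_iff₀ hn1]; gcongr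
    rw [← intervalIntegral.integral_const_mul, ← intervalIntegral.integral_sub
      (Continuous.intervalIntegrable (by fun_prop) _ _)
      (Continuous.intervalIntegrable (by fun_prop) _ _)]
    have hlen : |t * (i + 1) / (n + 1) - t * i / (n + 1)| = t / (n + 1) := by
      rw [abs_of_nonneg (by linarith)]; ring
    rw [← hlen]
    refine intervalIntegral.norm_integral_le_of_norm_le_const fun s hs => ?_
    rw [Set.uIoc_of_le hle] at hs
    have hs' : s ∈ Set.Icc (0 : ℝ) t := ⟨h0.trans hs.1.le, hs.2.trans h1⟩
    have htag1 : t * i / (n + 1) ≤ t * (i + σ) / (n + 1) := by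
      gcongr; linarith [hσ.1]
    have htag2 : t * (i + σ) / (n + 1) ≤ t * (i + 1) / (n + 1) := by
      gcongr; linarith [hσ.2]
    have hd : dist (t * (i + σ) / (n + 1)) s < δ := by
      refine lt_of_le_of_lt ?_ hstep
      rw [Real.dist_eq, abs_le]
      have : t * (i + 1) / (n + 1) - t * i / (n + 1) = t / (n + 1) := by ring
      constructor <;> linarith [hs.1, hs.2]
    have := hδ' _ ⟨h0.trans htag1, htag2.trans h1⟩ s hs' hd
    rw [← sub_mul, norm_mul]
    gcongr
    · rw [← dist_eq_norm]; exact this.le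
    · exact hM s hs'
  refine (norm_sum_le_of_le _ key).trans_lt ?_
  rw [Finset.sum_const, Finset.card_range, nsmul_eq_mul]
  have : ((n + 1 : ℕ) : ℝ) * (ε / (M * t + 1) * M * (t / (n + 1))) =
      ε * (M * t / (M * t + 1)) := by
    push_cast; field_simp
  rw [this]
  have : M * t / (M * t + 1) < 1 := by rw [div_lt_one hK]; linarith
  nlinarith

lemma sum_mul_sub_eq (f W : ℕ → ℝ) (n : ℕ) :
    ∑ i ∈ Finset.range n, f i * (W (i + 1) - W i) =
      f n * W n - f 0 * W 0 - ∑ i ∈ Finset.range n, W (i + 1) * (f (i + 1) - f i) := by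
  induction n with
  | zero => simp
  | succ n ih => rw [Finset.sum_range_succ, Finset.sum_range_succ, ih]; ring

/-- The time `t i / (n + 1)` of a uniform partition. -/
noncomputable def partitionTime (t : ℝ≥0) (n i : ℕ) : ℝ≥0 := t * i / (n + 1)

lemma partitionTime_mono (t : ℝ≥0) (n : ℕ) : Monotone (partitionTime t n) := by
  intro i j hij
  unfold partitionTime
  gcongr

/-- The approximation of the Wiener integral of `f` against the path `w`. -/
noncomputable def wienerSum (f : ℝ → ℝ) (t : ℝ≥0) (n : ℕ) (w : ℝ≥0 → ℝ) : ℝ :=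
  ∑ i ∈ Finset.range (n + 1), f (partitionTime t n i) *
    (w (partitionTime t n (i + 1)) - w (partitionTime t n i))

lemma measurable_wienerSum (f : ℝ → ℝ) (t : ℝ≥0) (n : ℕ) : Measurable (wienerSum f t n) := by
  unfold wienerSum
  fun_prop

lemma tendsto_wienerSum {f f' : ℝ → ℝ} (hf : ∀ s, HasDerivAt f (f' s) s) (hf' : Continuous f')
    (t : ℝ≥0) {w : ℝ≥0 → ℝ} (hw : Continuous w) (hw0 : w 0 = 0) :
    Tendsto (fun n => wienerSum f t n w) atTop
      (𝓝 (f t * w t - ∫ s in (0 : ℝ)..t, f' s * w s.toNNReal)) := by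
  have h1 := tendsto_sum_mul_integral (g := fun s => w s.toNNReal) (h := f')
    (hw.comp continuous_real_toNNReal) hf' t.2 (σ := 1) (by simp)
  have h2 : ∀ n, wienerSum f t n w = f t * w t - ∑ i ∈ Finset.range (n + 1),
      w (Real.toNNReal (t * (i + 1) / (n + 1))) *
      ∫ s in ((t : ℝ) * i / (n + 1))..(t * (i + 1) / (n + 1)), f' s := by
    intro n
    rw [wienerSum, sum_mul_sub_eq (fun i => f (partitionTime t n i))
      (fun i => w (partitionTime t n i))]
    have e1 : partitionTime t n (n + 1) = t := by
      unfold partitionTime; push_cast; field_simp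
    have e2 : partitionTime t n 0 = 0 := by simp [partitionTime]
    rw [e1, e2, hw0, mul_zero, sub_zero]
    congr 1
    refine Finset.sum_congr rfl fun i _ => ?_
    rw [intervalIntegral.integral_eq_sub_of_hasDerivAt (fun s _ => hf s)
      (hf'.intervalIntegrable _ _)]
    have e3 : Real.toNNReal (t * (i + 1) / (n + 1)) = partitionTime t n (i + 1) := by
      rw [partitionTime, ← NNReal.coe_inj, Real.coe_toNNReal _ (by positivity)]
      push_cast; rfl
    rw [e3]
    congr 2
    · congr 1; rw [partitionTime]; push_cast; rfl
  simp_rw [h2]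
  refine tendsto_const_nhds.sub ?_
  have h3 : ∫ s in (0 : ℝ)..t, f' s * w s.toNNReal = ∫ s in (0 : ℝ)..t, w s.toNNReal * f' s := by
    simp_rw [mul_comm]
  rw [h3]
  exact h1

lemma integral_cexp_wienerSum {Ω : Type*} [MeasurableSpace Ω] {P : Measure Ω}
    {W : ℝ≥0 → Ω → ℝ} (hW : IsPreBrownianReal W P) (f : ℝ → ℝ)
    (t : ℝ≥0) (n : ℕ) (r : ℝ) :
    charFun (P.map fun ω => wienerSum f t n (fun s => W s ω)) r =
      Complex.exp (-((r ^ 2 / 2 * ∑ i ∈ Finset.range (n + 1),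
        f (partitionTime t n i) ^ 2 * (t / (n + 1)) : ℝ) : ℂ)) := by
  have hI := (hW.hasIndepIncrements.nat (partitionTime_mono t n))
  have hI2 := hI.comp (fun i x => f (partitionTime t n i) * x) (fun i => by fun_prop)
  have hm : ∀ i, AEMeasurable ((fun x => f (partitionTime t n i) * x) ∘
      (fun ω => W (partitionTime t n (i + 1)) ω - W (partitionTime t n i) ω)) P := fun i =>
    ((hW.aemeasurable _).sub (hW.aemeasurable _)).const_mul _
  have h := iIndepFun.charFun_map_fun_finsetSum_eq_prod (s := Finset.range (n + 1))
    (fun i _ => hm i) (hI2.restrict _)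
  have e : (fun ω => wienerSum f t n (fun s => W s ω)) = fun ω => ∑ i ∈ Finset.range (n + 1),
    ((fun x => f (partitionTime t n i) * x) ∘
      (fun ω => W (partitionTime t n (i + 1)) ω - W (partitionTime t n i) ω)) ω := rfl
  rw [e, h, Finset.prod_apply]
  rw [Finset.mul_sum]
  push_cast
  rw [← Finset.sum_neg_distrib, Complex.exp_sum]
  refine Finset.prod_congr rfl fun i _ => ?_
  have hl := hW.hasLaw_sub (partitionTime t n (i + 1)) (partitionTime t n i)
  have : P.map ((fun x => f (partitionTime t n i) * x) ∘
      (fun ω => W (partitionTime t n (i + 1)) ω - W (partitionTime t n i) ω)) =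
      (P.map (W (partitionTime t n (i + 1)) - W (partitionTime t n i))).map
        (fun x => f (partitionTime t n i) * x) := by
    rw [AEMeasurable.map_map_of_aemeasurable (by fun_prop)
      ((hW.aemeasurable _).sub (hW.aemeasurable _))]
    rfl
  rw [this, hl.map_eq, charFun_map_mul, charFun_gaussianReal]
  have hd : ((nndist (partitionTime t n (i + 1)).1 (partitionTime t n i).1 : ℝ≥0) : ℝ) =
      t / (n + 1) := by
    rw [coe_nndist, Real.dist_eq]
    have : ((partitionTime t n (i + 1)).1 - (partitionTime t n i).1 : ℝ) = t / (n + 1) := by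
      simp only [partitionTime, NNReal.val_eq_coe]; push_cast; ring
    rw [this, abs_of_nonneg (by positivity)]
  rw [hd]
  congr 1
  push_cast
  ring

lemma tendsto_sum_sq_partition {f : ℝ → ℝ} (hf : Continuous f) (t : ℝ≥0) :
    Tendsto (fun n : ℕ => ∑ i ∈ Finset.range (n + 1),
        f (partitionTime t n i) ^ 2 * (t / (n + 1) : ℝ)) atTop
      (𝓝 (∫ s in (0 : ℝ)..t, f s ^ 2)) := by
  have h1 := tendsto_sum_mul_integral (g := fun s => f s ^ 2) (h := fun _ => 1)
    (hf.pow 2) continuous_const t.2 (σ := 0) (by simp)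
  simp only [mul_one, NNReal.val_eq_coe] at h1
  refine h1.congr fun n => Finset.sum_congr rfl fun i _ => ?_
  rw [intervalIntegral.integral_const]
  simp only [partitionTime, add_zero, smul_eq_mul, mul_one]
  push_cast
  ring

/-- The characteristic function of the sum of an initial condition and of independent Wiener
integrals. -/
theorem charFun_init_add_wiener {T Ω : Type*} [Fintype T] [MeasurableSpace Ω] {P : Measure Ω}
    [IsProbabilityMeasure P] {W : T → ℝ≥0 → Ω → ℝ} {X : Ω → T → ℝ}
    (hWm : ∀ p t, Measurable (W p t)) (hX : Measurable X) (hW : ∀ p, IsBrownianReal (W p) P)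
    (hi : iIndepFun (fun p ω t => W p t ω) P) (hi0 : IndepFun X (fun ω p t => W p t ω) P)
    {f f' : T → ℝ → ℝ} (hf : ∀ p s, HasDerivAt (f p) (f' p s) s) (hf' : ∀ p, Continuous (f' p))
    (t : ℝ≥0) (a : T → ℝ) (r : ℝ) :
    ∫ ω, Complex.exp (((∑ p, a p * X ω p + r * ∑ p, (f p t * W p t ω -
        ∫ s in (0 : ℝ)..t, f' p s * W p s.toNNReal ω) : ℝ) : ℂ) * Complex.I) ∂P =
      (∫ ω, Complex.exp (((∑ p, a p * X ω p : ℝ) : ℂ) * Complex.I) ∂P) *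
        Complex.exp (-((r ^ 2 / 2 * ∑ p, ∫ s in (0 : ℝ)..t, f p s ^ 2 : ℝ) : ℂ)) := by
  have hpath : Measurable fun ω p t => W p t ω :=
    measurable_pi_lambda _ fun p => measurable_pi_lambda _ fun t => hWm p t
  have hpathp : ∀ p, Measurable fun ω t => W p t ω := fun p =>
    measurable_pi_lambda _ fun t => hWm p t
  have hsum : ∀ n, Measurable fun ω => ∑ p, wienerSum (f p) t n (fun s => W p s ω) := fun n =>
    Finset.measurable_sum _ fun p _ => (measurable_wienerSum _ _ _).comp (hpathp p)
  have hlin : Measurable fun ω => ∑ p, a p * X ω p := by fun_prop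
  have step : ∀ n, ∫ ω, Complex.exp (((∑ p, a p * X ω p + r * ∑ p, wienerSum (f p) t n
        (fun s => W p s ω) : ℝ) : ℂ) * Complex.I) ∂P =
      (∫ ω, Complex.exp (((∑ p, a p * X ω p : ℝ) : ℂ) * Complex.I) ∂P) *
        Complex.exp (-((r ^ 2 / 2 * ∑ p, ∑ i ∈ Finset.range (n + 1),
          f p (partitionTime t n i) ^ 2 * (t / (n + 1)) : ℝ) : ℂ)) := by
    intro n
    have h1 := hi0.integral_fun_comp_mul_comp (f := fun x : T → ℝ =>
        Complex.exp (((∑ p, a p * x p : ℝ) : ℂ) * Complex.I))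
      (g := fun w : T → ℝ≥0 → ℝ =>
        Complex.exp (((r * ∑ p, wienerSum (f p) t n (w p) : ℝ) : ℂ) * Complex.I))
      hX.aemeasurable hpath.aemeasurable
      (by
        have : Measurable fun x : T → ℝ => ∑ p, a p * x p := by fun_prop
        exact (by fun_prop : Measurable _).aestronglyMeasurable)
      (by
        have : Measurable fun w : T → ℝ≥0 → ℝ => ∑ p, wienerSum (f p) t n (w p) :=
          Finset.measurable_sum _ fun p _ =>
            (measurable_wienerSum _ _ _).comp (measurable_pi_apply p)
        exact (by fun_prop : Measurable _).aestronglyMeasurable)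
    have h2 : ∀ ω, Complex.exp (((∑ p, a p * X ω p + r * ∑ p, wienerSum (f p) t n
        (fun s => W p s ω) : ℝ) : ℂ) * Complex.I) =
        Complex.exp (((∑ p, a p * X ω p : ℝ) : ℂ) * Complex.I) *
        Complex.exp (((r * ∑ p, wienerSum (f p) t n (fun s => W p s ω) : ℝ) : ℂ) *
          Complex.I) := by
      intro ω
      rw [← Complex.exp_add]
      push_cast
      ring_nf
    simp_rw [h2]
    rw [h1]
    congr 1
    have h3 := iIndepFun.charFun_map_fun_sum_eq_prod
      (X := fun p ω => wienerSum (f p) t n (fun s => W p s ω)) (P := P)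
      (fun p => ((measurable_wienerSum _ _ _).comp (hpathp p)).aemeasurable)
      (hi.comp (fun p => wienerSum (f p) t n) (fun p => measurable_wienerSum _ _ _))
    have h4 := congrFun h3 r
    rw [charFun_apply_real, integral_map (hsum n).aemeasurable (by fun_prop),
      Finset.prod_apply] at h4
    have h5 : ∀ ω, (((r * ∑ p, wienerSum (f p) t n (fun s => W p s ω) : ℝ) : ℂ) * Complex.I) =
        r * ((∑ p, wienerSum (f p) t n (fun s => W p s ω) : ℝ) : ℂ) * Complex.I := by
      intro ω; push_cast; ring
    simp_rw [h5]
    rw [h4]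
    simp_rw [fun p => integral_cexp_wienerSum (hW p).toIsPreBrownianReal (f p) t n r]
    rw [← Complex.exp_sum, Finset.sum_neg_distrib, Finset.mul_sum]
    push_cast
    rfl
  have lim1 : Tendsto (fun n => ∫ ω, Complex.exp (((∑ p, a p * X ω p + r * ∑ p,
        wienerSum (f p) t n (fun s => W p s ω) : ℝ) : ℂ) * Complex.I) ∂P) atTop
      (𝓝 (∫ ω, Complex.exp (((∑ p, a p * X ω p + r * ∑ p, (f p t * W p t ω -
        ∫ s in (0 : ℝ)..t, f' p s * W p s.toNNReal ω) : ℝ) : ℂ) * Complex.I) ∂P)) := by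
    refine tendsto_integral_of_dominated_convergence (fun _ => 1) (fun n => ?_)
      (integrable_const _) (fun n => ae_of_all _ fun ω => ?_) ?_
    · have := hsum n
      fun_prop
    · rw [Complex.norm_exp_ofReal_mul_I]
    · filter_upwards [ae_all_iff.2 fun p => (hW p).cont,
        ae_all_iff.2 fun p => (hW p).eval_zero_ae_eq_zero] with ω h1 h2
      have hc : Continuous fun x : ℝ => Complex.exp ((x : ℂ) * Complex.I) := by fun_prop
      refine (hc.tendsto _).comp (tendsto_const_nhds.add (tendsto_const_nhds.mul
        (tendsto_finsetSum _ fun p _ => tendsto_wienerSum (hf p) (hf' p) t (h1 p) (h2 p))))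
  have lim2 : Tendsto (fun n : ℕ => (∫ ω, Complex.exp (((∑ p, a p * X ω p : ℝ) : ℂ) *
        Complex.I) ∂P) *
        Complex.exp (-((r ^ 2 / 2 * ∑ p, ∑ i ∈ Finset.range (n + 1),
          f p (partitionTime t n i) ^ 2 * (t / (n + 1)) : ℝ) : ℂ))) atTop
      (𝓝 ((∫ ω, Complex.exp (((∑ p, a p * X ω p : ℝ) : ℂ) * Complex.I) ∂P) *
        Complex.exp (-((r ^ 2 / 2 * ∑ p, ∫ s in (0 : ℝ)..t, f p s ^ 2 : ℝ) : ℂ)))) := by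
    have hc : Continuous fun x : ℝ => Complex.exp (-((r ^ 2 / 2 * x : ℝ) : ℂ)) := by fun_prop
    refine tendsto_const_nhds.mul ((hc.tendsto _).comp (tendsto_finsetSum _ fun p _ =>
      tendsto_sum_sq_partition ?_ t))
    exact continuous_iff_continuousAt.2 fun s => (hf p s).continuousAt
  simp_rw [step] at lim1
  exact tendsto_nhds_unique lim1 lim2

/-- Pathwise integration by parts for a linear equation with additive noise. -/
lemma linear_equation_pairing {T : Type*} [Fintype T] {B : Matrix T T ℝ} {r : ℝ}
    {x w : ℝ≥0 → T → ℝ} (hx : Continuous x) (hw : Continuous w)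
    (heq : ∀ (t : ℝ≥0) p, x t p = x 0 p + r * w t p +
      ∫ s in (0 : ℝ)..t, ∑ p', B p p' * x s.toNNReal p')
    {c : ℝ → T → ℝ} (hc : ∀ s p, HasDerivAt (fun s => c s p) (∑ p', B p' p * c s p') s)
    (t : ℝ≥0) :
    ∑ p, c 0 p * x t p = ∑ p, c t p * x 0 p + r * ∑ p, (c 0 p * w t p -
      ∫ s in (0 : ℝ)..t, (-∑ p', B p' p * c (t - s) p') * w s.toNNReal p) := by
  have hcc : ∀ p, Continuous fun s => c s p := fun p =>
    continuous_iff_continuousAt.2 fun s => (hc s p).continuousAt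
  have hxp : ∀ p, Continuous fun s : ℝ => x s.toNNReal p := fun p =>
    ((continuous_apply p).comp hx).comp continuous_real_toNNReal
  have hwp : ∀ p, Continuous fun s : ℝ => w s.toNNReal p := fun p =>
    ((continuous_apply p).comp hw).comp continuous_real_toNNReal
  have hBx : ∀ p, Continuous fun s : ℝ => ∑ p', B p p' * x s.toNNReal p' := fun p =>
    continuous_finsetSum _ fun p' _ => (hxp p').const_mul _
  set Y : T → ℝ → ℝ := fun p s => x 0 p + ∫ u in (0 : ℝ)..s, ∑ p', B p p' * x u.toNNReal p'
  have hY : ∀ p s, HasDerivAt (Y p) (∑ p', B p p' * x s.toNNReal p') s := fun p s =>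
    ((hBx p).integral_hasStrictDerivAt 0 s).hasDerivAt.const_add _
  have hf : ∀ p s, HasDerivAt (fun s => c (t - s) p) (-∑ p', B p' p * c (t - s) p') s := by
    intro p s
    have h := HasDerivAt.scomp (g₁ := fun s => c s p) (h := fun s => (t : ℝ) - s) s
      (hc (t - s) p) ((hasDerivAt_id s).const_sub (t : ℝ))
    rw [neg_one_smul] at h
    exact h
  have hZ : ∀ s, HasDerivAt (fun s => ∑ p, c (t - s) p * Y p s)
      (∑ p, ((-∑ p', B p' p * c (t - s) p') * Y p s +
        c (t - s) p * ∑ p', B p p' * x s.toNNReal p')) s := by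
    intro s
    exact HasDerivAt.fun_sum (u := Finset.univ) fun p _ => (hf p s).mul (hY p s)
  have hYc : ∀ p, Continuous (Y p) := fun p =>
    continuous_iff_continuousAt.2 fun s => (hY p s).continuousAt
  have hct : ∀ p, Continuous fun s : ℝ => c (t - s) p := fun p =>
    (hcc p).comp (continuous_const.sub continuous_id)
  have hFTC := intervalIntegral.integral_eq_sub_of_hasDerivAt (a := 0) (b := t)
    (fun s _ => hZ s) (by
      refine Continuous.intervalIntegrable ?_ _ _
      fun_prop)
  have hY0 : ∀ p, Y p 0 = x 0 p := fun p => by simp [Y]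
  have hYs : ∀ p (s : ℝ), 0 ≤ s → Y p s = x s.toNNReal p - r * w s.toNNReal p := by
    intro p s hs
    have := heq s.toNNReal p
    rw [Real.coe_toNNReal _ hs] at this
    simp only [Y]
    linarith
  have hYt : ∀ p, Y p t = x t p - r * w t p := by
    intro p
    have := hYs p t t.2
    simpa using this
  have hint : ∫ s in (0 : ℝ)..t, ∑ p, ((-∑ p', B p' p * c (t - s) p') * Y p s +
        c (t - s) p * ∑ p', B p p' * x s.toNNReal p') =
      ∫ s in (0 : ℝ)..t, ∑ p, (-r) * ((-∑ p', B p' p * c (t - s) p') * w s.toNNReal p) := by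
    refine intervalIntegral.integral_congr fun s hs => ?_
    rw [Set.uIcc_of_le (NNReal.coe_nonneg t)] at hs
    have hswap : ∑ p, c (t - s) p * ∑ p', B p p' * x s.toNNReal p' =
        ∑ p, (∑ p', B p' p * c (t - s) p') * x s.toNNReal p := by
      simp_rw [Finset.mul_sum, Finset.sum_mul]
      rw [Finset.sum_comm]
      exact Finset.sum_congr rfl fun _ _ => Finset.sum_congr rfl fun _ _ => by ring
    rw [Finset.sum_add_distrib, hswap, ← Finset.sum_add_distrib]
    refine Finset.sum_congr rfl fun p _ => ?_
    rw [hYs p s hs.1]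
    ring
  rw [hint, intervalIntegral.integral_finsetSum] at hFTC
  · simp only [sub_self, sub_zero, hY0, hYt, intervalIntegral.integral_const_mul,
      ← Finset.mul_sum] at hFTC
    have e : r * ∑ p, (c 0 p * w t p -
        ∫ s in (0 : ℝ)..t, (-∑ p', B p' p * c (t - s) p') * w s.toNNReal p) =
        r * ∑ p, c 0 p * w t p -
        r * ∑ p, ∫ s in (0 : ℝ)..t, (-∑ p', B p' p * c (t - s) p') * w s.toNNReal p := by
      rw [Finset.sum_sub_distrib, mul_sub]
    rw [e]
    have : ∑ p, c 0 p * (x t p - r * w t p) = ∑ p, c 0 p * x t p - r * ∑ p, c 0 p * w t p := by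
      rw [Finset.mul_sum, ← Finset.sum_sub_distrib]
      exact Finset.sum_congr rfl fun _ _ => by ring
    rw [this] at hFTC
    linarith
  · intro p _
    refine Continuous.intervalIntegrable ?_ _ _
    have := hwp p
    fun_prop

/-! ### Plane waves -/

lemma latticePoint_add (p q : ℤ × ℤ) :
    latticePoint (p + q) = latticePoint p + latticePoint q := by
  ext i; fin_cases i <;> simp [latticePoint]

lemma latticePoint_neg (p : ℤ × ℤ) : latticePoint (-p) = -latticePoint p := by
  ext i; fin_cases i <;> simp [latticePoint]

lemma latticePoint_sub (p q : ℤ × ℤ) :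
    latticePoint (p - q) = latticePoint p - latticePoint q := by
  rw [sub_eq_add_neg, latticePoint_add, latticePoint_neg, sub_eq_add_neg]

@[simp] lemma latticePoint_zero : latticePoint 0 = 0 := by
  ext i; fin_cases i <;> simp [latticePoint]

lemma inner_latticePoint (k : Plane) (p : ℤ × ℤ) :
    inner ℝ k (latticePoint p) = k 0 * p.1 + k 1 * p.2 := by
  simp [latticePoint, PiLp.inner_apply, Fin.sum_univ_two, mul_comm]

lemma wave_eq (k : Plane) (p : ℤ × ℤ) :
    wave k p = Complex.exp (((k 0 * p.1 + k 1 * p.2 : ℝ) : ℂ) * Complex.I) := by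
  rw [wave, inner_latticePoint, mul_comm]

@[simp] lemma wave_zero_left (p : ℤ × ℤ) : wave 0 p = 1 := by simp [wave]

lemma wave_add_right (k : Plane) (p q : ℤ × ℤ) : wave k (p + q) = wave k p * wave k q := by
  rw [wave, wave, wave, ← Complex.exp_add, latticePoint_add, inner_add_right]
  push_cast; ring_nf

lemma wave_add_left (k l : Plane) (p : ℤ × ℤ) : wave (k + l) p = wave k p * wave l p := by
  rw [wave, wave, wave, ← Complex.exp_add, inner_add_left]
  push_cast; ring_nf

lemma wave_neg_right (k : Plane) (p : ℤ × ℤ) : wave k (-p) = wave (-k) p := by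
  rw [wave, wave, latticePoint_neg, inner_neg_right, inner_neg_left]

lemma wave_neg_left (k : Plane) (p : ℤ × ℤ) : wave (-k) p = (starRingEnd ℂ) (wave k p) := by
  rw [wave_eq, wave_eq, ← Complex.exp_conj]
  simp only [map_mul, Complex.conj_I, Complex.conj_ofReal, PiLp.neg_apply]
  push_cast; ring_nf

@[simp] lemma norm_wave (k : Plane) (p : ℤ × ℤ) : ‖wave k p‖ = 1 := by
  rw [wave_eq, Complex.norm_exp_ofReal_mul_I]

lemma wave_mul_wave_neg (k : Plane) (p q : ℤ × ℤ) :
    wave k p * wave (-k) q = wave k (p - q) := by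
  rw [← wave_neg_right, ← wave_add_right, sub_eq_add_neg]

lemma re_wave (k : Plane) (p : ℤ × ℤ) :
    (wave k p).re = Real.cos (inner ℝ k (latticePoint p)) := by
  rw [wave, mul_comm, Complex.exp_ofReal_mul_I_re]

lemma wave_two_pi_smul (n p : ℤ × ℤ) : wave ((2 * Real.pi) • latticePoint n) p = 1 := by
  rw [wave_eq, Complex.exp_eq_one_iff]
  refine ⟨n.1 * p.1 + n.2 * p.2, ?_⟩
  simp [latticePoint]; ring

lemma wave_periodic (k : Plane) (n p : ℤ × ℤ) :
    wave (k + (2 * Real.pi) • latticePoint n) p = wave k p := by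
  rw [wave_add_left, wave_two_pi_smul, mul_one]

lemma norm_wave_sub_le (k : Plane) (p q : ℤ × ℤ) :
    ‖wave k p - wave k q‖ ≤ ‖k‖ * ‖latticePoint p - latticePoint q‖ := by
  have h : wave k p - wave k q = wave k q * (wave k (p - q) - 1) := by
    rw [mul_sub, ← wave_add_right, add_sub_cancel, mul_one]
  rw [h, norm_mul, norm_wave, one_mul, wave, latticePoint_sub]
  refine (Real.norm_exp_I_mul_ofReal_sub_one_le).trans ?_
  rw [Real.norm_eq_abs]
  exact abs_real_inner_le_norm _ _

@[fun_prop] lemma continuous_wave (p : ℤ × ℤ) : Continuous fun k => wave k p := by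
  unfold wave; fun_prop

/-! ### The function `R̂` -/

section
variable {A : ℤ × ℤ → ℤ × ℤ → ℝ} {What : Matrix (Fin 2) (Fin 2) ℝ}

lemma Ahat_neg (k : Plane) : Ahat A (-k) = (starRingEnd ℂ) (Ahat A k) := by
  rw [Ahat, Ahat, Complex.conj_tsum]
  refine tsum_congr fun p => ?_
  rw [map_mul, Complex.conj_ofReal, wave_neg_left (-k)]

lemma Rhat_eq_two_re (k : Plane) : Rhat A k = 2 * (Ahat A k).re := by
  rw [Rhat, Ahat_neg]; simp [two_mul]

lemma Rhat_neg (k : Plane) : Rhat A (-k) = Rhat A k := by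
  rw [Rhat, Rhat, neg_neg, add_comm]

lemma Ahat_periodic (k : Plane) (n : ℤ × ℤ) :
    Ahat A (k + (2 * Real.pi) • latticePoint n) = Ahat A k := by
  refine tsum_congr fun p => ?_
  have : -(k + (2 * Real.pi) • latticePoint n) = -k + (2 * Real.pi) • latticePoint (-n) := by
    rw [latticePoint_neg, smul_neg, neg_add]
  rw [this, wave_periodic]

lemma Rhat_periodic (k : Plane) (n : ℤ × ℤ) :
    Rhat A (k + (2 * Real.pi) • latticePoint n) = Rhat A k := by
  rw [Rhat_eq_two_re, Ahat_periodic, ← Rhat_eq_two_re]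

lemma covSummand_periodic (y₁ y₂ y₃ y₄ : ℤ × ℤ) (k : Plane) (n : ℤ × ℤ) :
    covSummand A y₁ y₂ y₃ y₄ (k + (2 * Real.pi) • latticePoint n) =
      covSummand A y₁ y₂ y₃ y₄ k := by
  simp only [covSummand, wave_neg_left, wave_periodic, Rhat_periodic]

lemma exists_mem_brillouin (k : Plane) :
    ∃ n : ℤ × ℤ, k + (2 * Real.pi) • latticePoint n ∈ brillouin ∧
      ∀ i, (k + (2 * Real.pi) • latticePoint n) i < Real.pi := by
  have h := fun x : ℝ => toIcoMod_mem_Ico Real.two_pi_pos (-Real.pi) x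
  have e : ∀ x : ℝ, x + 2 * Real.pi * ((-toIcoDiv Real.two_pi_pos (-Real.pi) x : ℤ) : ℝ) =
      toIcoMod Real.two_pi_pos (-Real.pi) x := by
    intro x; rw [← self_sub_toIcoDiv_zsmul, zsmul_eq_mul]; push_cast; ring
  have h' : ∀ i, (k + (2 * Real.pi) • latticePoint (-toIcoDiv Real.two_pi_pos (-Real.pi) (k 0),
      -toIcoDiv Real.two_pi_pos (-Real.pi) (k 1))) i ∈ Set.Ico (-Real.pi) Real.pi := by
    intro i
    fin_cases i
    · have := h (k 0)
      rw [← e, show -Real.pi + 2 * Real.pi = Real.pi by ring] at this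
      simpa [latticePoint] using this
    · have := h (k 1)
      rw [← e, show -Real.pi + 2 * Real.pi = Real.pi by ring] at this
      simpa [latticePoint] using this
  exact ⟨_, fun i => ⟨(h' i).1, (h' i).2.le⟩, fun i => (h' i).2⟩

lemma isCompact_brillouin : IsCompact brillouin := by
  have h : brillouin = (WithLp.ofLp : Plane → Fin 2 → ℝ) ⁻¹'
      (Set.Icc (fun _ => -Real.pi) fun _ => Real.pi) := by
    ext k
    simp [brillouin, Pi.le_def, Set.mem_Icc, forall_and]
  rw [h]
  exact (PiLp.homeomorph 2 fun _ : Fin 2 => ℝ).isCompact_preimage.2 isCompact_Icc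

lemma measurableSet_brillouin : MeasurableSet brillouin :=
  isCompact_brillouin.isClosed.measurableSet

namespace IsAdmissible

variable (hA : IsAdmissible A What)
include hA

lemma apply_eq (p p' : ℤ × ℤ) : A p p' = A (p - p') 0 := by
  have := hA.translation (p - p') 0 p'
  rw [sub_add_cancel, zero_add] at this
  exact this

lemma tsum_col : ∑' p, A p 0 = 0 := by
  have h := hA.sum_eq_zero 0
  rw [← h, ← (Equiv.neg (ℤ × ℤ)).tsum_eq fun p' => A 0 p']
  refine tsum_congr fun p => ?_
  rw [hA.apply_eq 0]
  simp

lemma Ahat_zero : Ahat A 0 = 0 := by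
  have : Ahat A 0 = ((∑' p, A p 0 : ℝ) : ℂ) := by
    rw [Ahat, Complex.ofReal_tsum]
    simp
  rw [this, hA.tsum_col, Complex.ofReal_zero]

lemma Rhat_zero : Rhat A 0 = 0 := by rw [Rhat_eq_two_re, hA.Ahat_zero]; simp

lemma contDiff_Rhat : ContDiff ℝ (⊤ : ℕ∞) (Rhat A) := by
  have h : Rhat A = fun k => Complex.reCLM (Ahat A k + Ahat A (-k)) := rfl
  rw [h]
  exact Complex.reCLM.contDiff.comp (hA.smooth.add (hA.smooth.comp contDiff_neg))

lemma Rhat_neg_of_mem {k : Plane} (hk : k ∈ brillouin) (h0 : k ≠ 0) : Rhat A k < 0 :=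
  lt_of_le_of_ne (hA.nonpos k) fun h => h0 (hA.eq_zero k hk h)

/-- `-k·Ŵk` is bounded below by a multiple of `|k|²`. -/
lemma exists_quadratic_lower_bound : ∃ c > 0, ∀ k : Plane,
    c * ‖k‖ ^ 2 ≤ -(k.ofLp ⬝ᵥ (What *ᵥ k.ofLp)) := by
  have hcont : Continuous fun k : Plane => -(k.ofLp ⬝ᵥ (What *ᵥ k.ofLp)) := by
    fun_prop
  have hne : (Metric.sphere (0 : Plane) 1).Nonempty :=
    NormedSpace.sphere_nonempty.2 zero_le_one
  obtain ⟨x, hx, hmin⟩ := (isCompact_sphere (0 : Plane) 1).exists_isMinOn hne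
    hcont.continuousOn
  have hpos : ∀ k : Plane, k ≠ 0 → 0 < -(k.ofLp ⬝ᵥ (What *ᵥ k.ofLp)) := by
    intro k hk
    have := hA.negDef.dotProduct_mulVec_pos (x := k.ofLp) (by simpa using hk)
    rw [Matrix.neg_mulVec, dotProduct_neg] at this
    simpa only [star_trivial] using this
  have hx0 : x ≠ 0 := by
    rintro rfl; simp at hx
  refine ⟨_, hpos x hx0, fun k => ?_⟩
  by_cases hk : k = 0
  · simp [hk]
  have hk' : 0 < ‖k‖ := norm_pos_iff.2 hk
  have hmem : (‖k‖⁻¹ • k) ∈ Metric.sphere (0 : Plane) 1 := by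
    simp [norm_smul, hk'.ne']
  have := hmin hmem
  simp only [Set.mem_ofPred_eq, WithLp.ofLp_smul, Matrix.mulVec_smul, dotProduct_smul,
    smul_dotProduct, smul_eq_mul] at this
  have h2 : -(‖k‖⁻¹ * (‖k‖⁻¹ * (k.ofLp ⬝ᵥ (What *ᵥ k.ofLp)))) * ‖k‖ ^ 2 =
      -(k.ofLp ⬝ᵥ (What *ᵥ k.ofLp)) := by
    field_simp
  rw [← h2]
  gcongr

/-- `-R̂` is bounded below by a multiple of `|k|²` on the Brillouin zone. -/
lemma exists_lower_bound : ∃ c > 0, ∀ k ∈ brillouin, c * ‖k‖ ^ 2 ≤ -Rhat A k := by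
  obtain ⟨c₁, hc₁, hq⟩ := hA.exists_quadratic_lower_bound
  obtain ⟨C, hC⟩ := hA.expansion.bound
  rw [Metric.eventually_nhds_iff] at hC
  obtain ⟨ε, hε, hC⟩ := hC
  set C' := max C 1 with hC'
  have hC'0 : 0 < C' := lt_max_of_lt_right one_pos
  set ρ := min (ε / 2) (c₁ / (2 * C')) with hρ
  have hρ0 : 0 < ρ := by positivity
  have hnear : ∀ k : Plane, ‖k‖ ≤ ρ → c₁ / 2 * ‖k‖ ^ 2 ≤ -Rhat A k := by
    intro k hk
    have h1 : dist k 0 < ε := by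
      rw [dist_zero_right]
      have : ρ ≤ ε / 2 := min_le_left _ _
      linarith
    have h2 := hC h1
    rw [Real.norm_eq_abs, Real.norm_eq_abs, abs_of_nonneg (by positivity : 0 ≤ ‖k‖ ^ 3)] at h2
    have h3 : C * ‖k‖ ^ 3 ≤ C' * ‖k‖ ^ 3 := by gcongr; exact le_max_left _ _
    have h4 : C' * ‖k‖ ≤ c₁ / 2 := by
      have : ‖k‖ ≤ c₁ / (2 * C') := hk.trans (min_le_right _ _)
      rw [le_div_iff₀ (by positivity)] at this
      linarith
    have h5 : C' * ‖k‖ ^ 3 ≤ c₁ / 2 * ‖k‖ ^ 2 := by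
      calc C' * ‖k‖ ^ 3 = C' * ‖k‖ * ‖k‖ ^ 2 := by ring
        _ ≤ _ := by gcongr
    have h6 := hq k
    have h7 := (abs_le.1 (h2.trans (h3.trans h5))).2
    linarith
  -- away from the origin
  have hK : IsCompact (brillouin \ Metric.ball 0 ρ) := isCompact_brillouin.diff Metric.isOpen_ball
  obtain ⟨M, hM⟩ := isCompact_brillouin.exists_bound_of_continuousOn
    (f := fun k : Plane => ‖k‖ ^ 2) (by fun_prop)
  have hM0 : 0 ≤ M := (norm_nonneg _).trans (hM 0 (fun i => by simp [Real.pi_pos.le]))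
  rcases (brillouin \ Metric.ball (0 : Plane) ρ).eq_empty_or_nonempty with he | hne
  · refine ⟨c₁ / 2, by positivity, fun k hk => hnear k ?_⟩
    by_contra hcon
    have : k ∈ brillouin \ Metric.ball (0 : Plane) ρ := ⟨hk, by simpa using (not_le.1 hcon).le⟩
    simp [he] at this
  · obtain ⟨x, hx, hmin⟩ := hK.exists_isMinOn hne
      (f := fun k => -Rhat A k) hA.contDiff_Rhat.continuous.neg.continuousOn
    have hx0 : x ≠ 0 := by
      rintro rfl
      exact hx.2 (by simpa using hρ0)
    have hRx : 0 < -Rhat A x := by linarith [hA.Rhat_neg_of_mem hx.1 hx0]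
    refine ⟨min (c₁ / 2) (-Rhat A x / (M + 1)), by positivity, fun k hk => ?_⟩
    by_cases h : ‖k‖ ≤ ρ
    · refine le_trans ?_ (hnear k h)
      gcongr; exact min_le_left _ _
    · have h1 := hmin (show k ∈ brillouin \ Metric.ball (0 : Plane) ρ from
        ⟨hk, by simpa using (not_le.1 h).le⟩)
      have h2 := hM k hk
      rw [Real.norm_eq_abs, abs_of_nonneg (by positivity)] at h2
      calc min (c₁ / 2) (-Rhat A x / (M + 1)) * ‖k‖ ^ 2
          ≤ (-Rhat A x / (M + 1)) * (M + 1) := by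
            gcongr
            · exact min_le_right _ _
            · linarith
        _ = -Rhat A x := by field_simp
        _ ≤ _ := h1

/-- The summands of the covariance are bounded. -/
lemma exists_covSummand_bound (y₁ y₂ y₃ y₄ : ℤ × ℤ) :
    ∃ C, ∀ k, ‖covSummand A y₁ y₂ y₃ y₄ k‖ ≤ C := by
  obtain ⟨c, hc, hlow⟩ := hA.exists_lower_bound
  set L := ‖latticePoint y₁ - latticePoint y₂‖ * ‖latticePoint y₃ - latticePoint y₄‖ with hL
  refine ⟨L / c, fun k => ?_⟩
  obtain ⟨n, hn, -⟩ := exists_mem_brillouin k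
  rw [← covSummand_periodic y₁ y₂ y₃ y₄ k n]
  set q := k + (2 * Real.pi) • latticePoint n
  by_cases hq : q = 0
  · rw [hq, covSummand]; simp; positivity
  have hq' : 0 < ‖q‖ := norm_pos_iff.2 hq
  rw [covSummand, norm_div, norm_mul, Complex.norm_real, Real.norm_eq_abs,
    abs_of_nonpos (hA.nonpos q)]
  have h1 := norm_wave_sub_le q y₁ y₂
  have h2 := norm_wave_sub_le (-q) y₃ y₄
  rw [norm_neg] at h2
  have h3 := hlow q hn
  have h4 : 0 < c * ‖q‖ ^ 2 := by positivity
  calc _ ≤ (‖q‖ * ‖latticePoint y₁ - latticePoint y₂‖) *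
        (‖q‖ * ‖latticePoint y₃ - latticePoint y₄‖) / (c * ‖q‖ ^ 2) := by gcongr
    _ = L / c := by rw [hL]; field_simp

lemma continuousAt_covSummand (y₁ y₂ y₃ y₄ : ℤ × ℤ) {k : Plane} (hk : Rhat A k ≠ 0) :
    ContinuousAt (covSummand A y₁ y₂ y₃ y₄) k := by
  unfold covSummand
  have h1 : Continuous (Rhat A) := hA.contDiff_Rhat.continuous
  have h2 : Continuous fun k : Plane => wave (-k) y₃ := (continuous_wave y₃).comp continuous_neg
  have h3 : Continuous fun k : Plane => wave (-k) y₄ := (continuous_wave y₄).comp continuous_neg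
  refine ContinuousAt.div ?_ (Complex.continuous_ofReal.comp h1).continuousAt
    (by exact_mod_cast hk)
  exact (((continuous_wave _).sub (continuous_wave _)).mul (h2.sub h3)).continuousAt

lemma measurable_covSummand (y₁ y₂ y₃ y₄ : ℤ × ℤ) : Measurable (covSummand A y₁ y₂ y₃ y₄) := by
  unfold covSummand
  have h1 : Continuous (Rhat A) := hA.contDiff_Rhat.continuous
  have h2 : Continuous fun k : Plane => wave (-k) y₃ := (continuous_wave y₃).comp continuous_neg
  have h3 : Continuous fun k : Plane => wave (-k) y₄ := (continuous_wave y₄).comp continuous_neg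
  exact (((continuous_wave _).sub (continuous_wave _)).mul (h2.sub h3)).measurable.div
    (Complex.continuous_ofReal.comp h1).measurable

lemma integrableOn_covSummand (y₁ y₂ y₃ y₄ : ℤ × ℤ) :
    IntegrableOn (covSummand A y₁ y₂ y₃ y₄) brillouin := by
  obtain ⟨C, hC⟩ := hA.exists_covSummand_bound y₁ y₂ y₃ y₄
  exact Measure.integrableOn_of_bounded isCompact_brillouin.measure_lt_top.ne
    (hA.measurable_covSummand _ _ _ _).aestronglyMeasurable
    (ae_of_all _ fun k => hC k)

end IsAdmissible
end

/-! ### Sums over the wave vectors of the torus -/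

/-- The integers `r` with `-m/2 ≤ r < m/2`. -/
noncomputable def halfOpenIndex (m : ℕ) : Finset ℤ :=
  (Finset.Icc (-(m : ℤ)) m).filter fun r => -(m : ℤ) ≤ 2 * r ∧ 2 * r < m

lemma mem_halfOpenIndex {m : ℕ} {r : ℤ} :
    r ∈ halfOpenIndex m ↔ -(m : ℤ) ≤ 2 * r ∧ 2 * r < m := by
  simp only [halfOpenIndex, Finset.mem_filter, Finset.mem_Icc]
  omega

lemma waveIndex_eq (m : ℕ) : waveIndex m = halfOpenIndex m ×ˢ halfOpenIndex m := by
  ext ⟨a, b⟩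
  simp only [waveIndex, halfOpenIndex, Finset.mem_filter, Finset.mem_product, Finset.mem_Icc]
  tauto

lemma sum_range_add_periodic {M : Type*} [AddCommGroup M] {m : ℕ} {f : ℤ → M}
    (hf : ∀ r, f (r + m) = f r) (a : ℤ) :
    ∑ i ∈ Finset.range m, f (a + i) = ∑ i ∈ Finset.range m, f i := by
  have step : ∀ a : ℤ, ∑ i ∈ Finset.range m, f (a + 1 + i) = ∑ i ∈ Finset.range m, f (a + i) := by
    intro a
    have h1 := Finset.sum_range_succ (fun i : ℕ => f (a + i)) m
    have h2 := Finset.sum_range_succ' (fun i : ℕ => f (a + i)) m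
    rw [h1] at h2
    simp only [Nat.cast_add, Nat.cast_one, Nat.cast_zero, add_zero, hf] at h2
    have h3 := add_right_cancel h2
    rw [h3]
    exact Finset.sum_congr rfl fun i _ => by congr 1; ring
  induction a using Int.induction_on with
  | zero => simp
  | succ i ih => rw [step, ih]
  | pred i ih => rw [← ih, ← step (-i - 1)]; congr 1; ext; congr 1; ring

lemma sum_halfOpenIndex {M : Type*} [AddCommGroup M] {m : ℕ} {f : ℤ → M}
    (hf : ∀ r, f (r + m) = f r) (a : ℤ) :
    ∑ r ∈ halfOpenIndex m, f r = ∑ i ∈ Finset.range m, f (a + i) := by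
  rw [sum_range_add_periodic hf, ← sum_range_add_periodic hf (-((m / 2 : ℕ) : ℤ))]
  symm
  refine Finset.sum_bij (s := Finset.range m) (t := halfOpenIndex m)
    (f := fun i : ℕ => f (-((m / 2 : ℕ) : ℤ) + i)) (g := f)
    (fun i _ => -((m / 2 : ℕ) : ℤ) + i) ?_ ?_ ?_ fun _ _ => rfl
  · intro i hi
    have := Finset.mem_range.1 hi
    rw [mem_halfOpenIndex]; omega
  · intro i _ j _ h
    simpa using h
  · intro r hr
    rw [mem_halfOpenIndex] at hr
    exact ⟨(r + ((m / 2 : ℕ) : ℤ)).toNat, by simp; omega, by omega⟩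

lemma sum_halfOpenIndex_neg {M : Type*} [AddCommGroup M] {m : ℕ} {f : ℤ → M}
    (hf : ∀ r, f (r + m) = f r) :
    ∑ r ∈ halfOpenIndex m, f (-r) = ∑ r ∈ halfOpenIndex m, f r := by
  have hf' : ∀ r, f (-(r + m)) = f (-r) := fun r => by
    rw [← hf (-(r + m))]; congr 1; ring
  rw [sum_halfOpenIndex hf' 0, sum_halfOpenIndex hf (-(m - 1 : ℤ)),
    ← Finset.sum_range_reflect]
  refine Finset.sum_congr rfl fun i hi => ?_
  have := Finset.mem_range.1 hi
  congr 1
  omega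

lemma sum_waveIndex_neg {M : Type*} [AddCommGroup M] {m m₂ : ℕ} {F : ℤ × ℤ → M}
    (h1 : ∀ a b, F (a, b + m) = F (a, b)) (h2 : ∀ a b, F (a + m, b - m₂) = F (a, b)) :
    ∑ r ∈ waveIndex m, F (-r) = ∑ r ∈ waveIndex m, F r := by
  have e : ∀ a : ℤ, ∑ b ∈ halfOpenIndex m, F (a, -b) = ∑ b ∈ halfOpenIndex m, F (a, b) :=
    fun a => sum_halfOpenIndex_neg (f := fun b => F (a, b)) (h1 a)
  rw [waveIndex_eq, Finset.sum_product, Finset.sum_product]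
  simp only [Prod.neg_mk]
  simp_rw [e]
  refine sum_halfOpenIndex_neg (f := fun a => ∑ b ∈ halfOpenIndex m, F (a, b)) fun a => ?_
  have e : ∀ b : ℤ, F (a + m, b) = F (a, b + m₂) := fun b => by
    rw [← h2 a, add_sub_cancel_right]
  simp_rw [e]
  rw [sum_halfOpenIndex (f := fun b => F (a, b)) (h1 a) m₂,
    sum_halfOpenIndex (f := fun b => F (a, b + m₂)) _ 0]
  · exact Finset.sum_congr rfl fun i _ => by congr 2; ring
  · intro b
    rw [← h1 a (b + m₂)]; congr 2; ring

lemma waveVector_neg (m m₂ : ℕ) (r : ℤ × ℤ) : waveVector m m₂ (-r) = -waveVector m m₂ r := by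
  ext i; fin_cases i <;> simp [waveVector]; ring

@[simp] lemma waveVector_zero (m m₂ : ℕ) : waveVector m m₂ 0 = 0 := by
  ext i; fin_cases i <;> simp [waveVector]

lemma waveVector_add_snd (m m₂ : ℕ) [NeZero m] (a b : ℤ) :
    waveVector m m₂ (a, b + m) = waveVector m m₂ (a, b) + (2 * Real.pi) • latticePoint (0, 1) := by
  have : (m : ℝ) ≠ 0 := NeZero.ne _
  ext i; fin_cases i <;> simp [waveVector, latticePoint]; field_simp; ring

lemma waveVector_add_fst (m m₂ : ℕ) [NeZero m] (a b : ℤ) :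
    waveVector m m₂ (a + m, b - m₂) =
      waveVector m m₂ (a, b) + (2 * Real.pi) • latticePoint (1, 0) := by
  have : (m : ℝ) ≠ 0 := NeZero.ne _
  ext i; fin_cases i <;> simp [waveVector, latticePoint]
  · field_simp
  · field_simp; ring_nf; simp

lemma wave_waveVector (m m₂ : ℕ) (r p : ℤ × ℤ) : wave (waveVector m m₂ r) p =
    Complex.exp (((2 * Real.pi / m * (r.1 * (p.1 + m₂ / m * p.2) + r.2 * p.2) : ℝ) : ℂ) *
      Complex.I) := by
  rw [wave_eq]
  congr 3
  simp [waveVector]; ring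

lemma wave_waveVector_of_mem (m m₂ : ℕ) [NeZero m] (r : ℤ × ℤ) {l : ℤ × ℤ}
    (hl : l ∈ torusLattice m m₂) : wave (waveVector m m₂ r) l = 1 := by
  have : (m : ℝ) ≠ 0 := NeZero.ne _
  obtain ⟨j₁, j₂, rfl⟩ := hl
  rw [wave_waveVector, Complex.exp_eq_one_iff]
  refine ⟨r.1 * j₁ + r.2 * j₂, ?_⟩
  have h : 2 * Real.pi / m * (r.1 * (((j₁ * m - j₂ * m₂ : ℤ) : ℝ) + m₂ / m * ((j₂ * m : ℤ) : ℝ)) +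
      r.2 * ((j₂ * m : ℤ) : ℝ)) = 2 * Real.pi * (r.1 * j₁ + r.2 * j₂) := by
    push_cast; field_simp; ring
  rw [h]
  push_cast; ring

/-- The characters of the torus. -/
noncomputable def torusChar (m m₂ : ℕ) (r : ℤ × ℤ) (P : Torus m m₂) : ℂ :=
  wave (waveVector m m₂ r) (Quotient.out P)

section
variable {m m₂ : ℕ} [NeZero m]

lemma torusChar_mk (r p : ℤ × ℤ) :
    torusChar m m₂ r (toTorus m m₂ p) = wave (waveVector m m₂ r) p := by
  obtain ⟨l, hl⟩ := QuotientAddGroup.mk_out_eq_add (torusLattice m m₂) p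
  have h : Quotient.out (toTorus m m₂ p) = p + l := hl
  rw [torusChar, h, wave_add_right, wave_waveVector_of_mem m m₂ r l.2, mul_one]

lemma torusChar_add (r : ℤ × ℤ) (P Q : Torus m m₂) :
    torusChar m m₂ r (P + Q) = torusChar m m₂ r P * torusChar m m₂ r Q := by
  obtain ⟨p, rfl⟩ := QuotientAddGroup.mk_surjective P
  obtain ⟨q, rfl⟩ := QuotientAddGroup.mk_surjective Q
  rw [← QuotientAddGroup.mk_add, torusChar_mk, torusChar_mk, torusChar_mk, wave_add_right]

lemma torusChar_neg (r : ℤ × ℤ) (P : Torus m m₂) :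
    torusChar m m₂ r (-P) = (starRingEnd ℂ) (torusChar m m₂ r P) := by
  obtain ⟨p, rfl⟩ := QuotientAddGroup.mk_surjective P
  rw [← QuotientAddGroup.mk_neg, torusChar_mk, torusChar_mk, wave_neg_right, wave_neg_left]

lemma torusChar_sub (r : ℤ × ℤ) (P Q : Torus m m₂) :
    torusChar m m₂ r (P - Q) =
      torusChar m m₂ r P * (starRingEnd ℂ) (torusChar m m₂ r Q) := by
  rw [sub_eq_add_neg, torusChar_add, torusChar_neg]

omit [NeZero m] in
@[simp] lemma torusChar_zero_left (P : Torus m m₂) : torusChar m m₂ 0 P = 1 := by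
  simp [torusChar]

lemma sum_exp_range (j : ℤ) :
    ∑ i ∈ Finset.range m, Complex.exp (((2 * Real.pi / m * (i * j) : ℝ) : ℂ) * Complex.I) =
      if (m : ℤ) ∣ j then (m : ℂ) else 0 := by
  have hm : (m : ℂ) ≠ 0 := NeZero.ne _
  have hpow : ∀ i : ℕ, Complex.exp (((2 * Real.pi / m * (i * j) : ℝ) : ℂ) * Complex.I) =
      Complex.exp (2 * Real.pi * Complex.I * (j / m)) ^ i := by
    intro i
    rw [← Complex.exp_nat_mul]
    congr 1
    push_cast; ring
  simp_rw [hpow]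
  split_ifs with h
  · obtain ⟨l, rfl⟩ := h
    have : Complex.exp (2 * Real.pi * Complex.I * (((m * l : ℤ) : ℂ) / m)) = 1 := by
      rw [Complex.exp_eq_one_iff]
      refine ⟨l, ?_⟩
      push_cast; field_simp
    simp only [this, one_pow, Finset.sum_const, Finset.card_range, nsmul_eq_mul, mul_one]
  · have hne : Complex.exp (2 * Real.pi * Complex.I * (j / m)) ≠ 1 := by
      rw [Ne, Complex.exp_eq_one_iff]
      rintro ⟨n, hn⟩
      apply h
      have hpi : (2 * Real.pi * Complex.I : ℂ) ≠ 0 := Complex.two_pi_I_ne_zero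
      rw [mul_comm (n : ℂ), mul_right_inj' hpi, div_eq_iff hm] at hn
      exact ⟨n, by rw [mul_comm]; exact_mod_cast hn⟩
    rw [geom_sum_eq hne, ← Complex.exp_nat_mul]
    have : Complex.exp (m * (2 * Real.pi * Complex.I * (j / m))) = 1 := by
      rw [Complex.exp_eq_one_iff]
      refine ⟨j, ?_⟩
      field_simp
    rw [this, sub_self, zero_div]

lemma sum_exp_halfOpenIndex (j : ℤ) :
    ∑ r ∈ halfOpenIndex m, Complex.exp (((2 * Real.pi / m * (r * j) : ℝ) : ℂ) * Complex.I) =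
      if (m : ℤ) ∣ j then (m : ℂ) else 0 := by
  have hm : (m : ℂ) ≠ 0 := NeZero.ne _
  rw [← sum_exp_range, sum_halfOpenIndex _ 0]
  · simp
  · intro r
    have : ((2 * Real.pi / m * (((r + m : ℤ) : ℝ) * j) : ℝ) : ℂ) * Complex.I =
        ((2 * Real.pi / m * (r * j) : ℝ) : ℂ) * Complex.I + j * (2 * Real.pi * Complex.I) := by
      push_cast; field_simp
    rw [this, Complex.exp_add, Complex.exp_int_mul_two_pi_mul_I, mul_one]

open Classical in
/-- Orthogonality of the characters of the torus. -/
lemma sum_torusChar (P : Torus m m₂) :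
    ∑ r ∈ waveIndex m, torusChar m m₂ r P = if P = 0 then (m : ℂ) ^ 2 else 0 := by
  have hm : (m : ℝ) ≠ 0 := NeZero.ne _
  obtain ⟨p, rfl⟩ := QuotientAddGroup.mk_surjective P
  have hmem : ((p : Torus m m₂) = 0) ↔ p ∈ torusLattice m m₂ := QuotientAddGroup.eq_zero_iff p
  simp_rw [torusChar_mk, wave_waveVector, hmem]
  rw [waveIndex_eq, Finset.sum_product]
  have hfac : ∀ r₁ r₂ : ℤ, Complex.exp (((2 * Real.pi / m * (r₁ * (p.1 + m₂ / m * p.2) +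
      r₂ * p.2) : ℝ) : ℂ) * Complex.I) =
      Complex.exp (((2 * Real.pi / m * (r₁ * (p.1 + m₂ / m * p.2)) : ℝ) : ℂ) * Complex.I) *
      Complex.exp (((2 * Real.pi / m * (r₂ * p.2) : ℝ) : ℂ) * Complex.I) := by
    intro r₁ r₂
    rw [← Complex.exp_add]; push_cast; ring_nf
  simp_rw [hfac, ← Finset.mul_sum, sum_exp_halfOpenIndex]
  by_cases h2 : (m : ℤ) ∣ p.2
  · obtain ⟨j, hj⟩ := h2
    have e : ∀ r₁ : ℤ, 2 * Real.pi / m * (r₁ * (p.1 + m₂ / m * p.2)) =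
        2 * Real.pi / m * (r₁ * ((p.1 + m₂ * j : ℤ) : ℝ)) := by
      intro r₁
      rw [hj]; push_cast; field_simp
    simp_rw [e, if_pos (show (m : ℤ) ∣ p.2 from ⟨j, hj⟩), ← Finset.sum_mul,
      sum_exp_halfOpenIndex]
    have hiff : (m : ℤ) ∣ p.1 + m₂ * j ↔ p ∈ torusLattice m m₂ := by
      constructor
      · rintro ⟨l, hl⟩
        refine ⟨l, j, ?_⟩
        ext
        · simp only; linarith
        · simp only; linarith
      · rintro ⟨l, j', h⟩
        have h1 : p.1 = l * m - j' * m₂ := by rw [h]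
        have h2 : p.2 = j' * m := by rw [h]
        have hm' : (m : ℤ) ≠ 0 := NeZero.ne _
        have : j = j' := by
          have : (m : ℤ) * j = m * j' := by rw [← hj, h2]; ring
          exact mul_left_cancel₀ hm' this
        subst this
        exact ⟨l, by rw [h1]; ring⟩
    simp only [hiff]
    split_ifs <;> ring
  · simp only [if_neg h2, mul_zero, Finset.sum_const_zero]
    rw [if_neg]
    rintro ⟨l, j', h⟩
    exact h2 ⟨j', by rw [h]; ring⟩

end

lemma covSummand_neg {A : ℤ × ℤ → ℤ × ℤ → ℝ} (y₁ y₂ y₃ y₄ : ℤ × ℤ) (k : Plane) :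
    covSummand A y₁ y₂ y₃ y₄ (-k) = (starRingEnd ℂ) (covSummand A y₁ y₂ y₃ y₄ k) := by
  simp only [covSummand, map_div₀, map_mul, map_sub, wave_neg_left, Rhat_neg, Complex.conj_ofReal,
    Complex.conj_conj]

lemma zero_mem_waveIndex (m : ℕ) [NeZero m] : ((0, 0) : ℤ × ℤ) ∈ waveIndex m := by
  have : 0 < m := Nat.pos_of_ne_zero (NeZero.ne m)
  rw [waveIndex_eq, Finset.mem_product]
  simp only [mem_halfOpenIndex]
  omega

lemma covSummand_zero {A : ℤ × ℤ → ℤ × ℤ → ℝ} (y₁ y₂ y₃ y₄ : ℤ × ℤ) :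
    covSummand A y₁ y₂ y₃ y₄ 0 = 0 := by simp [covSummand]

lemma torusCov_eq {A : ℤ × ℤ → ℤ × ℤ → ℝ} (v : ℝ) (m m₂ : ℕ) (y₁ y₂ y₃ y₄ : ℤ × ℤ) :
    torusCov A v m m₂ y₁ y₂ y₃ y₄ = -((v : ℂ) / (m : ℂ) ^ 2) *
      ∑ r ∈ waveIndex m, covSummand A y₁ y₂ y₃ y₄ (waveVector m m₂ r) := by
  rw [torusCov, Finset.sum_erase]
  exact (congrArg _ (waveVector_zero m m₂)).trans (covSummand_zero _ _ _ _)

lemma covSummand_waveVector_add_snd {A : ℤ × ℤ → ℤ × ℤ → ℝ} (m m₂ : ℕ) [NeZero m]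
    (y₁ y₂ y₃ y₄ : ℤ × ℤ) (a b : ℤ) :
    covSummand A y₁ y₂ y₃ y₄ (waveVector m m₂ (a, b + m)) =
      covSummand A y₁ y₂ y₃ y₄ (waveVector m m₂ (a, b)) := by
  rw [waveVector_add_snd, covSummand_periodic]

lemma covSummand_waveVector_add_fst {A : ℤ × ℤ → ℤ × ℤ → ℝ} (m m₂ : ℕ) [NeZero m]
    (y₁ y₂ y₃ y₄ : ℤ × ℤ) (a b : ℤ) :
    covSummand A y₁ y₂ y₃ y₄ (waveVector m m₂ (a + m, b - m₂)) =
      covSummand A y₁ y₂ y₃ y₄ (waveVector m m₂ (a, b)) := by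
  rw [waveVector_add_fst, covSummand_periodic]

lemma conj_torusCov {A : ℤ × ℤ → ℤ × ℤ → ℝ} (v : ℝ) (m m₂ : ℕ) [NeZero m]
    (y₁ y₂ y₃ y₄ : ℤ × ℤ) :
    (starRingEnd ℂ) (torusCov A v m m₂ y₁ y₂ y₃ y₄) = torusCov A v m m₂ y₁ y₂ y₃ y₄ := by
  rw [torusCov_eq, map_mul, map_sum]
  simp_rw [← covSummand_neg, ← waveVector_neg]
  rw [sum_waveIndex_neg (m₂ := m₂) (F := fun r => covSummand A y₁ y₂ y₃ y₄ (waveVector m m₂ r))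
    (covSummand_waveVector_add_snd m m₂ _ _ _ _)
    (covSummand_waveVector_add_fst m m₂ _ _ _ _)]
  simp

lemma ofReal_re_torusCov {A : ℤ × ℤ → ℤ × ℤ → ℝ} (v : ℝ) (m m₂ : ℕ) [NeZero m]
    (y₁ y₂ y₃ y₄ : ℤ × ℤ) :
    ((torusCov A v m m₂ y₁ y₂ y₃ y₄).re : ℂ) = torusCov A v m m₂ y₁ y₂ y₃ y₄ :=
  Complex.conj_eq_iff_re.1 (conj_torusCov v m m₂ _ _ _ _)

lemma IsAdmissible.Rhat_waveVector_neg {A : ℤ × ℤ → ℤ × ℤ → ℝ} {What : Matrix (Fin 2) (Fin 2) ℝ}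
    (hA : IsAdmissible A What) {m m₂ : ℕ} [NeZero m] {r : ℤ × ℤ} (hr : r ∈ waveIndex m)
    (h0 : r ≠ 0) : Rhat A (waveVector m m₂ r) < 0 := by
  refine lt_of_le_of_ne (hA.nonpos _) fun h => h0 ?_
  have hm : (0 : ℝ) < m := by exact_mod_cast Nat.pos_of_ne_zero (NeZero.ne m)
  obtain ⟨n, hn, -⟩ := exists_mem_brillouin (waveVector m m₂ r)
  have hz := hA.eq_zero _ hn (by rw [Rhat_periodic, h])
  rw [waveIndex_eq, Finset.mem_product, mem_halfOpenIndex, mem_halfOpenIndex] at hr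
  have key : ∀ a b : ℤ, -(m : ℤ) ≤ 2 * a → 2 * a < m → (a : ℝ) = m * b → a = 0 := by
    intro a b ha hb hab
    have hab' : a = m * b := by exact_mod_cast hab
    have hm' : (0 : ℤ) < m := by exact_mod_cast hm
    have h1 : b < 1 := by
      by_contra hcon
      nlinarith [not_lt.1 hcon]
    have h2 : -1 < b := by
      by_contra hcon
      nlinarith [not_lt.1 hcon]
    have : b = 0 := by omega
    rw [hab', this, mul_zero]
  have hpi := Real.pi_pos
  have h1 : r.1 = 0 := by
    have := congrFun (congrArg WithLp.ofLp hz) 0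
    simp [waveVector, latticePoint] at this
    refine key _ (-n.1) hr.1.1 hr.1.2 ?_
    push_cast
    field_simp at this
    nlinarith
  have h2 : r.2 = 0 := by
    have := congrFun (congrArg WithLp.ofLp hz) 1
    simp [waveVector, latticePoint, h1] at this
    refine key _ (-n.2) hr.2.1 hr.2.2 ?_
    push_cast
    field_simp at this
    nlinarith
  exact Prod.ext h1 h2

/-! ### The drift matrix on the torus -/

section
variable {A : ℤ × ℤ → ℤ × ℤ → ℝ} {What : Matrix (Fin 2) (Fin 2) ℝ} {m m₂ : ℕ} [NeZero m]

omit [NeZero m] in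
open Classical in
lemma IsAdmissible.torusMatrix_apply (hA : IsAdmissible A What) (P P' : Torus m m₂) :
    torusMatrix A m m₂ P P' = ∑' s : ℤ × ℤ, if toTorus m m₂ s + P' = P then A s 0 else 0 := by
  rw [torusMatrix, ← (Equiv.addRight (Quotient.out P')).tsum_eq]
  refine tsum_congr fun s => ?_
  have h : toTorus m m₂ (s + Quotient.out P') = toTorus m m₂ s + P' := by
    rw [toTorus, QuotientAddGroup.mk_add]
    congr 1
    exact QuotientAddGroup.out_eq' P'
  simp only [Equiv.coe_addRight, h]
  rw [hA.apply_eq (s + _), add_sub_cancel_right]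

lemma IsAdmissible.summable_ite (hA : IsAdmissible A What) (p : ℤ × ℤ → Prop) [DecidablePred p] :
    Summable fun s : ℤ × ℤ => if p s then A s 0 else 0 :=
  Summable.of_norm_bounded hA.summable.norm fun s => by split_ifs <;> simp

lemma IsAdmissible.sum_torusMatrix_mul (hA : IsAdmissible A What) (P : Torus m m₂)
    (g : Torus m m₂ → ℂ) :
    ∑ P', (torusMatrix A m m₂ P P' : ℂ) * g P' =
      ∑' s : ℤ × ℤ, (A s 0 : ℂ) * g (P - toTorus m m₂ s) := by
  classical
  have h : ∀ P', (torusMatrix A m m₂ P P' : ℂ) * g P' = ∑' s : ℤ × ℤ,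
      ((if toTorus m m₂ s + P' = P then A s 0 else 0 : ℝ) : ℂ) * g P' := by
    intro P'
    rw [hA.torusMatrix_apply, Complex.ofReal_tsum, tsum_mul_right]
  simp_rw [h]
  rw [← Summable.tsum_finsetSum]
  · refine tsum_congr fun s => ?_
    rw [Finset.sum_eq_single (P - toTorus m m₂ s)]
    · simp
    · intro Q _ hQ
      rw [if_neg, Complex.ofReal_zero, zero_mul]
      rintro rfl; simp at hQ
    · simp
  · intro P' _
    exact Summable.mul_right _ (Complex.hasSum_ofReal.2
      (hA.summable_ite fun s => toTorus m m₂ s + P' = P).hasSum).summable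

lemma IsAdmissible.sum_torusMatrix_mul' (hA : IsAdmissible A What) (P' : Torus m m₂)
    (g : Torus m m₂ → ℂ) :
    ∑ P, (torusMatrix A m m₂ P P' : ℂ) * g P =
      ∑' s : ℤ × ℤ, (A s 0 : ℂ) * g (P' + toTorus m m₂ s) := by
  classical
  have h : ∀ P, (torusMatrix A m m₂ P P' : ℂ) * g P = ∑' s : ℤ × ℤ,
      ((if toTorus m m₂ s + P' = P then A s 0 else 0 : ℝ) : ℂ) * g P := by
    intro P
    rw [hA.torusMatrix_apply, Complex.ofReal_tsum, tsum_mul_right]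
  simp_rw [h]
  rw [← Summable.tsum_finsetSum]
  · refine tsum_congr fun s => ?_
    rw [Finset.sum_eq_single (P' + toTorus m m₂ s)]
    · simp [add_comm]
    · intro Q _ hQ
      rw [if_neg, Complex.ofReal_zero, zero_mul]
      rintro rfl; simp [add_comm] at hQ
    · simp
  · intro P _
    exact Summable.mul_right _ (Complex.hasSum_ofReal.2
      (hA.summable_ite fun s => toTorus m m₂ s + P' = P).hasSum).summable

lemma IsAdmissible.sum_torusMatrix_mul_torusChar (hA : IsAdmissible A What) (r : ℤ × ℤ)
    (P Q : Torus m m₂) :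
    ∑ P', (torusMatrix A m m₂ P P' : ℂ) * torusChar m m₂ r (P' - Q) =
      Ahat A (waveVector m m₂ r) * torusChar m m₂ r (P - Q) := by
  rw [hA.sum_torusMatrix_mul P fun P' => torusChar m m₂ r (P' - Q), Ahat, ← tsum_mul_right]
  refine tsum_congr fun s => ?_
  rw [sub_right_comm, torusChar_sub r (P - Q), torusChar_mk, wave_neg_left]
  ring

lemma IsAdmissible.sum_torusMatrix_mul_torusChar' (hA : IsAdmissible A What) (r : ℤ × ℤ)
    (P' : Torus m m₂) :
    ∑ P, (torusMatrix A m m₂ P P' : ℂ) * torusChar m m₂ r P =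
      Ahat A (-waveVector m m₂ r) * torusChar m m₂ r P' := by
  rw [hA.sum_torusMatrix_mul' P', Ahat, ← tsum_mul_right]
  refine tsum_congr fun s => ?_
  rw [torusChar_add, torusChar_mk, neg_neg]
  ring

lemma IsAdmissible.sum_torusMatrix' (hA : IsAdmissible A What) (P : Torus m m₂) :
    ∑ P', torusMatrix A m m₂ P P' = 0 := by
  have h := hA.sum_torusMatrix_mul_torusChar 0 P 0
  simp only [torusChar_zero_left, mul_one, waveVector_zero, hA.Ahat_zero] at h
  exact_mod_cast h

/-! ### The covariance matrix on the torus -/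

/-- The function `-(v/m²) ∑_k cos(k·P) / R̂(k)`, in which the term `k = 0` vanishes. -/
noncomputable def torusGreen (A : ℤ × ℤ → ℤ × ℤ → ℝ) (v : ℝ) (m m₂ : ℕ) (P : Torus m m₂) : ℝ :=
  -(v / m ^ 2) * ∑ r ∈ waveIndex m, (torusChar m m₂ r P).re / Rhat A (waveVector m m₂ r)

lemma torusGreen_neg (v : ℝ) (P : Torus m m₂) :
    torusGreen A v m m₂ (-P) = torusGreen A v m m₂ P := by
  simp only [torusGreen, torusChar_neg, Complex.conj_re]

open Classical in
/-- The Lyapunov equation for the covariance matrix. -/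
lemma IsAdmissible.lyapunov (hA : IsAdmissible A What) (v : ℝ) (P Q : Torus m m₂) :
    (∑ P', torusMatrix A m m₂ P P' * torusGreen A v m m₂ (P' - Q)) +
      (∑ P', torusMatrix A m m₂ Q P' * torusGreen A v m m₂ (P' - P)) =
      -v * (if P = Q then 1 else 0) + v / m ^ 2 := by
  have hm : (m : ℝ) ≠ 0 := NeZero.ne _
  have h1 : ∀ P Q : Torus m m₂, ∑ P', torusMatrix A m m₂ P P' * torusGreen A v m m₂ (P' - Q) =
      -(v / m ^ 2) * ∑ r ∈ waveIndex m, (Ahat A (waveVector m m₂ r) *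
        torusChar m m₂ r (P - Q)).re / Rhat A (waveVector m m₂ r) := by
    intro P Q
    simp only [torusGreen, Finset.mul_sum]
    rw [Finset.sum_comm]
    refine Finset.sum_congr rfl fun r _ => ?_
    rw [← hA.sum_torusMatrix_mul_torusChar, Complex.re_sum, Finset.sum_div, Finset.mul_sum]
    refine Finset.sum_congr rfl fun P' _ => ?_
    rw [Complex.re_ofReal_mul]
    ring
  rw [h1, h1, ← mul_add, ← Finset.sum_add_distrib]
  have h2 : ∀ r ∈ waveIndex m, (Ahat A (waveVector m m₂ r) *
        torusChar m m₂ r (P - Q)).re / Rhat A (waveVector m m₂ r) +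
      (Ahat A (waveVector m m₂ r) *
        torusChar m m₂ r (Q - P)).re / Rhat A (waveVector m m₂ r) =
      (torusChar m m₂ r (P - Q)).re - if r = 0 then 1 else 0 := by
    intro r hr
    split_ifs with h0
    · subst h0
      simp [hA.Rhat_zero]
    · have hR := (hA.Rhat_waveVector_neg (m₂ := m₂) hr h0).ne
      rw [← neg_sub P Q, torusChar_neg, ← add_div, div_eq_iff hR, Rhat_eq_two_re]
      simp only [Complex.mul_re, Complex.conj_re, Complex.conj_im]
      ring
  rw [Finset.sum_congr rfl h2, Finset.sum_sub_distrib, ← Complex.re_sum, sum_torusChar,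
    Finset.sum_ite_eq', if_pos (show (0 : ℤ × ℤ) ∈ waveIndex m from zero_mem_waveIndex m)]
  simp only [sub_eq_zero]
  split_ifs
  · rw [← Complex.ofReal_natCast, ← Complex.ofReal_pow, Complex.ofReal_re]
    field_simp; ring
  · simp

/-- The quadratic form of the covariance matrix. -/
noncomputable def torusForm (A : ℤ × ℤ → ℤ × ℤ → ℝ) (v : ℝ) (m m₂ : ℕ) [NeZero m]
    (u : Torus m m₂ → ℝ) : ℝ :=
  ∑ P, ∑ Q, u P * torusGreen A v m m₂ (P - Q) * u Q

lemma torusForm_eq (v : ℝ) (u : Torus m m₂ → ℝ) :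
    torusForm A v m m₂ u = -(v / m ^ 2) * ∑ r ∈ waveIndex m,
      Complex.normSq (∑ P, u P * torusChar m m₂ r P) / Rhat A (waveVector m m₂ r) := by
  have h : ∀ r, Complex.normSq (∑ P, u P * torusChar m m₂ r P) =
      ∑ P, ∑ Q, u P * (torusChar m m₂ r (P - Q)).re * u Q := by
    intro r
    have : (Complex.normSq (∑ P, u P * torusChar m m₂ r P) : ℂ) =
        ∑ P, ∑ Q, u P * torusChar m m₂ r (P - Q) * u Q := by
      rw [← Complex.mul_conj, map_sum, Finset.sum_mul_sum]
      refine Finset.sum_congr rfl fun P _ => Finset.sum_congr rfl fun Q _ => ?_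
      rw [torusChar_sub, map_mul, Complex.conj_ofReal]
      ring
    rw [← Complex.ofReal_re (Complex.normSq _), this, Complex.re_sum]
    refine Finset.sum_congr rfl fun P _ => ?_
    rw [Complex.re_sum]
    refine Finset.sum_congr rfl fun Q _ => ?_
    rw [Complex.re_mul_ofReal, Complex.re_ofReal_mul]
  simp_rw [h, torusForm, torusGreen, Finset.sum_div, Finset.mul_sum, Finset.sum_mul]
  symm
  rw [Finset.sum_comm]
  refine Finset.sum_congr rfl fun P _ => ?_
  rw [Finset.sum_comm]
  refine Finset.sum_congr rfl fun Q _ => Finset.sum_congr rfl fun r _ => ?_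
  ring

lemma IsAdmissible.torusForm_nonneg (hA : IsAdmissible A What) {v : ℝ} (hv : 0 ≤ v)
    (u : Torus m m₂ → ℝ) : 0 ≤ torusForm A v m m₂ u := by
  rw [torusForm_eq, neg_mul, ← mul_neg, ← Finset.sum_neg_distrib]
  refine mul_nonneg (by positivity) (Finset.sum_nonneg fun r _ => ?_)
  rw [← div_neg]
  exact div_nonneg (Complex.normSq_nonneg _) (by linarith [hA.nonpos (waveVector m m₂ r)])

lemma continuous_torusForm (v : ℝ) : Continuous (torusForm A v m m₂) := by
  unfold torusForm; fun_prop

/-! ### The dual flow -/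

/-- The solution of `c' = Bᵀ c` with `c 0 = u`. -/
noncomputable def dualFlow (A : ℤ × ℤ → ℤ × ℤ → ℝ) (m m₂ : ℕ) [NeZero m] (u : Torus m m₂ → ℝ)
    (τ : ℝ) (P : Torus m m₂) : ℝ :=
  (∑ r ∈ waveIndex m, (((m : ℂ) ^ 2)⁻¹ * ∑ Q, u Q * torusChar m m₂ r (-Q)) *
    torusChar m m₂ r P * Complex.exp (τ * Ahat A (-waveVector m m₂ r))).re

lemma dualFlow_zero (u : Torus m m₂ → ℝ) (P : Torus m m₂) : dualFlow A m m₂ u 0 P = u P := by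
  classical
  have hm : (m : ℂ) ≠ 0 := NeZero.ne _
  have h : ∑ r ∈ waveIndex m, (((m : ℂ) ^ 2)⁻¹ * ∑ Q, u Q * torusChar m m₂ r (-Q)) *
      torusChar m m₂ r P * Complex.exp ((0 : ℝ) * Ahat A (-waveVector m m₂ r)) = u P := by
    have e : ∀ r, (((m : ℂ) ^ 2)⁻¹ * ∑ Q, u Q * torusChar m m₂ r (-Q)) *
      torusChar m m₂ r P * Complex.exp ((0 : ℝ) * Ahat A (-waveVector m m₂ r)) =
      ∑ Q, ((m : ℂ) ^ 2)⁻¹ * u Q * torusChar m m₂ r (P - Q) := by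
      intro r
      simp only [Complex.ofReal_zero, zero_mul, Complex.exp_zero, mul_one]
      rw [Finset.mul_sum, Finset.sum_mul]
      refine Finset.sum_congr rfl fun Q _ => ?_
      rw [sub_eq_add_neg, torusChar_add]; ring
    simp_rw [e]
    rw [Finset.sum_comm]
    simp_rw [← Finset.mul_sum, sum_torusChar, sub_eq_zero]
    simp only [mul_ite, mul_zero, Finset.sum_ite_eq, Finset.mem_univ, if_true]
    field_simp
  rw [dualFlow, h, Complex.ofReal_re]

lemma IsAdmissible.hasDerivAt_dualFlow (hA : IsAdmissible A What) (u : Torus m m₂ → ℝ) (τ : ℝ)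
    (P : Torus m m₂) : HasDerivAt (fun τ => dualFlow A m m₂ u τ P)
      (∑ P', torusMatrix A m m₂ P' P * dualFlow A m m₂ u τ P') τ := by
  have h1 : ∀ (a lam : ℂ), HasDerivAt (fun τ : ℝ => a * Complex.exp (τ * lam))
      (a * (lam * Complex.exp (τ * lam))) τ := by
    intro a lam
    have h := ((Complex.ofRealCLM.hasDerivAt (x := τ)).mul_const lam).cexp.const_mul a
    simp only [Complex.ofRealCLM_apply, Complex.ofReal_one, one_mul] at h
    rw [mul_comm lam]
    exact h
  have h2 := HasDerivAt.fun_sum (u := waveIndex m) fun r _ =>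
    h1 ((((m : ℂ) ^ 2)⁻¹ * ∑ Q, u Q * torusChar m m₂ r (-Q)) * torusChar m m₂ r P)
      (Ahat A (-waveVector m m₂ r))
  have h3 := Complex.reCLM.hasFDerivAt.comp_hasDerivAt τ h2
  refine h3.congr_deriv ?_
  have h4 : ((∑ P', torusMatrix A m m₂ P' P * dualFlow A m m₂ u τ P' : ℝ)) =
      (∑ P', (torusMatrix A m m₂ P' P : ℂ) * ∑ r ∈ waveIndex m,
        (((m : ℂ) ^ 2)⁻¹ * ∑ Q, u Q * torusChar m m₂ r (-Q)) *
        torusChar m m₂ r P' * Complex.exp (τ * Ahat A (-waveVector m m₂ r))).re := by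
    rw [Complex.re_sum]
    refine Finset.sum_congr rfl fun P' _ => ?_
    rw [Complex.re_ofReal_mul, dualFlow]
  rw [h4, Complex.reCLM_apply]
  congr 1
  simp_rw [Finset.mul_sum (s := waveIndex m)]
  rw [Finset.sum_comm]
  refine Finset.sum_congr rfl fun r _ => ?_
  have h5 := hA.sum_torusMatrix_mul_torusChar' r P
  calc _ = (((m : ℂ) ^ 2)⁻¹ * ∑ Q, u Q * torusChar m m₂ r (-Q)) *
        (Ahat A (-waveVector m m₂ r) * torusChar m m₂ r P) *
          Complex.exp (τ * Ahat A (-waveVector m m₂ r)) := by ring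
    _ = _ := by
      rw [← h5, Finset.mul_sum, Finset.sum_mul]
      exact Finset.sum_congr rfl fun _ _ => by ring

lemma IsAdmissible.sum_dualFlow (hA : IsAdmissible A What) (u : Torus m m₂ → ℝ) (τ : ℝ) :
    ∑ P, dualFlow A m m₂ u τ P = ∑ P, u P := by
  have hd : ∀ τ, HasDerivAt (fun τ => ∑ P, dualFlow A m m₂ u τ P) 0 τ := by
    intro τ
    have h := HasDerivAt.fun_sum (u := Finset.univ) fun P _ => hA.hasDerivAt_dualFlow u τ P
    refine h.congr_deriv ?_
    rw [Finset.sum_comm]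
    refine Finset.sum_eq_zero fun P' _ => ?_
    rw [← Finset.sum_mul, hA.sum_torusMatrix', zero_mul]
  have := is_const_of_deriv_eq_zero (fun τ => (hd τ).differentiableAt) (fun τ => (hd τ).deriv) τ 0
  rw [this]
  exact Finset.sum_congr rfl fun P _ => dualFlow_zero u P

lemma IsAdmissible.tendsto_dualFlow (hA : IsAdmissible A What) {u : Torus m m₂ → ℝ}
    (hu : ∑ P, u P = 0) (P : Torus m m₂) :
    Tendsto (fun τ => dualFlow A m m₂ u τ P) atTop (𝓝 0) := by
  have h : Tendsto (fun τ : ℝ => ∑ r ∈ waveIndex m,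
      (((m : ℂ) ^ 2)⁻¹ * ∑ Q, u Q * torusChar m m₂ r (-Q)) *
      torusChar m m₂ r P * Complex.exp (τ * Ahat A (-waveVector m m₂ r))) atTop (𝓝 0) := by
    rw [← Finset.sum_const_zero (s := waveIndex m)]
    refine tendsto_finsetSum _ fun r hr => ?_
    by_cases h0 : r = 0
    · subst h0
      have : ∑ Q, (u Q : ℂ) * torusChar m m₂ 0 (-Q) = 0 := by
        simp only [torusChar_zero_left, mul_one]
        exact_mod_cast hu
      rw [this]
      simp
    · rw [← mul_zero ((((m : ℂ) ^ 2)⁻¹ * ∑ Q, u Q * torusChar m m₂ r (-Q)) *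
        torusChar m m₂ r P)]
      refine tendsto_const_nhds.mul ?_
      rw [tendsto_zero_iff_norm_tendsto_zero]
      have hneg : (Ahat A (-waveVector m m₂ r)).re < 0 := by
        have h1 := hA.Rhat_waveVector_neg (m₂ := m₂) hr h0
        rw [← Rhat_neg, Rhat_eq_two_re] at h1
        linarith
      simp_rw [Complex.norm_exp, Complex.re_ofReal_mul]
      exact Real.tendsto_exp_atBot.comp (tendsto_id.atTop_mul_const_of_neg hneg)
  have := (Complex.continuous_re.tendsto 0).comp h
  exact this

/-- The covariance form along the dual flow. -/
lemma IsAdmissible.torusForm_sub_dualFlow (hA : IsAdmissible A What) (v : ℝ)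
    {u : Torus m m₂ → ℝ} (hu : ∑ P, u P = 0) (t : ℝ) :
    torusForm A v m m₂ u - torusForm A v m m₂ (dualFlow A m m₂ u t) =
      v * ∑ P, ∫ s in (0 : ℝ)..t, dualFlow A m m₂ u (t - s) P ^ 2 := by
  classical
  have hc : ∀ P, Continuous fun τ => dualFlow A m m₂ u τ P := fun P =>
    continuous_iff_continuousAt.2 fun τ => (hA.hasDerivAt_dualFlow u τ P).continuousAt
  have hd : ∀ τ, HasDerivAt (fun τ => torusForm A v m m₂ (dualFlow A m m₂ u τ))
      (-v * ∑ P, dualFlow A m m₂ u τ P ^ 2) τ := by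
    intro τ
    set c := dualFlow A m m₂ u with hcdef
    set B := torusMatrix A m m₂
    set G := torusGreen A v m m₂
    have h := HasDerivAt.fun_sum (u := Finset.univ) fun P _ =>
      HasDerivAt.fun_sum (u := Finset.univ) fun Q _ =>
        ((hA.hasDerivAt_dualFlow u τ P).mul_const (G (P - Q))).mul (hA.hasDerivAt_dualFlow u τ Q)
    refine h.congr_deriv ?_
    set D : Torus m m₂ → Torus m m₂ → ℝ := fun P Q => ∑ P', B P P' * G (P' - Q) with hD
    have hG : ∀ P, G (-P) = G P := torusGreen_neg v
    have hL : ∀ P Q, D P Q + D Q P = -v * (if P = Q then 1 else 0) + v / m ^ 2 := hA.lyapunov v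
    have e1 : ∑ P, ∑ Q, (∑ P', B P' P * c τ P') * G (P - Q) * c τ Q =
        ∑ P, ∑ Q, c τ P * c τ Q * D P Q := by
      calc _ = ∑ P, ∑ Q, ∑ R, B R P * c τ R * G (P - Q) * c τ Q := by
            simp_rw [Finset.sum_mul]
        _ = ∑ P, ∑ R, ∑ Q, B R P * c τ R * G (P - Q) * c τ Q :=
            Finset.sum_congr rfl fun P _ => Finset.sum_comm
        _ = ∑ R, ∑ P, ∑ Q, B R P * c τ R * G (P - Q) * c τ Q := Finset.sum_comm
        _ = ∑ R, ∑ Q, ∑ P, B R P * c τ R * G (P - Q) * c τ Q :=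
            Finset.sum_congr rfl fun R _ => Finset.sum_comm
        _ = _ := by
            refine Finset.sum_congr rfl fun R _ => Finset.sum_congr rfl fun Q _ => ?_
            rw [hD, Finset.mul_sum]
            exact Finset.sum_congr rfl fun P _ => by ring
    have e2 : ∑ P, ∑ Q, c τ P * G (P - Q) * (∑ P', B P' Q * c τ P') =
        ∑ P, ∑ Q, c τ P * c τ Q * D Q P := by
      rw [Finset.sum_comm (f := fun P Q => c τ P * c τ Q * D Q P)]
      simp_rw [mul_comm (c τ _) (c τ _)]
      rw [← e1, Finset.sum_comm]
      refine Finset.sum_congr rfl fun Q _ => Finset.sum_congr rfl fun P _ => ?_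
      rw [← hG (P - Q), neg_sub]
      ring
    have hsum : ∑ P, c τ P = 0 := by rw [hcdef, hA.sum_dualFlow, hu]
    simp_rw [Finset.sum_add_distrib]
    rw [e1, e2, ← Finset.sum_add_distrib]
    simp_rw [← Finset.sum_add_distrib, ← mul_add, hL, mul_add,
      Finset.sum_add_distrib]
    have e3 : ∑ P, ∑ Q, c τ P * c τ Q * (v / m ^ 2) = 0 := by
      simp_rw [← Finset.sum_mul, ← Finset.mul_sum, hsum]
      simp
    rw [e3, add_zero, Finset.mul_sum]
    refine Finset.sum_congr rfl fun P _ => ?_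
    rw [Finset.sum_eq_single P]
    · simp; ring
    · intro Q _ hQ
      rw [if_neg hQ.symm]; simp
    · simp
  have hFTC := intervalIntegral.integral_eq_sub_of_hasDerivAt (a := 0) (b := t)
    (fun s _ => hd s) (Continuous.intervalIntegrable (by fun_prop) _ _)
  have h0 : dualFlow A m m₂ u 0 = u := funext fun P => dualFlow_zero u P
  rw [h0, intervalIntegral.integral_const_mul, intervalIntegral.integral_finsetSum
    (fun P _ => Continuous.intervalIntegrable (by fun_prop) _ _)] at hFTC
  have h1 : ∀ P, ∫ s in (0 : ℝ)..t, dualFlow A m m₂ u (t - s) P ^ 2 =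
      ∫ s in (0 : ℝ)..t, dualFlow A m m₂ u s P ^ 2 := by
    intro P
    rw [intervalIntegral.integral_comp_sub_left (fun s => dualFlow A m m₂ u s P ^ 2) t]
    simp
  simp_rw [h1]
  linarith

end

/-! ### The stationary law of the gradients -/

section
variable {A : ℤ × ℤ → ℤ × ℤ → ℝ} {What : Matrix (Fin 2) (Fin 2) ℝ} {m m₂ : ℕ} [NeZero m]

/-- The characteristic function of a solution, in terms of its initial condition. -/
lemma IsSolution.charFun_eq (hA : IsAdmissible A What) {v : ℝ} (hv : 0 ≤ v) {Ω : Type}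
    [MeasurableSpace Ω] {P : Measure Ω} [IsProbabilityMeasure P] {W : Torus m m₂ → ℝ≥0 → Ω → ℝ}
    {ξ : ℝ≥0 → Ω → Torus m m₂ → ℝ} (h : IsSolution P A v m m₂ W ξ) {u : Torus m m₂ → ℝ}
    (hu : ∑ p, u p = 0) (t : ℝ≥0) :
    ∫ ω, Complex.exp (((∑ p, u p * ξ t ω p : ℝ) : ℂ) * Complex.I) ∂P =
      (∫ ω, Complex.exp (((∑ p, dualFlow A m m₂ u t p * ξ 0 ω p : ℝ) : ℂ) * Complex.I) ∂P) *
        Complex.exp (-(((torusForm A v m m₂ u -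
          torusForm A v m m₂ (dualFlow A m m₂ u t)) / 2 : ℝ) : ℂ)) := by
  have hc : ∀ p, Continuous fun τ => dualFlow A m m₂ u τ p := fun p =>
    continuous_iff_continuousAt.2 fun τ => (hA.hasDerivAt_dualFlow u τ p).continuousAt
  have key := charFun_init_add_wiener h.measurable_noise (h.measurable 0) h.brownian h.indep
    h.indep_init (f := fun p s => dualFlow A m m₂ u (t - s) p)
    (f' := fun p s => -∑ p', torusMatrix A m m₂ p' p * dualFlow A m m₂ u (t - s) p')
    (fun p s => by
      have h := HasDerivAt.scomp (g₁ := fun s => dualFlow A m m₂ u s p)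
        (h := fun s => (t : ℝ) - s) s
        (hA.hasDerivAt_dualFlow u (t - s) p) ((hasDerivAt_id s).const_sub (t : ℝ))
      rw [neg_one_smul] at h
      exact h)
    (fun p => by
      have : ∀ p, Continuous fun s : ℝ => dualFlow A m m₂ u (t - s) p := fun p =>
        (hc p).comp (continuous_const.sub continuous_id)
      fun_prop) t (dualFlow A m m₂ u t) (√v)
  have hvv : (√v) ^ 2 / 2 * ∑ p, ∫ s in (0 : ℝ)..t, dualFlow A m m₂ u (t - s) p ^ 2 =
      (torusForm A v m m₂ u - torusForm A v m m₂ (dualFlow A m m₂ u t)) / 2 := by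
    rw [hA.torusForm_sub_dualFlow v hu, Real.sq_sqrt hv]; ring
  rw [← hvv, ← key]
  refine integral_congr_ae ?_
  filter_upwards [h.continuous, h.equation, ae_all_iff.2 fun p => (h.brownian p).cont]
    with ω h1 h2 h3
  have h4 := linear_equation_pairing (B := torusMatrix A m m₂) (r := √v) (x := fun t => ξ t ω)
    (w := fun t p => W p t ω) h1 (continuous_pi h3) h2 (c := dualFlow A m m₂ u)
    (fun s p => hA.hasDerivAt_dualFlow u s p) t
  have h0 : ∀ p, dualFlow A m m₂ u 0 p = u p := dualFlow_zero u
  simp only [h0] at h4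
  simp only [h4, sub_self, h0]

open Classical in
/-- The covariance matrix on the torus. -/
noncomputable def torusCovMatrix (A : ℤ × ℤ → ℤ × ℤ → ℝ) (v : ℝ) (m m₂ : ℕ) :
    Matrix (Torus m m₂) (Torus m m₂) ℝ :=
  Matrix.of fun P Q => torusGreen A v m m₂ (P - Q)

lemma dotProduct_torusCovMatrix (v : ℝ) (u : Torus m m₂ → ℝ) :
    u ⬝ᵥ (torusCovMatrix A v m m₂ *ᵥ u) = torusForm A v m m₂ u := by
  simp only [dotProduct, Matrix.mulVec, torusCovMatrix, torusForm, Matrix.of_apply, Finset.mul_sum]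
  exact Finset.sum_congr rfl fun _ _ => Finset.sum_congr rfl fun _ _ => by ring

lemma IsAdmissible.posSemidef_torusCovMatrix (hA : IsAdmissible A What) {v : ℝ} (hv : 0 ≤ v) :
    (torusCovMatrix A v m m₂).PosSemidef := by
  refine Matrix.PosSemidef.of_dotProduct_mulVec_nonneg ?_ fun u => ?_
  · ext P Q
    simp only [Matrix.conjTranspose_apply, torusCovMatrix, Matrix.of_apply, star_trivial]
    rw [← torusGreen_neg, neg_sub]
  · rw [star_trivial, dotProduct_torusCovMatrix]
    exact hA.torusForm_nonneg hv u

/-- The gradient as a continuous linear map. -/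
noncomputable def gradientCLM (m m₂ : ℕ) [NeZero m] :
    EuclideanSpace ℝ (Torus m m₂) →L[ℝ] GradientSpace m m₂ :=
  ContinuousLinearMap.pi fun q =>
    EuclideanSpace.proj (𝕜 := ℝ) q.1 - EuclideanSpace.proj (𝕜 := ℝ) q.2

lemma gradientCLM_apply (x : EuclideanSpace ℝ (Torus m m₂)) (q : Torus m m₂ × Torus m m₂) :
    gradientCLM m m₂ x q = x q.1 - x q.2 := by
  simp [gradientCLM]

omit [NeZero m] in
lemma measurable_fieldGradient : Measurable (fieldGradient (m := m) (m₂ := m₂)) := by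
  unfold fieldGradient; fun_prop

open Classical in
/-- The stationary law of the gradients on the torus. -/
noncomputable def stationaryLaw (A : ℤ × ℤ → ℤ × ℤ → ℝ) (v : ℝ) (m m₂ : ℕ) [NeZero m] :
    Measure (GradientSpace m m₂) :=
  (multivariateGaussian 0 (torusCovMatrix A v m m₂)).map (gradientCLM m m₂)

instance (v : ℝ) : IsGaussian (stationaryLaw A v m m₂) := by
  unfold stationaryLaw; infer_instance

lemma sum_mul_fieldGradient {c : Torus m m₂ → ℝ} (hc : ∑ p, c p = 0) (x : Torus m m₂ → ℝ) :
    ∑ p, c p * fieldGradient x (p, 0) = ∑ p, c p * x p := by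
  simp only [fieldGradient, mul_sub, Finset.sum_sub_distrib, ← Finset.sum_mul, hc, zero_mul,
    sub_zero]

lemma IsAdmissible.charFun_stationaryLaw (hA : IsAdmissible A What) {v : ℝ} (hv : 0 ≤ v)
    {c : Torus m m₂ → ℝ} (hc : ∑ p, c p = 0) :
    ∫ g, Complex.exp (((∑ p, c p * g (p, 0) : ℝ) : ℂ) * Complex.I) ∂stationaryLaw A v m m₂ =
      Complex.exp (-((torusForm A v m m₂ c / 2 : ℝ) : ℂ)) := by
  classical
  have hmeas : Measurable fun g : GradientSpace m m₂ => ∑ p, c p * g (p, 0) := by fun_prop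
  rw [stationaryLaw, integral_map (by fun_prop)
    ((by fun_prop : Measurable _).aestronglyMeasurable)]
  have h := charFun_multivariateGaussian (μ := 0) (hA.posSemidef_torusCovMatrix hv)
    (WithLp.toLp 2 c : EuclideanSpace ℝ (Torus m m₂))
  rw [dotProduct_torusCovMatrix, charFun_apply] at h
  have e : ∀ x : EuclideanSpace ℝ (Torus m m₂), ∑ p, c p * gradientCLM m m₂ x (p, 0) =
      inner ℝ x (WithLp.toLp 2 c : EuclideanSpace ℝ (Torus m m₂)) := by
    intro x
    have h1 : gradientCLM m m₂ x = fieldGradient x.ofLp := by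
      ext q; rw [gradientCLM_apply]; rfl
    rw [h1, sum_mul_fieldGradient hc]
    simp [PiLp.inner_apply]
  simp_rw [e]
  rw [h]
  congr 1
  simp

/-- Laws of gradients are determined by the characteristic functions of sums with coefficients of
vanishing sum. -/
lemma gradientLaw_ext {Ω Ω' : Type*} [MeasurableSpace Ω] [MeasurableSpace Ω'] {P : Measure Ω}
    {P' : Measure Ω'} [IsProbabilityMeasure P] [IsProbabilityMeasure P']
    {X : Ω → Torus m m₂ → ℝ} {X' : Ω' → Torus m m₂ → ℝ} (hX : Measurable X) (hX' : Measurable X')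
    (h : ∀ u : Torus m m₂ → ℝ, ∑ p, u p = 0 →
      ∫ ω, Complex.exp (((∑ p, u p * X ω p : ℝ) : ℂ) * Complex.I) ∂P =
      ∫ ω, Complex.exp (((∑ p, u p * X' ω p : ℝ) : ℂ) * Complex.I) ∂P') :
    P.map (fun ω => fieldGradient (X ω)) = P'.map (fun ω => fieldGradient (X' ω)) := by
  classical
  have hm : Measurable fun ω => fieldGradient (X ω) := measurable_fieldGradient.comp hX
  have hm' : Measurable fun ω => fieldGradient (X' ω) := measurable_fieldGradient.comp hX'
  have : IsProbabilityMeasure (P.map (fun ω => fieldGradient (X ω))) :=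
    Measure.isProbabilityMeasure_map hm.aemeasurable
  have : IsProbabilityMeasure (P'.map (fun ω => fieldGradient (X' ω))) :=
    Measure.isProbabilityMeasure_map hm'.aemeasurable
  refine Measure.ext_of_charFunDual ?_
  ext L
  rw [charFunDual_apply, charFunDual_apply, integral_map hm.aemeasurable
    ((by fun_prop : Measurable _).aestronglyMeasurable), integral_map hm'.aemeasurable
    ((by fun_prop : Measurable _).aestronglyMeasurable)]
  set u : Torus m m₂ → ℝ := fun p => L (fieldGradient (Pi.single p 1))
  have hlin : ∀ x : Torus m m₂ → ℝ, L (fieldGradient x) = ∑ p, u p * x p := by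
    intro x
    have e : fieldGradient x = ∑ p, x p • fieldGradient (Pi.single p (1 : ℝ)) := by
      ext q
      simp only [fieldGradient, Finset.sum_apply, Pi.smul_apply, smul_eq_mul, mul_sub,
        Finset.sum_sub_distrib, Pi.single_apply, mul_ite, mul_one, mul_zero]
      simp
    rw [e, map_sum]
    exact Finset.sum_congr rfl fun p _ => by rw [map_smul, smul_eq_mul, mul_comm]
  have hu : ∑ p, u p = 0 := by
    have := hlin 1
    have h0 : fieldGradient (1 : Torus m m₂ → ℝ) = 0 := by ext q; simp [fieldGradient]
    rw [h0, map_zero] at this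
    simpa using this.symm
  simp_rw [hlin]
  exact h u hu

lemma stationaryLaw_eq_map (v : ℝ) : ∃ ρ : Measure (Torus m m₂ → ℝ), IsProbabilityMeasure ρ ∧
    ρ.map fieldGradient = stationaryLaw A v m m₂ := by
  classical
  refine ⟨(multivariateGaussian 0 (torusCovMatrix A v m m₂)).map WithLp.ofLp,
    Measure.isProbabilityMeasure_map (by fun_prop), ?_⟩
  rw [Measure.map_map measurable_fieldGradient (by fun_prop), stationaryLaw]
  congr 1

lemma IsAdmissible.map_eq_stationaryLaw (hA : IsAdmissible A What) {v : ℝ} (hv : 0 ≤ v)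
    {Ω : Type*} [MeasurableSpace Ω] {P : Measure Ω} [IsProbabilityMeasure P]
    {X : Ω → Torus m m₂ → ℝ} (hX : Measurable X)
    (h : ∀ u : Torus m m₂ → ℝ, ∑ p, u p = 0 →
      ∫ ω, Complex.exp (((∑ p, u p * X ω p : ℝ) : ℂ) * Complex.I) ∂P =
        Complex.exp (-((torusForm A v m m₂ u / 2 : ℝ) : ℂ))) :
    P.map (fun ω => fieldGradient (X ω)) = stationaryLaw A v m m₂ := by
  obtain ⟨ρ, hρ, hρ'⟩ := stationaryLaw_eq_map (A := A) (m := m) (m₂ := m₂) v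
  rw [← hρ']
  refine gradientLaw_ext hX (X' := id) measurable_id fun u hu => ?_
  have hmeas : Measurable fun g : GradientSpace m m₂ => ∑ p, u p * g (p, 0) := by fun_prop
  rw [h u hu, ← hA.charFun_stationaryLaw hv hu, ← hρ', integral_map
    measurable_fieldGradient.aemeasurable ((by fun_prop : Measurable _).aestronglyMeasurable)]
  simp_rw [sum_mul_fieldGradient hu]
  simp only [id]

/-- The characteristic function of a configuration, in terms of the law of its gradients. -/
lemma integral_map_fieldGradient {Ω : Type*} [MeasurableSpace Ω] {P : Measure Ω}
    {X : Ω → Torus m m₂ → ℝ} (hX : Measurable X) {c : Torus m m₂ → ℝ} (hc : ∑ p, c p = 0) :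
    ∫ g, Complex.exp (((∑ p, c p * g (p, 0) : ℝ) : ℂ) * Complex.I)
      ∂(P.map fun ω => fieldGradient (X ω)) =
    ∫ ω, Complex.exp (((∑ p, c p * X ω p : ℝ) : ℂ) * Complex.I) ∂P := by
  have hmeas : Measurable fun g : GradientSpace m m₂ => ∑ p, c p * g (p, 0) := by fun_prop
  have hm : Measurable fun ω => fieldGradient (X ω) := measurable_fieldGradient.comp hX
  rw [integral_map hm.aemeasurable
    ((by fun_prop : Measurable _).aestronglyMeasurable)]
  simp_rw [sum_mul_fieldGradient hc]

theorem IsAdmissible.isStationaryGradientLaw (hA : IsAdmissible A What) {v : ℝ} (hv : 0 ≤ v) :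
    IsStationaryGradientLaw A v m m₂ (stationaryLaw A v m m₂) where
  isGradient := stationaryLaw_eq_map v
  invariant := by
    intro Ω _ P _ W ξ h h0 t
    refine hA.map_eq_stationaryLaw hv (h.measurable t) fun u hu => ?_
    have hs : ∑ p, dualFlow A m m₂ u t p = 0 := by rw [hA.sum_dualFlow, hu]
    rw [h.charFun_eq hA hv hu t, ← integral_map_fieldGradient (h.measurable 0) hs, h0,
      hA.charFun_stationaryLaw hv hs, ← Complex.exp_add]
    congr 1
    push_cast; ring

theorem IsAdmissible.eq_stationaryLaw (hA : IsAdmissible A What) {v : ℝ} (hv : 0 ≤ v)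
    {Ω : Type} [MeasurableSpace Ω] {P : Measure Ω} [IsProbabilityMeasure P]
    {W : Torus m m₂ → ℝ≥0 → Ω → ℝ} {ξ : ℝ≥0 → Ω → Torus m m₂ → ℝ}
    {ν : Measure (GradientSpace m m₂)} (h : IsSolution P A v m m₂ W ξ)
    (hν : ∀ t, P.map (fun ω => fieldGradient (ξ t ω)) = ν) : ν = stationaryLaw A v m m₂ := by
  rw [← hν 0]
  refine hA.map_eq_stationaryLaw hv (h.measurable 0) fun u hu => ?_
  have hs : ∀ t : ℝ, ∑ p, dualFlow A m m₂ u t p = 0 := fun t => by rw [hA.sum_dualFlow, hu]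
  have key : ∀ t : ℝ≥0,
      ∫ ω, Complex.exp (((∑ p, u p * ξ 0 ω p : ℝ) : ℂ) * Complex.I) ∂P =
      (∫ ω, Complex.exp (((∑ p, dualFlow A m m₂ u t p * ξ 0 ω p : ℝ) : ℂ) * Complex.I) ∂P) *
        Complex.exp (-(((torusForm A v m m₂ u -
          torusForm A v m m₂ (dualFlow A m m₂ u t)) / 2 : ℝ) : ℂ)) := by
    intro t
    rw [← h.charFun_eq hA hv hu t, ← integral_map_fieldGradient (h.measurable 0) hu, hν,
      ← hν t, integral_map_fieldGradient (h.measurable t) hu]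
  have hflow : Tendsto (fun n : ℕ => dualFlow A m m₂ u ((n : ℝ≥0) : ℝ)) atTop (𝓝 0) := by
    rw [tendsto_pi_nhds]
    intro p
    refine (hA.tendsto_dualFlow hu p).comp ?_
    simpa using tendsto_natCast_atTop_atTop (R := ℝ)
  have l1 : Tendsto (fun n : ℕ => ∫ ω, Complex.exp (((∑ p,
      dualFlow A m m₂ u ((n : ℝ≥0) : ℝ) p * ξ 0 ω p : ℝ) : ℂ) * Complex.I) ∂P) atTop (𝓝 1) := by
    have : (1 : ℂ) = ∫ _ω, (1 : ℂ) ∂P := by simp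
    rw [this]
    refine tendsto_integral_of_dominated_convergence (fun _ => 1) (fun n => ?_)
      (integrable_const _) (fun n => ae_of_all _ fun ω => ?_) (ae_of_all _ fun ω => ?_)
    · have := h.measurable 0
      have : Measurable fun ω => ∑ p, dualFlow A m m₂ u ((n : ℝ≥0) : ℝ) p * ξ 0 ω p := by fun_prop
      exact (by fun_prop : Measurable _).aestronglyMeasurable
    · rw [Complex.norm_exp_ofReal_mul_I]
    · have hc : Continuous fun c : Torus m m₂ → ℝ =>
          Complex.exp (((∑ p, c p * ξ 0 ω p : ℝ) : ℂ) * Complex.I) := by fun_prop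
      have := (hc.tendsto 0).comp hflow
      simp only [Function.comp_def, Pi.zero_apply, zero_mul, Finset.sum_const_zero,
        Complex.ofReal_zero, Complex.exp_zero] at this
      exact this
  have l2 : Tendsto (fun n : ℕ => Complex.exp (-(((torusForm A v m m₂ u -
          torusForm A v m m₂ (dualFlow A m m₂ u ((n : ℝ≥0) : ℝ))) / 2 : ℝ) : ℂ))) atTop
      (𝓝 (Complex.exp (-((torusForm A v m m₂ u / 2 : ℝ) : ℂ)))) := by
    have hc : Continuous fun c : Torus m m₂ → ℝ => Complex.exp (-(((torusForm A v m m₂ u -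
          torusForm A v m m₂ c) / 2 : ℝ) : ℂ)) := by
      have := continuous_torusForm (A := A) (m := m) (m₂ := m₂) v
      fun_prop
    have h0 : torusForm A v m m₂ (0 : Torus m m₂ → ℝ) = 0 := by simp [torusForm]
    have := (hc.tendsto 0).comp hflow
    rw [h0, sub_zero] at this
    exact this
  have l3 := l1.mul l2
  simp_rw [← key] at l3
  rw [one_mul] at l3
  exact tendsto_nhds_unique tendsto_const_nhds l3

lemma integral_stationaryLaw (v : ℝ) (q : Torus m m₂ × Torus m m₂) :
    ∫ g, g q ∂stationaryLaw A v m m₂ = 0 := by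
  classical
  have hq : Measurable fun g : GradientSpace m m₂ => g q := measurable_pi_apply q
  rw [stationaryLaw, integral_map (by fun_prop) hq.aestronglyMeasurable]
  have h : ∀ x : EuclideanSpace ℝ (Torus m m₂), gradientCLM m m₂ x q =
      ((ContinuousLinearMap.proj (R := ℝ) q).comp (gradientCLM m m₂)) x := fun x => rfl
  simp_rw [h]
  rw [ContinuousLinearMap.integral_comp_comm _ IsGaussian.integrable_fun_id,
    integral_id_multivariateGaussian, map_zero]

lemma re_torusCov (v : ℝ) (y₁ y₂ y₃ y₄ : ℤ × ℤ) :
    (torusCov A v m m₂ y₁ y₂ y₃ y₄).re =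
      torusGreen A v m m₂ (toTorus m m₂ y₁ - toTorus m m₂ y₃) -
      torusGreen A v m m₂ (toTorus m m₂ y₁ - toTorus m m₂ y₄) -
      torusGreen A v m m₂ (toTorus m m₂ y₂ - toTorus m m₂ y₃) +
      torusGreen A v m m₂ (toTorus m m₂ y₂ - toTorus m m₂ y₄) := by
  rw [torusCov_eq]
  have h : -((v : ℂ) / (m : ℂ) ^ 2) = ((-(v / m ^ 2) : ℝ) : ℂ) := by push_cast; ring
  rw [h, Complex.re_ofReal_mul, Complex.re_sum]
  simp only [torusGreen, ← mul_sub, ← mul_add, ← Finset.sum_sub_distrib, ← Finset.sum_add_distrib]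
  congr 1
  refine Finset.sum_congr rfl fun r _ => ?_
  rw [covSummand, Complex.div_ofReal_re, ← sub_div, ← sub_div, ← add_div]
  congr 1
  simp only [← QuotientAddGroup.mk_sub, torusChar_mk, ← wave_mul_wave_neg, ← Complex.sub_re,
    ← Complex.add_re]
  congr 1
  ring

theorem IsAdmissible.covariance_stationaryLaw (hA : IsAdmissible A What) {v : ℝ} (hv : 0 ≤ v)
    (y₁ y₂ y₃ y₄ : ℤ × ℤ) :
    ((cov[fun g => g (toTorus m m₂ y₁, toTorus m m₂ y₂),
      fun g => g (toTorus m m₂ y₃, toTorus m m₂ y₄); stationaryLaw A v m m₂] : ℝ) : ℂ) =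
      torusCov A v m m₂ y₁ y₂ y₃ y₄ := by
  classical
  have hS := hA.posSemidef_torusCovMatrix (m := m) (m₂ := m₂) hv
  rw [← ofReal_re_torusCov, re_torusCov, stationaryLaw, covariance_map_fun
    (measurable_pi_apply _).aestronglyMeasurable (measurable_pi_apply _).aestronglyMeasurable
    (by fun_prop)]
  simp only [gradientCLM_apply]
  have hL : ∀ P : Torus m m₂, MemLp (fun x : EuclideanSpace ℝ (Torus m m₂) => x P) 2
      (multivariateGaussian 0 (torusCovMatrix A v m m₂)) := fun P =>
    IsGaussian.memLp_dual _ (EuclideanSpace.proj (𝕜 := ℝ) P) 2 (by simp)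
  rw [covariance_fun_sub_fun_sub (hL _) (hL _) (hL _) (hL _)]
  have hval : ∀ P Q, torusCovMatrix A v m m₂ P Q = torusGreen A v m m₂ (P - Q) := fun _ _ => rfl
  simp only [covariance_eval_multivariateGaussian hS, hval]

end

/-! ### Step functions on the plane -/

/-- The index of the square of side `h` which contains `k`. -/
noncomputable def cellIndex (h : ℝ) (k : Plane) : ℤ × ℤ := (⌊k 0 / h⌋, ⌊k 1 / h⌋)

lemma measurable_cellIndex (h : ℝ) : Measurable (cellIndex h) := by
  unfold cellIndex
  exact ((by fun_prop : Measurable fun k : Plane => k 0 / h).floor).prodMk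
    ((by fun_prop : Measurable fun k : Plane => k 1 / h).floor)

lemma map_cellIndex {h : ℝ} (hh : 0 < h) :
    (volume : Measure Plane).map (cellIndex h) = ENNReal.ofReal (h ^ 2) • Measure.count := by
  refine Measure.ext_of_singleton fun r => ?_
  rw [Measure.map_apply (measurable_cellIndex h) (measurableSet_singleton r)]
  have hset : cellIndex h ⁻¹' {r} = (WithLp.ofLp : Plane → Fin 2 → ℝ) ⁻¹'
      (Set.univ.pi fun i => Set.Ico (![h * r.1, h * r.2] i) (![h * (r.1 + 1), h * (r.2 + 1)] i)) := by
    ext k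
    simp only [cellIndex, Set.mem_preimage, Set.mem_singleton_iff, Prod.ext_iff, Int.floor_eq_iff,
      Set.mem_pi, Set.mem_univ, true_imp_iff, Fin.forall_fin_two, Set.mem_Ico, le_div_iff₀ hh,
      div_lt_iff₀ hh]
    simp [mul_comm]
  rw [hset, (PiLp.volume_preserving_ofLp (Fin 2)).measure_preimage
    (MeasurableSet.univ_pi fun i => measurableSet_Ico).nullMeasurableSet, Real.volume_pi_Ico]
  simp [Fin.prod_univ_two, ← mul_sub, pow_two, ENNReal.ofReal_mul hh.le]

lemma integral_cellIndex {E : Type*} [NormedAddCommGroup E] [NormedSpace ℝ E] [CompleteSpace E]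
    {h : ℝ} (hh : 0 < h) (s : Finset (ℤ × ℤ)) (f : ℤ × ℤ → E) (hf : ∀ r ∉ s, f r = 0) :
    ∫ k, f (cellIndex h k) = h ^ 2 • ∑ r ∈ s, f r := by
  have hfm : StronglyMeasurable f := .of_discrete
  have h1 := integral_map (measurable_cellIndex h).aemeasurable (μ := (volume : Measure Plane))
    hfm.aestronglyMeasurable
  rw [← h1, map_cellIndex hh, integral_smul_measure, ENNReal.toReal_ofReal (by positivity)]
  congr 1
  rw [← setIntegral_eq_integral_of_forall_compl_eq_zero (s := (s : Set (ℤ × ℤ)))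
    fun r hr => hf r (by simpa using hr), setIntegral_finset]
  · simp [Measure.real]
  · exact Measure.integrableOn_of_bounded (M := ∑ r ∈ s, ‖f r‖) (by simp)
      hfm.aestronglyMeasurable (by
        filter_upwards [ae_restrict_mem s.measurableSet] with r hr
        exact Finset.single_le_sum (f := fun r => ‖f r‖) (fun _ _ => norm_nonneg _) hr)

lemma ae_apply_ne (i : Fin 2) (x : ℝ) : ∀ᵐ k : Plane, k i ≠ x := by
  have h := Measure.pi_hyperplane (fun _ : Fin 2 => (volume : Measure ℝ)) i x
  rw [ae_iff]
  simp only [ne_eq, not_not]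
  rw [← volume_pi] at h
  have h2 := (PiLp.volume_preserving_ofLp (Fin 2)).measure_preimage
    (s := {f : Fin 2 → ℝ | f i = x}) (measurableSet_eq_fun (by fun_prop) (by fun_prop)).nullMeasurableSet
  rw [h] at h2
  exact h2

lemma abs_mul_floor_sub_le {h : ℝ} (hh : 0 < h) (x : ℝ) {θ : ℝ} (hθ : θ ∈ Set.Icc (0 : ℝ) 1) :
    |h * (θ + ⌊x / h⌋) - x| ≤ h := by
  have e : h * (θ + ⌊x / h⌋) - x = h * (θ - Int.fract (x / h)) := by
    rw [Int.fract]; field_simp; ring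
  rw [e, abs_mul, abs_of_pos hh]
  have h1 := Int.fract_nonneg (x / h)
  have h2 := (Int.fract_lt_one (x / h)).le
  have : |θ - Int.fract (x / h)| ≤ 1 := by
    rw [abs_le]; constructor <;> linarith [hθ.1, hθ.2]
  nlinarith

lemma tendsto_mul_floor {ι : Type*} {l : Filter ι} {h θ : ι → ℝ} (hh : ∀ i, 0 < h i)
    (h0 : Tendsto h l (𝓝 0)) (hθ : ∀ i, θ i ∈ Set.Icc (0 : ℝ) 1) (x : ℝ) :
    Tendsto (fun i => h i * (θ i + ⌊x / h i⌋)) l (𝓝 x) := by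
  rw [tendsto_iff_norm_sub_tendsto_zero]
  exact squeeze_zero (fun _ => norm_nonneg _) (fun i => abs_mul_floor_sub_le (hh i) x (hθ i)) h0

/-! ### The infinite volume limit of the covariances -/

section
variable {A : ℤ × ℤ → ℤ × ℤ → ℝ} {What : Matrix (Fin 2) (Fin 2) ℝ}

/-- A point equivalent to the wave vector, in the square of side `2π/m` of index `r`. -/
noncomputable def shiftedWaveVector (m m₂ : ℕ) (r : ℤ × ℤ) : Plane :=
  !₂[2 * Real.pi / m * (0 + r.1), 2 * Real.pi / m * (Int.fract ((m₂ : ℝ) / m * r.1) + r.2)]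

lemma sum_covSummand_shifted (m m₂ : ℕ) [NeZero m] (y₁ y₂ y₃ y₄ : ℤ × ℤ) :
    ∑ r ∈ waveIndex m, covSummand A y₁ y₂ y₃ y₄ (waveVector m m₂ r) =
      ∑ r ∈ waveIndex m, covSummand A y₁ y₂ y₃ y₄ (shiftedWaveVector m m₂ r) := by
  have hm : (m : ℝ) ≠ 0 := NeZero.ne _
  rw [waveIndex_eq, Finset.sum_product, Finset.sum_product]
  refine Finset.sum_congr rfl fun a _ => ?_
  set g : ℤ → ℂ := fun b => covSummand A y₁ y₂ y₃ y₄ (shiftedWaveVector m m₂ (a, b)) with hg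
  have hper : ∀ b, g (b + m) = g b := by
    intro b
    have : shiftedWaveVector m m₂ (a, b + m) =
        shiftedWaveVector m m₂ (a, b) + (2 * Real.pi) • latticePoint (0, 1) := by
      ext i; fin_cases i
      · simp [shiftedWaveVector, latticePoint]
      · simp [shiftedWaveVector, latticePoint]; field_simp; ring
    simp only [hg, this, covSummand_periodic]
  have hper' : ∀ b, g (b + m + ⌊(m₂ : ℝ) / m * a⌋) = g (b + ⌊(m₂ : ℝ) / m * a⌋) := by
    intro b; rw [← hper (b + _)]; congr 1; ring
  have heq : ∀ b, covSummand A y₁ y₂ y₃ y₄ (waveVector m m₂ (a, b)) =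
      g (b + ⌊(m₂ : ℝ) / m * a⌋) := by
    intro b
    simp only [hg]
    congr 1
    ext i; fin_cases i
    · simp [shiftedWaveVector, waveVector]
    · have := Int.floor_add_fract ((m₂ : ℝ) / m * a)
      simp only [shiftedWaveVector, waveVector]
      simp
      left
      linarith
  simp_rw [heq]
  rw [sum_halfOpenIndex (f := g) hper ⌊(m₂ : ℝ) / m * a⌋,
    sum_halfOpenIndex (f := fun b => g (b + ⌊(m₂ : ℝ) / m * a⌋)) hper' 0]
  exact Finset.sum_congr rfl fun i _ => by congr 1; ring

lemma eventually_mem_halfOpenIndex {m : ℕ → ℕ} (hm : Tendsto m atTop atTop) {x : ℝ}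
    (hx : |x| < Real.pi) : ∀ᶠ n in atTop, ⌊x / (2 * Real.pi / m n)⌋ ∈ halfOpenIndex (m n) := by
  have hpi := Real.pi_pos
  rw [abs_lt] at hx
  have hx1 : 0 < x / Real.pi + 1 := by
    have : -1 < x / Real.pi := by rw [lt_div_iff₀ hpi]; linarith
    linarith
  have hx2 : x / Real.pi < 1 := by rw [div_lt_one hpi]; exact hx.2
  have ht : Tendsto (fun n => (m n : ℝ)) atTop atTop := tendsto_natCast_atTop_atTop.comp hm
  filter_upwards [ht.eventually_ge_atTop (2 / (x / Real.pi + 1)), ht.eventually_gt_atTop 0]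
    with n hn hn0
  rw [mem_halfOpenIndex]
  have e : x / (2 * Real.pi / m n) = m n * (x / Real.pi) / 2 := by field_simp
  rw [e]
  have h1 := Int.floor_le (m n * (x / Real.pi) / 2)
  have h2 := Int.lt_floor_add_one (m n * (x / Real.pi) / 2)
  rw [div_le_iff₀ hx1] at hn
  constructor
  · have : (-(m n : ℝ)) ≤ 2 * ⌊m n * (x / Real.pi) / 2⌋ := by nlinarith
    exact_mod_cast this
  · have : (2 * ⌊m n * (x / Real.pi) / 2⌋ : ℝ) < m n := by nlinarith
    exact_mod_cast this

lemma eventually_notMem_halfOpenIndex {m : ℕ → ℕ} (hm : Tendsto m atTop atTop) {x : ℝ}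
    (hx : Real.pi < |x|) : ∀ᶠ n in atTop, ⌊x / (2 * Real.pi / m n)⌋ ∉ halfOpenIndex (m n) := by
  have hpi := Real.pi_pos
  have ht : Tendsto (fun n => (m n : ℝ)) atTop atTop := tendsto_natCast_atTop_atTop.comp hm
  have e : ∀ n, x / (2 * Real.pi / m n) = m n * (x / Real.pi) / 2 := fun n => by field_simp
  rcases lt_abs.1 hx with h | h
  · have hx2 : 0 < x / Real.pi - 1 := by
      have : 1 < x / Real.pi := by rw [lt_div_iff₀ hpi]; linarith
      linarith
    filter_upwards [ht.eventually_ge_atTop (2 / (x / Real.pi - 1))] with n hn hcon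
    rw [mem_halfOpenIndex, e] at hcon
    have h2 := Int.lt_floor_add_one (m n * (x / Real.pi) / 2)
    rw [div_le_iff₀ hx2] at hn
    have h3 : (2 * ⌊m n * (x / Real.pi) / 2⌋ : ℝ) < m n := by exact_mod_cast hcon.2
    nlinarith
  · have hx2 : x / Real.pi < -1 := by rw [div_lt_iff₀ hpi]; linarith
    filter_upwards [ht.eventually_gt_atTop 0] with n hn hcon
    rw [mem_halfOpenIndex, e] at hcon
    have h2 := Int.floor_le (m n * (x / Real.pi) / 2)
    have h3 : (-(m n : ℝ)) ≤ 2 * ⌊m n * (x / Real.pi) / 2⌋ := by exact_mod_cast hcon.1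
    nlinarith

/-- The infinite volume limit of the covariances. -/
theorem IsAdmissible.tendsto_torusCov (hA : IsAdmissible A What) (v : ℝ) (y₁ y₂ y₃ y₄ : ℤ × ℤ)
    {m m₂ : ℕ → ℕ} (hm : Tendsto m atTop atTop) (hlt : ∀ n, 0 < m₂ n ∧ m₂ n < m n) :
    Tendsto (fun n => torusCov A v (m n) (m₂ n) y₁ y₂ y₃ y₄) atTop
      (𝓝 (limitCov A v y₁ y₂ y₃ y₄)) := by
  classical
  have hpi := Real.pi_pos
  have hm0 : ∀ n, (0 : ℝ) < m n := fun n => by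
    exact_mod_cast (hlt n).1.trans (hlt n).2
  have hne : ∀ n, NeZero (m n) := fun n => ⟨((hlt n).1.trans (hlt n).2).ne'⟩
  set F := covSummand A y₁ y₂ y₃ y₄
  set h : ℕ → ℝ := fun n => 2 * Real.pi / m n with hh
  have hhpos : ∀ n, 0 < h n := fun n => div_pos Real.two_pi_pos (hm0 n)
  have hh0 : Tendsto h atTop (𝓝 0) :=
    tendsto_const_nhds.div_atTop (tendsto_natCast_atTop_atTop.comp hm)
  set f : ℕ → ℤ × ℤ → ℂ := fun n r =>
    if r ∈ waveIndex (m n) then F (shiftedWaveVector (m n) (m₂ n) r) else 0 with hf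
  have hsum : ∀ n, torusCov A v (m n) (m₂ n) y₁ y₂ y₃ y₄ =
      -((v : ℂ) / (2 * (Real.pi : ℂ)) ^ 2) * ∫ k, f n (cellIndex (h n) k) := by
    intro n
    rw [torusCov_eq, sum_covSummand_shifted, integral_cellIndex (hhpos n) (waveIndex (m n)) (f n)
      (fun r hr => if_neg hr)]
    have : ∑ r ∈ waveIndex (m n), f n r =
        ∑ r ∈ waveIndex (m n), F (shiftedWaveVector (m n) (m₂ n) r) :=
      Finset.sum_congr rfl fun r hr => if_pos hr
    rw [this, Complex.real_smul, ← mul_assoc]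
    congr 1
    have h1 : (m n : ℂ) ≠ 0 := by exact_mod_cast (hm0 n).ne'
    have h2 : (Real.pi : ℂ) ≠ 0 := by exact_mod_cast hpi.ne'
    simp only [hh]
    push_cast
    field_simp
  simp_rw [hsum]
  refine tendsto_const_nhds.mul ?_
  rw [← integral_indicator measurableSet_brillouin]
  obtain ⟨C, hC⟩ := hA.exists_covSummand_bound y₁ y₂ y₃ y₄
  have hC0 : 0 ≤ C := (norm_nonneg _).trans (hC 0)
  set D : Set Plane := Metric.closedBall 0 (6 * Real.pi)
  refine tendsto_integral_of_dominated_convergence (D.indicator fun _ => C) (fun n => ?_) ?_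
    (fun n => ae_of_all _ fun k => ?_) ?_
  · exact ((StronglyMeasurable.of_discrete (f := f n)).comp_measurable
      (measurable_cellIndex _)).aestronglyMeasurable
  · exact (integrable_indicator_iff Metric.isClosed_closedBall.measurableSet).2
      (integrableOn_const (isCompact_closedBall _ _).measure_lt_top.ne)
  · by_cases hk : cellIndex (h n) k ∈ waveIndex (m n)
    · have hkD : k ∈ D := by
        rw [waveIndex_eq, Finset.mem_product] at hk
        have h2 : h n ≤ 2 * Real.pi := by
          have : (1 : ℝ) ≤ m n := by exact_mod_cast (hlt n).1.trans (hlt n).2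
          exact div_le_self Real.two_pi_pos.le this
        have key : ∀ x : ℝ, ⌊x / h n⌋ ∈ halfOpenIndex (m n) → |x| ≤ 3 * Real.pi := by
          intro x hx
          rw [mem_halfOpenIndex] at hx
          have h1 : h n * m n = 2 * Real.pi := by simp only [hh]; field_simp [(hm0 n).ne']
          have h3 := abs_le.1 (abs_mul_floor_sub_le (hhpos n) x (θ := 0) (by simp))
          rw [zero_add] at h3
          have h4 : (-(m n : ℝ)) ≤ 2 * ⌊x / h n⌋ := by exact_mod_cast hx.1
          have h5 : (2 * ⌊x / h n⌋ : ℝ) < m n := by exact_mod_cast hx.2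
          have h6 := hhpos n
          rw [abs_le]
          constructor <;> nlinarith
        have hk0 := key _ hk.1
        have hk1 := key _ hk.2
        rw [mem_closedBall_zero_iff, EuclideanSpace.norm_eq, Real.sqrt_le_left (by positivity),
          Fin.sum_univ_two, Real.norm_eq_abs, Real.norm_eq_abs]
        nlinarith [abs_nonneg (k 0), abs_nonneg (k 1)]
      rw [Set.indicator_of_mem hkD]
      simp only [hf, if_pos hk]
      exact hC _
    · simp only [hf, if_neg hk, norm_zero]
      exact Set.indicator_nonneg (fun _ _ => hC0) _
  · filter_upwards [ae_apply_ne 0 0, ae_apply_ne 0 Real.pi, ae_apply_ne 0 (-Real.pi),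
      ae_apply_ne 1 Real.pi, ae_apply_ne 1 (-Real.pi)] with k hk0 h1 h2 h3 h4
    have hne' : ∀ i, |k i| ≠ Real.pi := by
      intro i hi
      rcases (abs_eq hpi.le).1 hi with h | h <;> fin_cases i <;> simp_all
    by_cases hB : k ∈ brillouin
    · rw [Set.indicator_of_mem hB]
      have hlt' : ∀ i, |k i| < Real.pi := fun i =>
        lt_of_le_of_ne (abs_le.2 (hB i)) (hne' i)
      have hkne : k ≠ 0 := by rintro rfl; simp at hk0
      have hcont := hA.continuousAt_covSummand y₁ y₂ y₃ y₄ (hA.Rhat_neg_of_mem hB hkne).ne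
      have hev : ∀ᶠ n in atTop, f n (cellIndex (h n) k) =
          F (shiftedWaveVector (m n) (m₂ n) (cellIndex (h n) k)) := by
        filter_upwards [eventually_mem_halfOpenIndex hm (hlt' 0),
          eventually_mem_halfOpenIndex hm (hlt' 1)] with n e1 e2
        refine if_pos ?_
        rw [waveIndex_eq, Finset.mem_product]
        exact ⟨e1, e2⟩
      refine Tendsto.congr' (EventuallyEq.symm hev) (hcont.tendsto.comp ?_)
      have hcoord : Tendsto (fun n => ![h n * (0 + ⌊k 0 / h n⌋),
          h n * (Int.fract ((m₂ n : ℝ) / m n * ⌊k 0 / h n⌋) + ⌊k 1 / h n⌋)]) atTop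
          (𝓝 (k.ofLp)) := by
        rw [tendsto_pi_nhds]
        intro i
        fin_cases i
        · exact tendsto_mul_floor hhpos hh0 (θ := fun _ => 0) (by simp) (k 0)
        · exact tendsto_mul_floor hhpos hh0
            (θ := fun n => Int.fract ((m₂ n : ℝ) / m n * ⌊k 0 / h n⌋))
            (fun n => ⟨Int.fract_nonneg _, (Int.fract_lt_one _).le⟩) (k 1)
      exact ((PiLp.continuous_toLp 2 fun _ : Fin 2 => ℝ).tendsto k.ofLp).comp hcoord
    · rw [Set.indicator_of_notMem hB]
      have : ∃ i, Real.pi < |k i| := by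
        by_contra hcon
        push Not at hcon
        exact hB fun i => abs_le.1 (hcon i)
      obtain ⟨i, hi⟩ := this
      refine tendsto_const_nhds.congr' ?_
      filter_upwards [eventually_notMem_halfOpenIndex hm hi] with n hn
      refine (if_neg ?_).symm
      rw [waveIndex_eq, Finset.mem_product]
      rintro ⟨e1, e2⟩
      fin_cases i
      · exact hn e1
      · exact hn e2

end

/-! ### Taylor estimates for even functions -/

section
variable {E F : Type*} [NormedAddCommGroup E] [NormedSpace ℝ E] [NormedAddCommGroup F]
  [NormedSpace ℝ F]

lemma norm_le_pow_succ_of_fderiv {g : E → F} (hg : Differentiable ℝ g) (h0 : g 0 = 0) {C R : ℝ}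
    (hC : 0 ≤ C) {n : ℕ} (h : ∀ k, ‖k‖ ≤ R → ‖fderiv ℝ g k‖ ≤ C * ‖k‖ ^ n) {k : E} (hk : ‖k‖ ≤ R) :
    ‖g k‖ ≤ C * ‖k‖ ^ (n + 1) := by
  have := (convex_closedBall (0 : E) ‖k‖).norm_image_sub_le_of_norm_fderiv_le (𝕜 := ℝ) (f := g)
    (C := C * ‖k‖ ^ n) (x := 0) (y := k) (fun x _ => hg x) (fun x hx => ?_) (by simp) (by simp)
  · rw [h0, sub_zero, sub_zero] at this
    rwa [pow_succ, ← mul_assoc]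
  · rw [mem_closedBall_zero_iff] at hx
    refine (h x (hx.trans hk)).trans ?_
    gcongr

lemma fderiv_comp_neg' {f : E → F} (hd : Differentiable ℝ f) (k : E) :
    fderiv ℝ (fun k => f (-k)) k = -fderiv ℝ f (-k) := by
  have h := (hd (-k)).hasFDerivAt.comp k (hasFDerivAt_id (𝕜 := ℝ) k).neg
  refine (h.congr_fderiv (f' := _) ?_).fderiv
  ext y
  simp

lemma ContDiff.fderiv_of_top {f : E → F} (hf : ContDiff ℝ (⊤ : ℕ∞) f) :
    ContDiff ℝ (⊤ : ℕ∞) (fderiv ℝ f) :=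
  hf.fderiv_right (m := (⊤ : ℕ∞)) (by exact_mod_cast le_top)

lemma ContDiff.differentiable_of_top {f : E → F} (hf : ContDiff ℝ (⊤ : ℕ∞) f) :
    Differentiable ℝ f :=
  hf.differentiable (by simp)

lemma fderiv_odd_of_even {f : E → F} (hd : Differentiable ℝ f) (hf : ∀ k, f (-k) = f k) (k : E) :
    fderiv ℝ f (-k) = -fderiv ℝ f k := by
  have h : f = fun k => f (-k) := funext fun k => (hf k).symm
  conv_rhs => rw [h]
  rw [fderiv_comp_neg' hd, neg_neg]

lemma fderiv_even_of_odd {f : E → F} (hd : Differentiable ℝ f) (hf : ∀ k, f (-k) = -f k) (k : E) :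
    fderiv ℝ f (-k) = fderiv ℝ f k := by
  have h : f = fun k => -f (-k) := funext fun k => by rw [hf, neg_neg]
  conv_rhs => rw [h]
  rw [fderiv_fun_neg, fderiv_comp_neg' hd, neg_neg]

omit [NormedSpace ℝ E] in
lemma map_zero_of_odd {f : E → F} (hf : ∀ k, f (-k) = -f k) : f 0 = 0 := by
  have h := hf 0
  rw [neg_zero] at h
  have h2 : (2 : ℝ) • f 0 = 0 := by rw [two_smul]; exact add_eq_zero_iff_eq_neg.2 h
  exact (smul_eq_zero.1 h2).resolve_left two_ne_zero

lemma exists_norm_sub_le [FiniteDimensional ℝ E] {g : E → F} (hg : ContDiff ℝ (⊤ : ℕ∞) g) (R : ℝ) :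
    ∃ C, 0 ≤ C ∧ ∀ k, ‖k‖ ≤ R → ‖g k - g 0‖ ≤ C * ‖k‖ ^ 1 := by
  obtain ⟨M, hM⟩ := (isCompact_closedBall (0 : E) R).exists_bound_of_continuousOn
    hg.fderiv_of_top.continuous.continuousOn
  exact ⟨max M 0, le_max_right _ _, fun k hk => norm_le_pow_succ_of_fderiv (n := 0)
    (g := fun k => g k - g 0) (hg.differentiable_of_top.sub_const _) (sub_self _)
    (le_max_right _ _) (fun k hk => by
      rw [pow_zero, mul_one, fderiv_sub_const]
      exact (hM k (by simpa using hk)).trans (le_max_left _ _)) hk⟩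

lemma exists_norm_le_sq_of_even [FiniteDimensional ℝ E] {g : E → F} (hg : ContDiff ℝ (⊤ : ℕ∞) g)
    (he : ∀ k, g (-k) = g k) (h0 : g 0 = 0) (R : ℝ) :
    ∃ C, 0 ≤ C ∧ ∀ k, ‖k‖ ≤ R → ‖g k‖ ≤ C * ‖k‖ ^ 2 := by
  obtain ⟨C, hC, h⟩ := exists_norm_sub_le hg.fderiv_of_top R
  have hodd := fderiv_odd_of_even hg.differentiable_of_top he
  refine ⟨C, hC, fun k hk => norm_le_pow_succ_of_fderiv hg.differentiable_of_top h0 hC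
    (fun k hk => ?_) hk⟩
  have := h k hk
  rwa [map_zero_of_odd hodd, sub_zero] at this

/-- A smooth even function which vanishes to third order at the origin vanishes to fourth order. -/
theorem even_taylor_bound [FiniteDimensional ℝ E] {f : E → ℝ} (hf : ContDiff ℝ (⊤ : ℕ∞) f)
    (heven : ∀ k, f (-k) = f k) (hO : f =O[𝓝 0] fun k => ‖k‖ ^ 3) (R : ℝ) :
    ∃ C, 0 ≤ C ∧ ∀ k, ‖k‖ ≤ R → |f k| ≤ C * ‖k‖ ^ 4 ∧ ‖fderiv ℝ f k‖ ≤ C * ‖k‖ ^ 3 := by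
  have h1 := hf.fderiv_of_top
  have h2 := h1.fderiv_of_top
  set f1 := fderiv ℝ f
  set f2 := fderiv ℝ f1
  have o1 : ∀ k, f1 (-k) = -f1 k := fderiv_odd_of_even hf.differentiable_of_top heven
  have e2 : ∀ k, f2 (-k) = f2 k := fderiv_even_of_odd h1.differentiable_of_top o1
  have z0 : f 0 = 0 := by
    obtain ⟨C, hC⟩ := hO.bound
    simpa using hC.self_of_nhds
  have z1 : f1 0 = 0 := map_zero_of_odd (f := f1) o1
  have z2 : f2 0 = 0 := by
    set B := f2 0 with hB
    obtain ⟨M, hM, c2⟩ := exists_norm_sub_le h2 1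
    have c1 : ∀ k, ‖k‖ ≤ 1 → ‖f1 k - B k‖ ≤ M * ‖k‖ ^ 2 := fun k hk =>
      norm_le_pow_succ_of_fderiv (n := 1) (g := fun k => f1 k - B k)
        (h1.differentiable_of_top.sub B.differentiable) (by simp [z1]) hM (fun k hk => by
          rw [fderiv_fun_sub (h1.differentiable_of_top k) B.differentiableAt, ContinuousLinearMap.fderiv]
          exact c2 k hk) hk
    have hsymm : ∀ x y, B x y = B y x := by
      have : ContDiffAt ℝ (⊤ : ℕ∞) f 0 := hf.contDiffAt
      have := this.isSymmSndFDerivAt (by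
        rw [minSmoothness_of_isRCLikeNormedField]
        exact WithTop.coe_le_coe.2 (le_top (a := (2 : ℕ∞))))
      exact fun x y => this x y
    have hq : ∀ k, HasFDerivAt (fun k => (1 / 2 : ℝ) * B k k) (B k) k := by
      intro k
      have h := (B.hasFDerivAt (x := k)).clm_apply (hasFDerivAt_id (𝕜 := ℝ) k)
      have h' := h.const_mul (1 / 2 : ℝ)
      refine h'.congr_fderiv ?_
      ext y
      simp [hsymm y k]
      ring
    have c0 : ∀ k, ‖k‖ ≤ 1 → ‖f k - (1 / 2 : ℝ) * B k k‖ ≤ M * ‖k‖ ^ 3 := fun k hk =>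
      norm_le_pow_succ_of_fderiv (n := 2) (g := fun k => f k - (1 / 2 : ℝ) * B k k)
        (hf.differentiable_of_top.sub fun k => (hq k).differentiableAt) (by simp [z0]) hM
        (fun k hk => by
          rw [fderiv_fun_sub (hf.differentiable_of_top k) (hq k).differentiableAt, (hq k).fderiv]
          exact c1 k hk) hk
    obtain ⟨C, hC0, hC⟩ := hO.exists_pos
    have hdiag : ∀ k, B k k = 0 := by
      intro k
      have hlim : Tendsto (fun t : ℝ => t • k) (𝓝[>] 0) (𝓝 0) := by
        have : Tendsto (fun t : ℝ => t • k) (𝓝 0) (𝓝 ((0 : ℝ) • k)) :=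
          (continuous_id.smul continuous_const).tendsto 0
        rw [zero_smul] at this
        exact this.mono_left nhdsWithin_le_nhds
      have hev : ∀ᶠ t : ℝ in 𝓝[>] 0, |B k k| ≤ t * (2 * (C + M) * ‖k‖ ^ 3) := by
        filter_upwards [hlim.eventually hC.bound,
          hlim.eventually (Metric.closedBall_mem_nhds (0 : E) one_pos),
          self_mem_nhdsWithin] with t ht1 ht2 ht3
        have ht3' : (0 : ℝ) < t := ht3
        rw [dist_zero_right] at ht2
        have h5 := c0 _ ht2
        have h6 : (1 / 2 : ℝ) * B (t • k) (t • k) = t ^ 2 * (B k k / 2) := by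
          simp; ring
        rw [h6] at h5
        have h7 : ‖t • k‖ = t * ‖k‖ := by rw [norm_smul, Real.norm_of_nonneg ht3'.le]
        rw [norm_pow, norm_norm] at ht1
        rw [h7, mul_pow] at h5 ht1
        have h8 : |t ^ 2 * (B k k / 2)| ≤ (C + M) * (t ^ 3 * ‖k‖ ^ 3) := by
          rw [Real.norm_eq_abs] at h5 ht1
          have := abs_sub_abs_le_abs_sub (t ^ 2 * (B k k / 2)) (f (t • k))
          rw [abs_sub_comm] at this
          linarith
        rw [abs_mul, abs_of_pos (by positivity : 0 < t ^ 2), abs_div, abs_two] at h8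
        have h9 : t ^ 2 * |B k k| ≤ t ^ 2 * (t * (2 * (C + M) * ‖k‖ ^ 3)) := by
          nlinarith
        exact le_of_mul_le_mul_left h9 (by positivity)
      have hlim2 : Tendsto (fun t : ℝ => t * (2 * (C + M) * ‖k‖ ^ 3)) (𝓝[>] 0) (𝓝 0) := by
        have : Tendsto (fun t : ℝ => t * (2 * (C + M) * ‖k‖ ^ 3)) (𝓝 0)
            (𝓝 (0 * (2 * (C + M) * ‖k‖ ^ 3))) :=
          (continuous_id.mul continuous_const).tendsto 0
        rw [zero_mul] at this
        exact this.mono_left nhdsWithin_le_nhds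
      exact abs_eq_zero.1 (le_antisymm (ge_of_tendsto hlim2 hev) (abs_nonneg _))
    ext x y
    have h := hdiag (x + y)
    simp only [map_add, add_apply, hdiag, hsymm y x] at h
    simp only [zero_apply]
    linarith
  obtain ⟨M, hM, b2⟩ := exists_norm_le_sq_of_even h2 e2 z2 R
  have b1 : ∀ k, ‖k‖ ≤ R → ‖f1 k‖ ≤ M * ‖k‖ ^ 3 := fun k hk =>
    norm_le_pow_succ_of_fderiv h1.differentiable_of_top z1 hM b2 hk
  exact ⟨M, hM, fun k hk => ⟨norm_le_pow_succ_of_fderiv hf.differentiable_of_top z0 hM b1 hk,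
    b1 k hk⟩⟩

end

/-! ### Oscillatory integrals -/

lemma abs_integral_cos_mul_le {g w : ℝ → ℝ} {a b x φ M : ℝ} (hab : a ≤ b) (hx : x ≠ 0)
    (hg : ∀ s ∈ Set.Icc a b, DifferentiableAt ℝ g s)
    (hga : |g a| ≤ M) (hgb : |g b| ≤ M) (hw : Integrable w) (hw0 : ∀ s, 0 ≤ w s)
    (hg' : ∀ s ∈ Set.Icc a b, s ≠ 0 → |deriv g s| ≤ w s) :
    |∫ s in a..b, Real.cos (x * s + φ) * g s| ≤ (2 * M + ∫ s, w s) / |x| := by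
  have hx' : 0 < |x| := abs_pos.2 hx
  have hint : IntervalIntegrable (deriv g) volume a b := by
    rw [intervalIntegrable_iff_integrableOn_Ioc_of_le hab]
    refine Integrable.mono' hw.integrableOn (measurable_deriv g).aestronglyMeasurable ?_
    have h0 : ∀ᵐ s : ℝ, s ≠ 0 := by simp [ae_iff]
    filter_upwards [ae_restrict_mem measurableSet_Ioc, ae_restrict_of_ae h0] with s hs hs0
    exact hg' s ⟨hs.1.le, hs.2⟩ hs0
  have hv : ∀ s, HasDerivAt (fun s => Real.sin (x * s + φ) / x) (Real.cos (x * s + φ)) s := by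
    intro s
    have h := (((hasDerivAt_id s).const_mul x).add_const φ).sin.div_const x
    refine h.congr_deriv ?_
    simp; field_simp
  have hibp := intervalIntegral.integral_mul_deriv_eq_deriv_mul (a := a) (b := b)
    (u := g) (u' := deriv g) (v := fun s => Real.sin (x * s + φ) / x)
    (v' := fun s => Real.cos (x * s + φ))
    (fun s hs => (hg s (by rwa [Set.uIcc_of_le hab] at hs)).hasDerivAt) (fun s _ => hv s) hint
    (Continuous.intervalIntegrable (by fun_prop) _ _)
  simp_rw [mul_comm (Real.cos _)]
  rw [hibp]
  have hsin : ∀ y, |Real.sin y / x| ≤ 1 / |x| := fun y => by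
    rw [abs_div]; gcongr; exact Real.abs_sin_le_one y
  have hM : 0 ≤ M := (abs_nonneg _).trans hga
  have t1 : |g b * (Real.sin (x * b + φ) / x)| ≤ M * (1 / |x|) := by
    rw [abs_mul]; gcongr; exact hsin _
  have t2 : |g a * (Real.sin (x * a + φ) / x)| ≤ M * (1 / |x|) := by
    rw [abs_mul]; gcongr; exact hsin _
  have t3 : |∫ s in a..b, deriv g s * (Real.sin (x * s + φ) / x)| ≤ (∫ s, w s) * (1 / |x|) := by
    rw [← Real.norm_eq_abs, intervalIntegral.integral_of_le hab]
    have h0 : ∀ᵐ s : ℝ, s ≠ 0 := by simp [ae_iff]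
    refine (norm_integral_le_of_norm_le (g := fun s => w s * (1 / |x|))
      (hw.integrableOn.mul_const _) ?_).trans ?_
    · filter_upwards [ae_restrict_mem measurableSet_Ioc, ae_restrict_of_ae h0] with s hs hs0
      rw [norm_mul]
      exact mul_le_mul (hg' s ⟨hs.1.le, hs.2⟩ hs0) (hsin _) (norm_nonneg _) (hw0 s)
    · rw [integral_mul_const]
      gcongr
      · exact ae_of_all _ hw0
      · exact Measure.restrict_le_self
  have e : (2 * M + ∫ s, w s) / |x| = M * (1 / |x|) + M * (1 / |x|) + (∫ s, w s) * (1 / |x|) := by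
    ring
  rw [e, abs_le]
  rw [abs_le] at t1 t2 t3
  constructor <;> linarith

/-- An oscillatory integral over the plane of a function which is piecewise differentiable in the
first variable. -/
theorem abs_integral_cos_mul_prod_le {G : ℝ × ℝ → ℝ} {ω : ℝ → ℝ} {M L : ℝ} (hL : 0 < L)
    (hM : 0 ≤ M)
    (hGm : Measurable G) (hω : Integrable ω) (hω0 : ∀ s, 0 ≤ ω s) (hω2 : ∀ s, L ≤ |s| → ω s ≤ 2)
    (hG : ∀ a b, a ≠ 0 → b ≠ 0 → |G (a, b)| ≤ M * ω a * ω b)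
    (hpw : ∀ b, b ≠ 0 → ∃ g₁ g₂ : ℝ → ℝ,
      (∀ a ∈ Set.Ioo (-L) L, G (a, b) = g₁ a) ∧ (∀ a, L < |a| → G (a, b) = g₂ a) ∧
      (∀ a ∈ Set.Icc (-L) L, DifferentiableAt ℝ g₁ a ∧
        (a ≠ 0 → |g₁ a| ≤ M * ω a * ω b ∧ |deriv g₁ a| ≤ M * ω a * ω b)) ∧
      ∀ a, L ≤ |a| → DifferentiableAt ℝ g₂ a ∧ |g₂ a| ≤ M * ω a * ω b ∧
        |deriv g₂ a| ≤ M * ω a * ω b) (x : ℝ) (hx : x ≠ 0) (φ : ℝ → ℝ) (hφ : Measurable φ) :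
    |∫ z : ℝ × ℝ, Real.cos (x * z.1 + φ z.2) * G z| ≤
      3 * (4 * M + M * ∫ s, ω s) * (∫ s, ω s) / |x| := by
  have hx' : 0 < |x| := abs_pos.2 hx
  have hint : Integrable (fun z : ℝ × ℝ => Real.cos (x * z.1 + φ z.2) * G z) := by
    refine Integrable.mono' (((hω.const_mul M).mul_prod hω)) ?_ ?_
    · exact (by fun_prop : Measurable _).aestronglyMeasurable
    · have h1 : ∀ᵐ z : ℝ × ℝ, z.1 ≠ 0 :=
        Measure.quasiMeasurePreserving_fst.ae (p := fun a => a ≠ 0) (by simp [ae_iff])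
      have h2 : ∀ᵐ z : ℝ × ℝ, z.2 ≠ 0 :=
        Measure.quasiMeasurePreserving_snd.ae (p := fun a => a ≠ 0) (by simp [ae_iff])
      filter_upwards [h1, h2] with z hz1 hz2
      rw [norm_mul]
      have := hG z.1 z.2 hz1 hz2
      calc _ ≤ 1 * |G z| := by
            gcongr
            · exact Real.abs_cos_le_one _
            · exact le_rfl
        _ ≤ _ := by rw [one_mul]; exact this
  rw [Measure.volume_eq_prod, integral_prod_symm _ hint, ← Real.norm_eq_abs]
  have hb0 : ∀ᵐ b : ℝ, b ≠ 0 := by simp [ae_iff]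
  have key : ∀ b, b ≠ 0 → ‖∫ a, Real.cos (x * a + φ b) * G (a, b)‖ ≤
      3 * (4 * M + M * ∫ s, ω s) / |x| * ω b := by
    intro b hb
    by_cases hI : Integrable fun a => Real.cos (x * a + φ b) * G (a, b)
    swap
    · rw [integral_undef hI, norm_zero]
      have : 0 ≤ ∫ s, ω s := integral_nonneg hω0
      have := hω0 b
      positivity
    have hlim := intervalIntegral_tendsto_integral hI tendsto_neg_atTop_atBot
      (tendsto_id (x := (atTop : Filter ℝ)))
    obtain ⟨g₁, g₂, e1, e2, d1, d2⟩ := hpw b hb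
    refine le_of_tendsto hlim.norm ?_
    filter_upwards [eventually_gt_atTop L] with T hT
    simp only [id]
    have hsub : ∀ u v : ℝ, IntervalIntegrable (fun a => Real.cos (x * a + φ b) * G (a, b))
        volume u v := fun u v => hI.intervalIntegrable
    rw [← intervalIntegral.integral_add_adjacent_intervals (hsub (-T) (-L)) (hsub (-L) T),
      ← intervalIntegral.integral_add_adjacent_intervals (hsub (-L) L) (hsub L T)]
    have hωM : ∀ a, L ≤ |a| → M * ω a * ω b ≤ 2 * (M * ω b) := fun a ha => by
      have := hω2 a ha
      have := mul_le_mul_of_nonneg_left this (mul_nonneg hM (hω0 b))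
      linarith
    have hwI : Integrable fun a => M * ω a * ω b := (hω.const_mul M).mul_const _
    have hw0 : ∀ a, 0 ≤ M * ω a * ω b := fun a => by
      have := hω0 a; have := hω0 b; positivity
    have hcongr : ∀ u v : ℝ, u ≤ v → ∀ g : ℝ → ℝ, (∀ a ∈ Set.Ioo u v, G (a, b) = g a) →
        ∫ a in u..v, Real.cos (x * a + φ b) * G (a, b) =
          ∫ a in u..v, Real.cos (x * a + φ b) * g a := fun u v huv g hg => by
      rw [intervalIntegral.integral_of_le huv, intervalIntegral.integral_of_le huv,
        integral_Ioc_eq_integral_Ioo, integral_Ioc_eq_integral_Ioo]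
      exact setIntegral_congr_fun measurableSet_Ioo fun a ha => by simp only [hg a ha]
    have outer : ∀ u v : ℝ, u ≤ v → (∀ s ∈ Set.Icc u v, L ≤ |s|) →
        (∀ s ∈ Set.Ioo u v, L < |s|) →
        |∫ a in u..v, Real.cos (x * a + φ b) * G (a, b)| ≤
          (2 * (2 * (M * ω b)) + ∫ a, M * ω a * ω b) / |x| := fun u v huv h1 h2 => by
      rw [hcongr u v huv g₂ fun a ha => e2 a (h2 a ha)]
      refine abs_integral_cos_mul_le huv hx (fun s hs => (d2 s (h1 s hs)).1) ?_ ?_ hwI hw0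
        fun s hs _ => (d2 s (h1 s hs)).2.2
      · exact (d2 u (h1 u (by simp [huv]))).2.1.trans (hωM u (h1 u (by simp [huv])))
      · exact (d2 v (h1 v (by simp [huv]))).2.1.trans (hωM v (h1 v (by simp [huv])))
    have c1 := outer (-T) (-L) (by linarith)
      (fun s hs => by rw [abs_of_nonpos (by linarith [hs.2])]; linarith [hs.2])
      (fun s hs => by rw [abs_of_nonpos (by linarith [hs.2])]; linarith [hs.2])
    have c3 := outer L T hT.le (fun s hs => hs.1.trans (le_abs_self s))
      (fun s hs => hs.1.trans_le (le_abs_self s))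
    have c2 : |∫ a in (-L)..L, Real.cos (x * a + φ b) * G (a, b)| ≤
        (2 * (2 * (M * ω b)) + ∫ a, M * ω a * ω b) / |x| := by
      rw [hcongr (-L) L (by linarith) g₁ e1]
      refine abs_integral_cos_mul_le (by linarith) hx (fun s hs => (d1 s hs).1) ?_ ?_ hwI hw0
        fun s hs h0 => ((d1 s hs).2 h0).2
      · exact ((d1 (-L) (by constructor <;> linarith)).2 (by linarith)).1.trans
          (hωM _ (by rw [abs_neg]; exact le_abs_self L))
      · exact ((d1 L (by constructor <;> linarith)).2 (by linarith)).1.trans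
          (hωM _ (le_abs_self L))
    have e : 3 * (4 * M + M * ∫ s, ω s) / |x| * ω b =
        (2 * (2 * (M * ω b)) + ∫ a, M * ω a * ω b) / |x| +
        ((2 * (2 * (M * ω b)) + ∫ a, M * ω a * ω b) / |x| +
        (2 * (2 * (M * ω b)) + ∫ a, M * ω a * ω b) / |x|) := by
      rw [integral_mul_const, integral_const_mul]; ring
    rw [e, Real.norm_eq_abs]
    exact (abs_add_le _ _).trans (add_le_add c1 ((abs_add_le _ _).trans (add_le_add c2 c3)))
  refine (norm_integral_le_of_norm_le (hω.const_mul (3 * (4 * M + M * ∫ s, ω s) / |x|)) ?_).trans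
    (le_of_eq ?_)
  · filter_upwards [hb0] with b hb
    exact key b hb
  · rw [integral_const_mul]; ring

/-! ### The exponential integral -/

lemma exp_neg_inv_div_le {t : ℝ} (ht : 0 < t) : Real.exp (-(1 / t)) / t ≤ 1 := by
  rw [div_le_one ht, Real.exp_neg, inv_le_comm₀ (Real.exp_pos _) ht, ← one_div]
  exact (by linarith : 1 / t ≤ 1 / t + 1).trans (Real.add_one_le_exp _)

lemma integrableOn_one_sub_exp_div (Y : ℝ) (hY : 0 ≤ Y) :
    IntegrableOn (fun t : ℝ => (1 - Real.exp (-(Y / t))) / t) (Set.Ioi 1) := by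
  refine Integrable.mono' (g := fun t : ℝ => Y * t ^ (-2 : ℝ))
    ((integrableOn_Ioi_rpow_of_lt (by norm_num) one_pos).const_mul Y)
    (by fun_prop : Measurable _).aestronglyMeasurable ?_
  filter_upwards [ae_restrict_mem measurableSet_Ioi] with t ht
  have ht0 : (0 : ℝ) < t := one_pos.trans ht
  have h0 : 0 ≤ Y / t := by positivity
  have h1 : Real.exp (-(Y / t)) ≤ 1 := Real.exp_le_one_iff.2 (by linarith)
  have h2 := Real.add_one_le_exp (-(Y / t))
  rw [Real.norm_of_nonneg (div_nonneg (by linarith) ht0.le), Real.rpow_neg ht0.le,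
    div_le_iff₀ ht0]
  have : Y * (t ^ (2 : ℝ))⁻¹ * t = Y / t := by
    rw [Real.rpow_two]; field_simp
  rw [this]; linarith

/-- The logarithmic asymptotics of the exponential integral. -/
lemma exists_abs_integral_one_sub_exp_sub_log_le : ∃ c : ℝ, ∀ Y : ℝ, 0 < Y →
    |(∫ t in Set.Ioi (1 : ℝ), (1 - Real.exp (-(Y / t))) / t) - Real.log Y - c| ≤ 1 / Y := by
  set h : ℝ → ℝ := fun t => (1 - Real.exp (-(1 / t))) / t with hh
  set g : ℝ → ℝ := fun t => Real.exp (-(1 / t)) / t with hg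
  have hgm : Measurable g := by fun_prop
  have hgb : ∀ t, 0 ≤ t → ‖g t‖ ≤ 1 := by
    intro t ht
    rcases ht.eq_or_lt with rfl | ht
    · simp [hg]
    · rw [Real.norm_of_nonneg (by positivity)]
      exact exp_neg_inv_div_le ht
  have hgi : ∀ a b : ℝ, 0 ≤ a → 0 ≤ b → IntervalIntegrable g volume a b := by
    intro a b ha hb
    rw [intervalIntegrable_iff]
    refine Measure.integrableOn_of_bounded (M := 1) (by simp [Set.uIoc]) hgm.aestronglyMeasurable ?_
    filter_upwards [ae_restrict_mem measurableSet_uIoc] with t ht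
    exact hgb t ((le_min ha hb).trans ht.1.le)
  have hhg : ∀ t, h t = t⁻¹ - g t := fun t => by simp only [hh, hg]; ring
  refine ⟨(∫ t in Set.Ioi (1 : ℝ), h t) - ∫ t in (0 : ℝ)..1, g t, fun Y hY => ?_⟩
  have hY' : 0 < Y⁻¹ := inv_pos.2 hY
  have e1 : ∫ t in Set.Ioi (1 : ℝ), (1 - Real.exp (-(Y / t))) / t =
      ∫ t in Set.Ioi Y⁻¹, h t := by
    have := integral_comp_mul_left_Ioi' h 1 hY'
    rw [mul_one] at this
    rw [← this, ← integral_smul]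
    refine integral_congr_ae (ae_of_all _ fun t => ?_)
    simp only [hh, smul_eq_mul, one_div, mul_inv, inv_inv]
    field_simp
  have hinv : IntervalIntegrable (fun t : ℝ => t⁻¹) volume Y⁻¹ 1 :=
    intervalIntegral.intervalIntegrable_inv (fun t ht => by
      have := (lt_min hY' one_pos).trans_le ht.1
      exact this.ne') continuousOn_id
  have hhi : IntervalIntegrable h volume Y⁻¹ 1 := by
    rw [funext hhg]
    exact hinv.sub (hgi _ _ hY'.le zero_le_one)
  have e2 : ∫ t in Set.Ioi Y⁻¹, h t = (∫ t in Y⁻¹..1, h t) + ∫ t in Set.Ioi 1, h t := by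
    have hI := integrableOn_one_sub_exp_div 1 zero_le_one
    exact (intervalIntegral.integral_interval_add_Ioi'  hhi hI).symm
  have e3 : ∫ t in Y⁻¹..1, h t = Real.log Y - ((∫ t in (0 : ℝ)..1, g t) - ∫ t in (0 : ℝ)..Y⁻¹, g t) := by
    rw [funext hhg, intervalIntegral.integral_sub hinv (hgi _ _ hY'.le zero_le_one),
      integral_inv_of_pos hY' one_pos, ← intervalIntegral.integral_interval_sub_left
        (hgi 0 1 le_rfl zero_le_one) (hgi 0 Y⁻¹ le_rfl hY'.le)]
    simp
  have e4 : ‖∫ t in (0 : ℝ)..Y⁻¹, g t‖ ≤ 1 * |Y⁻¹ - 0| :=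
    intervalIntegral.norm_integral_le_of_norm_le_const fun t ht => hgb t (by
      rw [Set.uIoc_of_le hY'.le] at ht; exact ht.1.le)
  rw [e1, e2, e3]
  rw [sub_zero, abs_of_pos hY', one_mul, Real.norm_eq_abs, inv_eq_one_div] at e4
  convert e4 using 2
  ring_nf

/-! ### The Gaussian potential -/

lemma integrable_exp_neg_mul_norm_sq {t : ℝ} (ht : 0 < t) :
    Integrable fun q : Plane => Real.exp (-(t * ‖q‖ ^ 2)) := by
  have h := (GaussianFourier.integrable_cexp_neg_mul_sq_norm_add (b := (t : ℂ)) (by simpa using ht) 0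
    (0 : Plane)).re
  refine h.congr (ae_of_all _ fun q => ?_)
  have : -(t : ℂ) * ‖q‖ ^ 2 + 0 * ((inner ℝ (0 : Plane) q : ℝ) : ℂ) = ((-(t * ‖q‖ ^ 2) : ℝ) : ℂ) := by
    push_cast; ring
  simp only [this]
  rw [← Complex.ofReal_exp]
  rfl

lemma integral_cos_mul_exp_neg_mul_sq {t : ℝ} (ht : 0 < t) (X : Plane) :
    ∫ q : Plane, Real.cos (inner ℝ q X) * Real.exp (-(t * ‖q‖ ^ 2)) =
      Real.pi / t * Real.exp (-(‖X‖ ^ 2 / 4 / t)) := by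
  have hb : 0 < (t : ℂ).re := by simpa using ht
  have h := GaussianFourier.integral_cexp_neg_mul_sq_norm_add hb Complex.I X
  have hi := GaussianFourier.integrable_cexp_neg_mul_sq_norm_add hb Complex.I X
  have h1 : ∀ q : Plane, (Complex.exp (-(t : ℂ) * ‖q‖ ^ 2 + Complex.I * ((inner ℝ X q : ℝ) : ℂ))).re =
      Real.cos (inner ℝ q X) * Real.exp (-(t * ‖q‖ ^ 2)) := by
    intro q
    have : -(t : ℂ) * ‖q‖ ^ 2 + Complex.I * ((inner ℝ X q : ℝ) : ℂ) =
        ((-(t * ‖q‖ ^ 2) : ℝ) : ℂ) + ((inner ℝ q X : ℝ) : ℂ) * Complex.I := by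
      rw [real_inner_comm]; push_cast; ring
    rw [this, Complex.exp_add, ← Complex.ofReal_exp, Complex.re_ofReal_mul,
      Complex.exp_ofReal_mul_I_re, mul_comm]
  have h2 := congrArg Complex.re h
  rw [← RCLike.re_eq_complex_re, ← integral_re hi] at h2
  simp only [RCLike.re_eq_complex_re, h1] at h2
  rw [h2]
  have : ((Real.pi : ℂ) / t) ^ ((Module.finrank ℝ Plane : ℂ) / 2) *
      Complex.exp (Complex.I ^ 2 * ‖X‖ ^ 2 / (4 * t)) =
      ((Real.pi / t * Real.exp (-(‖X‖ ^ 2 / 4 / t)) : ℝ) : ℂ) := by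
    rw [finrank_euclideanSpace_fin]
    push_cast
    rw [div_self two_ne_zero, Complex.cpow_one, Complex.I_sq]
    congr 2
    field_simp
  rw [this, Complex.ofReal_re]

/-- `(1 - cos ⟨q, X⟩) e^{-|q|²} / |q|²`. -/
noncomputable def gaussianPotentialIntegrand (X q : Plane) : ℝ :=
  (1 - Real.cos (inner ℝ q X)) * (Real.exp (-‖q‖ ^ 2) / ‖q‖ ^ 2)

lemma integral_gaussianPotentialIntegrand (X : Plane) :
    Integrable (gaussianPotentialIntegrand X) ∧ ∫ q, gaussianPotentialIntegrand X q =
      Real.pi * ∫ t in Set.Ioi (1 : ℝ), (1 - Real.exp (-(‖X‖ ^ 2 / 4 / t))) / t := by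
  set F : Plane → ℝ → ℝ := fun q t => (1 - Real.cos (inner ℝ q X)) * Real.exp (-(t * ‖q‖ ^ 2))
    with hF
  have hF0 : ∀ q t, 0 ≤ F q t := fun q t => by
    have := Real.cos_le_one (inner ℝ q X)
    exact mul_nonneg (by linarith) (Real.exp_pos _).le
  have hI : ∀ t, 0 < t → Integrable fun q => F q t := fun t ht => by
    refine (integrable_exp_neg_mul_norm_sq ht).bdd_mul (c := 2)
      (by fun_prop : Measurable fun q : Plane => 1 - Real.cos (inner ℝ q X)).aestronglyMeasurable
      (ae_of_all _ fun q => ?_)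
    rw [Real.norm_eq_abs, abs_le]
    constructor <;> linarith [Real.cos_le_one (inner ℝ q X), Real.neg_one_le_cos (inner ℝ q X)]
  have hIc : ∀ t, 0 < t → Integrable fun q : Plane =>
      Real.cos (inner ℝ q X) * Real.exp (-(t * ‖q‖ ^ 2)) := fun t ht => by
    refine (integrable_exp_neg_mul_norm_sq ht).bdd_mul (c := 1)
      (by fun_prop : Measurable fun q : Plane => Real.cos (inner ℝ q X)).aestronglyMeasurable
      (ae_of_all _ fun q => Real.abs_cos_le_one _)
  have hint : ∀ t, 0 < t → ∫ q, F q t =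
      Real.pi * ((1 - Real.exp (-(‖X‖ ^ 2 / 4 / t))) / t) := fun t ht => by
    have e : ∀ q, F q t = Real.exp (-(t * ‖q‖ ^ 2)) -
        Real.cos (inner ℝ q X) * Real.exp (-(t * ‖q‖ ^ 2)) := fun q => by simp only [hF]; ring
    simp_rw [e]
    rw [integral_sub (integrable_exp_neg_mul_norm_sq ht) (hIc t ht), integral_cos_mul_exp_neg_mul_sq ht]
    have := integral_cos_mul_exp_neg_mul_sq ht 0
    simp only [inner_zero_right, Real.cos_zero, one_mul] at this
    rw [this]
    simp
    ring
  have hFi : Integrable (Function.uncurry F) (volume.prod (volume.restrict (Set.Ioi (1 : ℝ)))) := by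
    rw [integrable_prod_iff' (by simp only [hF, Function.uncurry_def]; exact
      (by fun_prop : Measurable _).aestronglyMeasurable)]
    constructor
    · filter_upwards [ae_restrict_mem measurableSet_Ioi] with t ht
      exact hI t (one_pos.trans ht)
    · refine ((integrableOn_one_sub_exp_div (‖X‖ ^ 2 / 4) (by positivity)).const_mul Real.pi).congr ?_
      filter_upwards [ae_restrict_mem measurableSet_Ioi] with t ht
      simp only [Function.uncurry_apply_pair, Real.norm_of_nonneg (hF0 _ _)]
      exact (hint t (one_pos.trans ht)).symm
  have hinner : ∀ᵐ q : Plane, ∫ t in Set.Ioi (1 : ℝ), F q t = gaussianPotentialIntegrand X q := by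
    filter_upwards [ae_apply_ne 0 0] with q hq
    have hq0 : 0 < ‖q‖ ^ 2 := by
      have : q ≠ 0 := by rintro rfl; simp at hq
      positivity
    have := integral_exp_mul_Ioi (a := -‖q‖ ^ 2) (by linarith) 1
    simp only [hF]
    rw [integral_const_mul]
    have e : ∀ t : ℝ, -(t * ‖q‖ ^ 2) = -‖q‖ ^ 2 * t := fun t => by ring
    simp_rw [e]
    rw [this, gaussianPotentialIntegrand, mul_one, neg_div_neg_eq]
  refine ⟨hFi.integral_prod_left.congr hinner, ?_⟩
  rw [← integral_congr_ae hinner, integral_integral_swap hFi, ← integral_const_mul]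
  exact setIntegral_congr_fun measurableSet_Ioi fun t ht => hint t (one_pos.trans ht)

lemma exists_abs_integral_gaussianPotentialIntegrand_sub_le : ∃ c : ℝ, ∀ X : Plane, X ≠ 0 →
    |(∫ q, gaussianPotentialIntegrand X q) - 2 * Real.pi * Real.log ‖X‖ - c| ≤
      4 * Real.pi / ‖X‖ ^ 2 := by
  obtain ⟨c, hc⟩ := exists_abs_integral_one_sub_exp_sub_log_le
  refine ⟨Real.pi * (c - Real.log 4), fun X hX => ?_⟩
  have hX' : 0 < ‖X‖ := norm_pos_iff.2 hX
  have h := hc (‖X‖ ^ 2 / 4) (by positivity)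
  rw [(integral_gaussianPotentialIntegrand X).2]
  rw [Real.log_div (by positivity) (by norm_num), Real.log_pow, Nat.cast_ofNat] at h
  set J := ∫ t in Set.Ioi (1 : ℝ), (1 - Real.exp (-(‖X‖ ^ 2 / 4 / t))) / t
  have e : Real.pi * J - 2 * Real.pi * Real.log ‖X‖ - Real.pi * (c - Real.log 4) =
      Real.pi * (J - (2 * Real.log ‖X‖ - Real.log 4) - c) := by ring
  rw [e, abs_mul, abs_of_pos Real.pi_pos]
  exact (mul_le_mul_of_nonneg_left h Real.pi_pos.le).trans_eq (by field_simp)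

/-! ### Linear change of variables -/

section
variable {What V : Matrix (Fin 2) (Fin 2) ℝ} {w : ℝ}

/-- `-k·Ŵk`. -/
noncomputable def quadForm (What : Matrix (Fin 2) (Fin 2) ℝ) (k : Plane) : ℝ :=
  -(k.ofLp ⬝ᵥ (What *ᵥ k.ofLp))

/-- A matrix as a linear map of the plane. -/
noncomputable def planeMap (V : Matrix (Fin 2) (Fin 2) ℝ) : Plane →ₗ[ℝ] Plane :=
  Matrix.toEuclideanLin V

lemma planeMap_apply (V : Matrix (Fin 2) (Fin 2) ℝ) (x : Plane) :
    planeMap V x = WithLp.toLp 2 (V *ᵥ x.ofLp) := rfl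

lemma normV_eq (V : Matrix (Fin 2) (Fin 2) ℝ) (x : Plane) : normV V x = ‖planeMap V x‖ := rfl

lemma det_planeMap (V : Matrix (Fin 2) (Fin 2) ℝ) : LinearMap.det (planeMap V) = V.det := by
  rw [planeMap, Matrix.toEuclideanLin_eq_toLin_orthonormal, LinearMap.det_toLin]

lemma inner_planeMap_transpose (V : Matrix (Fin 2) (Fin 2) ℝ) (q x : Plane) :
    inner ℝ (planeMap Vᵀ q) x = inner ℝ q (planeMap V x) := by
  rw [planeMap_apply, planeMap_apply, PiLp.inner_apply, PiLp.inner_apply]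
  simp [Matrix.mulVec, dotProduct, Fin.sum_univ_two]
  ring

lemma quadForm_planeMap (hV : V * What * Vᵀ = -1) (q : Plane) :
    quadForm What (planeMap Vᵀ q) = ‖q‖ ^ 2 := by
  rw [quadForm, planeMap_apply]
  simp only
  rw [Matrix.mulVec_mulVec, Matrix.dotProduct_mulVec, Matrix.mulVec_transpose,
    Matrix.vecMul_vecMul, ← Matrix.mul_assoc, hV, EuclideanSpace.norm_sq_eq]
  simp [Matrix.vecMul_neg, dotProduct, Fin.sum_univ_two]
  ring

lemma abs_det_mul (hw : 0 < w) (hw2 : w ^ 2 = What.det) (hV : V * What * Vᵀ = -1) :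
    |V.det| * w = 1 := by
  have h := congrArg Matrix.det hV
  rw [Matrix.det_mul, Matrix.det_mul, Matrix.det_transpose, ← hw2, Matrix.det_neg, Matrix.det_one]
    at h
  simp at h
  have : (|V.det| * w) ^ 2 = 1 := by rw [mul_pow, sq_abs, ← h]; ring
  exact (pow_eq_one_iff_of_nonneg (by positivity) two_ne_zero).1 this

lemma integral_planeMap (hw : 0 < w) (hw2 : w ^ 2 = What.det) (hV : V * What * Vᵀ = -1)
    (f : Plane → ℝ) : (Integrable (fun q => f (planeMap Vᵀ q)) ↔ Integrable f) ∧
      ∫ q, f (planeMap Vᵀ q) = w * ∫ k, f k := by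
  have h1 := abs_det_mul hw hw2 hV
  have hdet : LinearMap.det (planeMap Vᵀ) ≠ 0 := by
    rw [det_planeMap, Matrix.det_transpose]
    intro h; rw [h] at h1; simp at h1
  have hinv : |(LinearMap.det (planeMap Vᵀ))⁻¹| = w := by
    rw [abs_inv, det_planeMap, Matrix.det_transpose]
    exact inv_eq_of_mul_eq_one_right h1
  have hmap := Measure.map_linearMap_addHaar_eq_smul_addHaar (volume : Measure Plane) hdet
  rw [hinv] at hmap
  let e := ((planeMap Vᵀ).equivOfDetNeZero hdet).toContinuousLinearEquiv.toHomeomorph.toMeasurableEquiv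
  have he : ∀ q, e q = planeMap Vᵀ q := fun q => rfl
  have hmap' : (volume : Measure Plane).map e = ENNReal.ofReal w • volume := hmap
  constructor
  · have := integrable_map_equiv (μ := volume) e f
    rw [hmap', integrable_smul_measure (by simpa using hw) ENNReal.ofReal_ne_top] at this
    exact this.symm
  · have := integral_map_equiv (μ := volume) e f
    rw [hmap', integral_smul_measure, ENNReal.toReal_ofReal hw.le] at this
    exact this.symm

/-- The potential of the Gaussian regularisation of the inverse of the quadratic form. -/
lemma exists_abs_integral_quadForm_sub_le (hw : 0 < w) (hw2 : w ^ 2 = What.det)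
    (hV : V * What * Vᵀ = -1) :
    (∀ x : Plane, Integrable fun k => (1 - Real.cos (inner ℝ k x)) *
      (Real.exp (-quadForm What k) / quadForm What k)) ∧
    ∃ c : ℝ, ∀ x : Plane, normV V x ≠ 0 →
      |(∫ k, (1 - Real.cos (inner ℝ k x)) * (Real.exp (-quadForm What k) / quadForm What k)) -
        2 * Real.pi / w * Real.log (normV V x) - c| ≤ 4 * Real.pi / w / normV V x ^ 2 := by
  have e : ∀ x q : Plane, (1 - Real.cos (inner ℝ (planeMap Vᵀ q) x)) *
      (Real.exp (-quadForm What (planeMap Vᵀ q)) / quadForm What (planeMap Vᵀ q)) =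
      gaussianPotentialIntegrand (planeMap V x) q := fun x q => by
    rw [gaussianPotentialIntegrand, quadForm_planeMap hV, inner_planeMap_transpose]
  refine ⟨fun x => ?_, ?_⟩
  · rw [← (integral_planeMap hw hw2 hV _).1]
    simp_rw [e]
    exact (integral_gaussianPotentialIntegrand _).1
  · obtain ⟨c, hc⟩ := exists_abs_integral_gaussianPotentialIntegrand_sub_le
    refine ⟨c / w, fun x hx => ?_⟩
    have h := hc (planeMap V x) (by rwa [← norm_ne_zero_iff])
    have h2 := (integral_planeMap hw hw2 hV fun k => (1 - Real.cos (inner ℝ k x)) *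
      (Real.exp (-quadForm What k) / quadForm What k)).2
    simp_rw [e] at h2
    rw [h2, ← normV_eq] at h
    set J := ∫ k, (1 - Real.cos (inner ℝ k x)) *
      (Real.exp (-quadForm What k) / quadForm What k)
    have e' : J - 2 * Real.pi / w * Real.log (normV V x) - c / w =
        (w * J - 2 * Real.pi * Real.log (normV V x) - c) / w := by field_simp
    rw [e', abs_div, abs_of_pos hw]
    exact (div_le_div_of_nonneg_right h hw.le).trans_eq (by ring)

end

/-! ### Coordinates on the plane -/

/-- The point with `i`-th coordinate `a` and other coordinate `b`. -/
noncomputable def planePoint (i : Fin 2) (a b : ℝ) : Plane :=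
  WithLp.toLp 2 fun j => if j = i then a else b

lemma norm_planePoint_sq (i : Fin 2) (a b : ℝ) : ‖planePoint i a b‖ ^ 2 = a ^ 2 + b ^ 2 := by
  rw [EuclideanSpace.norm_sq_eq]
  fin_cases i <;> simp [planePoint, add_comm]

lemma inner_planePoint (i : Fin 2) (a b : ℝ) (x : Plane) :
    inner ℝ (planePoint i a b) x = x i * a + x (i + 1) * b := by
  rw [PiLp.inner_apply]
  fin_cases i <;> simp [planePoint, Fin.sum_univ_two, add_comm]

lemma hasDerivAt_planePoint (i : Fin 2) (a b : ℝ) :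
    HasDerivAt (fun a => planePoint i a b) (EuclideanSpace.single i 1) a := by
  have h : HasDerivAt (fun a : ℝ => fun j : Fin 2 => if j = i then a else b) (Pi.single i 1) a := by
    rw [hasDerivAt_pi]
    intro j
    by_cases hj : j = i
    · subst hj; simp only [if_true, Pi.single_eq_same]; exact hasDerivAt_id' a
    · simpa [hj] using hasDerivAt_const a b
  exact (PiLp.continuousLinearEquiv 2 ℝ fun _ : Fin 2 => ℝ).symm.hasFDerivAt.comp_hasDerivAt a h

lemma planePoint_mem_brillouin (i : Fin 2) (a b : ℝ) :
    planePoint i a b ∈ brillouin ↔ |a| ≤ Real.pi ∧ |b| ≤ Real.pi := by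
  simp only [brillouin, Set.mem_ofPred_eq, Fin.forall_fin_two, Set.mem_Icc, ← abs_le]
  fin_cases i <;> simp [planePoint, and_comm]

/-- `planePoint` as a measurable equivalence. -/
noncomputable def planeEquiv (i : Fin 2) : ℝ × ℝ ≃ᵐ Plane :=
  (if i = 0 then MeasurableEquiv.refl _ else MeasurableEquiv.prodComm).trans
    ((MeasurableEquiv.finTwoArrow (α := ℝ)).symm.trans (MeasurableEquiv.toLp 2 _))

lemma planeEquiv_apply (i : Fin 2) (z : ℝ × ℝ) : planeEquiv i z = planePoint i z.1 z.2 := by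
  ext j
  fin_cases i <;> fin_cases j <;>
    simp [planeEquiv, planePoint, MeasurableEquiv.finTwoArrow, MeasurableEquiv.prodComm,
      MeasurableEquiv.piFinTwo]

lemma measurePreserving_planeEquiv (i : Fin 2) : MeasurePreserving (planeEquiv i) := by
  have h1 : MeasurePreserving ((MeasurableEquiv.finTwoArrow (α := ℝ)).symm.trans
      (MeasurableEquiv.toLp 2 (Fin 2 → ℝ))) :=
    (PiLp.volume_preserving_toLp (Fin 2)).comp (volume_preserving_finTwoArrow ℝ).symm
  by_cases hi : i = 0
  · simp only [planeEquiv, hi, if_true]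
    exact h1.comp (MeasurePreserving.id _)
  · simp only [planeEquiv, hi, if_false]
    refine h1.comp ?_
    exact Measure.measurePreserving_swap

lemma integral_planePoint (i : Fin 2) (f : Plane → ℝ) :
    ∫ z : ℝ × ℝ, f (planePoint i z.1 z.2) = ∫ k, f k := by
  rw [← (measurePreserving_planeEquiv i).integral_comp (planeEquiv i).measurableEmbedding f]
  simp_rw [planeEquiv_apply]

lemma integrable_planePoint (i : Fin 2) (f : Plane → ℝ) :
    Integrable (fun z : ℝ × ℝ => f (planePoint i z.1 z.2)) ↔ Integrable f := by
  rw [← (measurePreserving_planeEquiv i).integrable_comp_emb (planeEquiv i).measurableEmbedding]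
  simp_rw [Function.comp_def, planeEquiv_apply]

lemma measurable_planePoint (i : Fin 2) : Measurable fun z : ℝ × ℝ => planePoint i z.1 z.2 := by
  have := (planeEquiv i).measurable
  rwa [show (planeEquiv i : ℝ × ℝ → Plane) = fun z => planePoint i z.1 z.2 from
    funext (planeEquiv_apply i)] at this

/-! ### The majorant -/

/-- `|a|^{-1/2}` on `[-π, π]`, plus a Gaussian. -/
noncomputable def majorant (c a : ℝ) : ℝ :=
  (Set.Icc (-Real.pi) Real.pi).indicator (fun a => |a| ^ (-(1 / 2) : ℝ)) a + Real.exp (-c * a ^ 2)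

lemma majorant_nonneg (c a : ℝ) : 0 ≤ majorant c a :=
  add_nonneg (Set.indicator_nonneg (fun _ _ => by positivity) _) (Real.exp_pos _).le

lemma integrable_majorant {c : ℝ} (hc : 0 < c) : Integrable (majorant c) := by
  refine Integrable.add ?_ (integrable_exp_neg_mul_sq hc)
  rw [integrable_indicator_iff measurableSet_Icc]
  have h1 : IntegrableOn (fun a : ℝ => |a| ^ (-(1 / 2) : ℝ)) (Set.Ioc 0 Real.pi) := by
    have := (intervalIntegral.intervalIntegrable_rpow' (a := 0) (b := Real.pi)
      (r := (-(1 / 2) : ℝ)) (by norm_num))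
    rw [intervalIntegrable_iff_integrableOn_Ioc_of_le Real.pi_pos.le] at this
    exact this.congr_fun (fun a ha => by simp only [abs_of_pos ha.1]) measurableSet_Ioc
  have h2 : IntegrableOn (fun a : ℝ => |a| ^ (-(1 / 2) : ℝ)) (Set.Ico (-Real.pi) 0) := by
    have h := h1
    rw [← integrable_indicator_iff measurableSet_Ioc] at h
    have := h.comp_neg
    rw [← integrable_indicator_iff measurableSet_Ico]
    refine this.congr (ae_of_all _ fun a => ?_)
    simp only [Set.indicator, Set.mem_Ioc, Set.mem_Ico, abs_neg]
    congr 1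
    simp only [eq_iff_iff]
    constructor <;> rintro ⟨h, h'⟩ <;> constructor <;> linarith
  have h3 : IntegrableOn (fun a : ℝ => |a| ^ (-(1 / 2) : ℝ)) ({0} : Set ℝ) := by
    simp
  refine ((h2.union h3).union h1).mono_set fun a ha => ?_
  rcases lt_trichotomy a 0 with h | h | h
  · exact Or.inl (Or.inl ⟨ha.1, h⟩)
  · exact Or.inl (Or.inr h)
  · exact Or.inr ⟨h, ha.2⟩

lemma majorant_le_two {c a : ℝ} (hc : 0 < c) (ha : Real.pi ≤ |a|) : majorant c a ≤ 2 := by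
  have h1 : (Set.Icc (-Real.pi) Real.pi).indicator (fun a => |a| ^ (-(1 / 2) : ℝ)) a ≤ 1 := by
    by_cases h : a ∈ Set.Icc (-Real.pi) Real.pi
    · rw [Set.indicator_of_mem h]
      exact Real.rpow_le_one_of_one_le_of_nonpos (by linarith [Real.pi_gt_three]) (by norm_num)
    · rw [Set.indicator_of_notMem h]
      exact zero_le_one
  have h2 : Real.exp (-c * a ^ 2) ≤ 1 := Real.exp_le_one_iff.2 (by nlinarith [sq_nonneg a])
  unfold majorant
  linarith

lemma one_div_norm_le_majorant {c a b : ℝ} (i : Fin 2) (ha : |a| ≤ Real.pi) (hb : |b| ≤ Real.pi)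
    (ha0 : a ≠ 0) (hb0 : b ≠ 0) : 1 / ‖planePoint i a b‖ ≤ majorant c a * majorant c b := by
  have ha' : 0 < |a| := abs_pos.2 ha0
  have hb' : 0 < |b| := abs_pos.2 hb0
  have h1 : ∀ {x : ℝ}, |x| ≤ Real.pi → |x| ^ (-(1 / 2) : ℝ) ≤ majorant c x := fun {x} hx => by
    rw [majorant, Set.indicator_of_mem (Set.mem_Icc.2 (abs_le.1 hx))]
    linarith [Real.exp_pos (-c * x ^ 2)]
  refine le_trans ?_ (mul_le_mul (h1 ha) (h1 hb) (by positivity) (majorant_nonneg _ _))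
  rw [← Real.mul_rpow ha'.le hb'.le, Real.rpow_neg (by positivity), ← Real.sqrt_eq_rpow, one_div]
  refine inv_anti₀ (by positivity) (Real.sqrt_le_iff.2 ⟨norm_nonneg _, ?_⟩)
  rw [norm_planePoint_sq, ← sq_abs a, ← sq_abs b]
  nlinarith [sq_nonneg (|a| - |b|)]

lemma exp_neg_norm_sq_le_majorant {c : ℝ} (i : Fin 2) (a b : ℝ) :
    Real.exp (-(c * ‖planePoint i a b‖ ^ 2)) ≤ majorant c a * majorant c b := by
  have h1 : ∀ x : ℝ, Real.exp (-c * x ^ 2) ≤ majorant c x := fun x => by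
    rw [majorant]
    linarith [Set.indicator_nonneg (s := Set.Icc (-Real.pi) Real.pi)
      (f := fun a : ℝ => |a| ^ (-(1 / 2) : ℝ)) (fun _ _ => by positivity) x]
  rw [norm_planePoint_sq]
  refine le_trans (le_of_eq ?_) (mul_le_mul (h1 a) (h1 b) (Real.exp_pos _).le (majorant_nonneg _ _))
  rw [← Real.exp_add]; congr 1; ring

/-! ### Elementary bounds -/

lemma abs_one_div_sub_one_div_le {p q c C r : ℝ} (hc : 0 < c) (hr : 0 < r) (hp : c * r ^ 2 ≤ p)
    (hq : c * r ^ 2 ≤ q) (hpq : |p - q| ≤ C * r ^ 4) : |1 / p - 1 / q| ≤ C / c ^ 2 := by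
  have h0 : 0 < c * r ^ 2 := by positivity
  have hp0 := h0.trans_le hp
  have hq0 := h0.trans_le hq
  have hC : 0 ≤ C := by
    have := (abs_nonneg _).trans hpq
    exact nonneg_of_mul_nonneg_left this (by positivity)
  rw [div_sub_div _ _ hp0.ne' hq0.ne', abs_div, abs_of_pos (mul_pos hp0 hq0),
    div_le_div_iff₀ (mul_pos hp0 hq0) (by positivity), one_mul, mul_one, abs_sub_comm]
  calc |p - q| * c ^ 2 ≤ C * r ^ 4 * c ^ 2 := by gcongr
    _ = C * ((c * r ^ 2) * (c * r ^ 2)) := by ring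
    _ ≤ C * (p * q) := by gcongr

lemma abs_deriv_one_div_sub_one_div_le {p q p' q' c C r : ℝ} (hc : 0 < c) (hr : 0 < r)
    (hp : c * r ^ 2 ≤ p) (hq : c * r ^ 2 ≤ q) (hpq : |p - q| ≤ C * r ^ 4)
    (hpq' : |p' - q'| ≤ C * r ^ 3) (hq' : |q'| ≤ C * r) (hpC : p ≤ C * r ^ 2)
    (hqC : q ≤ C * r ^ 2) :
    |-p' / p ^ 2 - -q' / q ^ 2| ≤ (C / c ^ 2 + 2 * C ^ 3 / c ^ 4) * (1 / r) := by
  have h0 : 0 < c * r ^ 2 := by positivity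
  have hp0 := h0.trans_le hp
  have hq0 := h0.trans_le hq
  have hC : 0 ≤ C := by
    have := (abs_nonneg _).trans hpq
    exact nonneg_of_mul_nonneg_left this (by positivity)
  have e : -p' / p ^ 2 - -q' / q ^ 2 =
      -(p' - q') / p ^ 2 + q' * ((p - q) * (p + q)) / (p ^ 2 * q ^ 2) := by field_simp; ring
  rw [e]
  have t1 : |-(p' - q') / p ^ 2| ≤ C * r ^ 3 / (c * r ^ 2) ^ 2 := by
    rw [abs_div, abs_neg, abs_of_pos (by positivity : 0 < p ^ 2)]
    gcongr
  have t2 : |q' * ((p - q) * (p + q)) / (p ^ 2 * q ^ 2)| ≤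
      C * r * (C * r ^ 4 * (C * r ^ 2 + C * r ^ 2)) / ((c * r ^ 2) ^ 2 * (c * r ^ 2) ^ 2) := by
    rw [abs_div, abs_mul, abs_mul, abs_of_pos (by positivity : 0 < p ^ 2 * q ^ 2),
      abs_of_pos (by positivity : 0 < p + q)]
    gcongr
  refine (abs_add_le _ _).trans ((add_le_add t1 t2).trans (le_of_eq ?_))
  field_simp
  ring

lemma exp_neg_div_le {q c r : ℝ} (hc : 0 < c) (hr : 1 ≤ r) (hq : c * r ^ 2 ≤ q) :
    |Real.exp (-q) / q| ≤ 1 / c * Real.exp (-(c * r ^ 2)) := by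
  have hq0 : 0 < q := (by positivity : 0 < c * r ^ 2).trans_le hq
  have hcq : c ≤ q := (by nlinarith [one_le_pow₀ hr (n := 2)] : c ≤ c * r ^ 2).trans hq
  rw [abs_of_pos (by positivity), div_eq_mul_one_div, mul_comm]
  gcongr

lemma abs_deriv_exp_neg_div_le {q q' c D r : ℝ} (hc : 0 < c) (hr : 1 ≤ r) (hq : c * r ^ 2 ≤ q)
    (hq' : |q'| ≤ D * r) :
    |q' * (1 + q) * Real.exp (-q) / q ^ 2| ≤
      D * (1 / c ^ 2 + 1 / c) * Real.exp (-(c * r ^ 2)) := by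
  have hr0 : 0 < r := by linarith
  have hq0 : 0 < q := (by positivity : 0 < c * r ^ 2).trans_le hq
  have hD : 0 ≤ D := nonneg_of_mul_nonneg_left ((abs_nonneg _).trans hq') hr0
  have e : q' * (1 + q) * Real.exp (-q) / q ^ 2 = q' * (1 / q ^ 2 + 1 / q) * Real.exp (-q) := by
    field_simp
  rw [e, abs_mul, abs_mul, abs_of_pos (Real.exp_pos _),
    abs_of_pos (by positivity : 0 < 1 / q ^ 2 + 1 / q)]
  have h1 : D * r * (1 / q ^ 2 + 1 / q) ≤ D * (1 / c ^ 2 + 1 / c) := by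
    have hr2 : r ≤ r ^ 2 := by nlinarith
    have hcr : c * r ≤ q := (mul_le_mul_of_nonneg_left hr2 hc.le).trans hq
    have hcr2 : c ^ 2 * r ≤ q ^ 2 :=
      (by rw [mul_pow]; gcongr : c ^ 2 * r ≤ (c * r) ^ 2).trans (by gcongr)
    rw [mul_assoc]
    gcongr
    rw [mul_add]
    gcongr
    · rw [mul_one_div, div_le_div_iff₀ (by positivity) (by positivity)]; linarith
    · rw [mul_one_div, div_le_div_iff₀ (by positivity) (by positivity)]; linarith
  calc |q'| * (1 / q ^ 2 + 1 / q) * Real.exp (-q)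
      ≤ D * r * (1 / q ^ 2 + 1 / q) * Real.exp (-(c * r ^ 2)) := by gcongr
    _ ≤ _ := by gcongr

/-! ### Comparison of the symbol with a regularised quadratic form -/

section
variable {A : ℤ × ℤ → ℤ × ℤ → ℝ} {What : Matrix (Fin 2) (Fin 2) ℝ}

/-- `q e^q` for the quadratic form `q = -k·Ŵk`. -/
noncomputable def regSymbol (What : Matrix (Fin 2) (Fin 2) ℝ) (k : Plane) : ℝ :=
  quadForm What k * Real.exp (quadForm What k)

lemma contDiff_quadForm : ContDiff ℝ (⊤ : ℕ∞) (quadForm What) := by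
  have : quadForm What = fun k : Plane => -(k 0 * (What 0 0 * k 0 + What 0 1 * k 1) +
      k 1 * (What 1 0 * k 0 + What 1 1 * k 1)) := by
    ext k
    simp only [quadForm, dotProduct, Matrix.mulVec, Fin.sum_univ_two]
  rw [this]
  fun_prop

lemma contDiff_regSymbol : ContDiff ℝ (⊤ : ℕ∞) (regSymbol What) :=
  contDiff_quadForm.mul (Real.contDiff_exp.comp contDiff_quadForm)

lemma quadForm_neg (k : Plane) : quadForm What (-k) = quadForm What k := by
  rw [quadForm, quadForm, WithLp.ofLp_neg, Matrix.mulVec_neg, neg_dotProduct_neg]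

lemma quadForm_zero : quadForm What 0 = 0 := by simp [quadForm]

lemma regSymbol_neg (k : Plane) : regSymbol What (-k) = regSymbol What k := by
  rw [regSymbol, quadForm_neg, regSymbol]

lemma regSymbol_zero : regSymbol What 0 = 0 := by simp [regSymbol, quadForm_zero]

lemma quadForm_planePoint (i : Fin 2) (a b : ℝ) : quadForm What (planePoint i a b) =
    -(What i i * a ^ 2 + (What i (i + 1) + What (i + 1) i) * b * a +
      What (i + 1) (i + 1) * b ^ 2) := by
  fin_cases i <;> simp [quadForm, planePoint, dotProduct, Matrix.mulVec, Fin.sum_univ_two] <;> ring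

lemma hasDerivAt_quadForm_planePoint (i : Fin 2) (a b : ℝ) :
    HasDerivAt (fun a => quadForm What (planePoint i a b))
      (-(What i i * (2 * a) + (What i (i + 1) + What (i + 1) i) * b)) a := by
  simp_rw [quadForm_planePoint]
  have h := ((((hasDerivAt_pow 2 a).const_mul (What i i)).add
    ((hasDerivAt_id' a).const_mul ((What i (i + 1) + What (i + 1) i) * b))).add_const
      (What (i + 1) (i + 1) * b ^ 2)).neg
  refine h.congr_deriv ?_
  simp

lemma abs_le_norm_planePoint (i : Fin 2) (a b : ℝ) :
    |a| ≤ ‖planePoint i a b‖ ∧ |b| ≤ ‖planePoint i a b‖ := by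
  have h := norm_planePoint_sq i a b
  constructor <;> refine abs_le_of_sq_le_sq ?_ (norm_nonneg _) <;> nlinarith [sq_nonneg a, sq_nonneg b]

lemma exists_abs_deriv_quadForm_le (What : Matrix (Fin 2) (Fin 2) ℝ) (i : Fin 2) :
    ∃ D, 0 ≤ D ∧ ∀ a b, |-(What i i * (2 * a) + (What i (i + 1) + What (i + 1) i) * b)| ≤
      D * ‖planePoint i a b‖ := by
  refine ⟨2 * |What i i| + |What i (i + 1) + What (i + 1) i|, by positivity, fun a b => ?_⟩
  obtain ⟨h1, h2⟩ := abs_le_norm_planePoint i a b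
  rw [abs_neg]
  refine (abs_add_le _ _).trans ?_
  rw [abs_mul, abs_mul, abs_mul, abs_two]
  nlinarith [mul_le_mul_of_nonneg_left h1 (abs_nonneg (What i i)),
    mul_le_mul_of_nonneg_left h2 (abs_nonneg (What i (i + 1) + What (i + 1) i))]

lemma isBigO_regSymbol_sub : (fun k : Plane => regSymbol What k - quadForm What k) =O[𝓝 0]
    fun k : Plane => ‖k‖ ^ 3 := by
  obtain ⟨C, hC, h⟩ := exists_norm_le_sq_of_even (contDiff_quadForm (What := What)) quadForm_neg
    quadForm_zero 1
  have h1 : (quadForm What) =O[𝓝 0] fun k : Plane => ‖k‖ ^ 2 := by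
    refine Asymptotics.IsBigO.of_bound C ?_
    filter_upwards [Metric.closedBall_mem_nhds (0 : Plane) one_pos] with k hk
    rw [norm_pow, norm_norm]
    exact h k (by simpa using hk)
  have h2 : (fun k : Plane => Real.exp (quadForm What k) - 1) =O[𝓝 0] fun k : Plane => ‖k‖ ^ 2 := by
    have ht : Tendsto (quadForm What) (𝓝 0) (𝓝 0) := by
      have := (contDiff_quadForm (What := What)).continuous.tendsto 0
      rwa [quadForm_zero] at this
    have h3 : (fun y : ℝ => Real.exp y - 1) =O[𝓝 0] fun y : ℝ => y := by
      have := (Real.hasDerivAt_exp 0).isBigO_sub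
      simpa using this
    exact (h3.comp_tendsto ht).trans h1
  have h4 := h1.mul h2
  have h5 : (fun k : Plane => ‖k‖ ^ 2 * ‖k‖ ^ 2) =O[𝓝 0] fun k : Plane => ‖k‖ ^ 3 := by
    refine Asymptotics.IsBigO.of_bound 1 ?_
    filter_upwards [Metric.closedBall_mem_nhds (0 : Plane) one_pos] with k hk
    have hk1 : ‖k‖ ≤ 1 := by simpa using hk
    rw [one_mul, Real.norm_of_nonneg (by positivity), Real.norm_of_nonneg (by positivity), ← pow_add]
    exact pow_le_pow_of_le_one (norm_nonneg _) hk1 (by norm_num)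
  refine (h4.trans h5).congr_left fun k => ?_
  rw [regSymbol]; ring

lemma norm_le_of_mem_brillouin {k : Plane} (hk : k ∈ brillouin) : ‖k‖ ≤ 2 * Real.pi := by
  refine abs_le_of_sq_le_sq' ?_ Real.two_pi_pos.le |>.2
  rw [EuclideanSpace.norm_sq_eq, Fin.sum_univ_two, Real.norm_eq_abs, Real.norm_eq_abs]
  have h0 := abs_le.2 (hk 0)
  have h1 := abs_le.2 (hk 1)
  nlinarith [abs_nonneg (k 0), abs_nonneg (k 1), Real.pi_pos]

lemma IsAdmissible.exists_symbol_bounds (hA : IsAdmissible A What) : ∃ c C : ℝ, 0 < c ∧ 0 ≤ C ∧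
    (∀ k, c * ‖k‖ ^ 2 ≤ quadForm What k) ∧ ∀ k ∈ brillouin,
      c * ‖k‖ ^ 2 ≤ -Rhat A k ∧ c * ‖k‖ ^ 2 ≤ regSymbol What k ∧
      |(-Rhat A k) - regSymbol What k| ≤ C * ‖k‖ ^ 4 ∧
      ‖fderiv ℝ (fun k => -Rhat A k) k - fderiv ℝ (regSymbol What) k‖ ≤ C * ‖k‖ ^ 3 ∧
      ‖fderiv ℝ (regSymbol What) k‖ ≤ C * ‖k‖ ∧ -Rhat A k ≤ C * ‖k‖ ^ 2 ∧
      regSymbol What k ≤ C * ‖k‖ ^ 2 := by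
  obtain ⟨c₁, hc₁, h1⟩ := hA.exists_quadratic_lower_bound
  obtain ⟨c₂, hc₂, h2⟩ := hA.exists_lower_bound
  have hP : ContDiff ℝ (⊤ : ℕ∞) fun k => -Rhat A k := hA.contDiff_Rhat.neg
  have hS : ContDiff ℝ (⊤ : ℕ∞) (regSymbol What) := contDiff_regSymbol
  have hPe : ∀ k, -Rhat A (-k) = -Rhat A k := fun k => by rw [Rhat_neg]
  obtain ⟨C₁, hC₁, h3⟩ := exists_norm_le_sq_of_even hP hPe (by rw [hA.Rhat_zero, neg_zero])
    (2 * Real.pi)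
  obtain ⟨C₂, hC₂, h4⟩ := exists_norm_le_sq_of_even hS regSymbol_neg regSymbol_zero (2 * Real.pi)
  obtain ⟨C₃, hC₃, h5⟩ := exists_norm_sub_le hS.fderiv_of_top (2 * Real.pi)
  have h0 : fderiv ℝ (regSymbol What) 0 = 0 :=
    map_zero_of_odd (f := fderiv ℝ (regSymbol What))
      (fderiv_odd_of_even hS.differentiable_of_top regSymbol_neg)
  have hO : (fun k => -Rhat A k - regSymbol What k) =O[𝓝 0] fun k : Plane => ‖k‖ ^ 3 := by
    refine (hA.expansion.add (isBigO_regSymbol_sub (What := What))).neg_left.congr_left fun k => ?_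
    simp only [quadForm]; ring
  obtain ⟨C₄, hC₄, h6⟩ := even_taylor_bound (hP.sub hS)
    (fun k => by simp only [hPe, regSymbol_neg]) hO (2 * Real.pi)
  have hc : 0 < min c₁ c₂ := lt_min hc₁ hc₂
  have hq : ∀ k, min c₁ c₂ * ‖k‖ ^ 2 ≤ quadForm What k := fun k =>
    (mul_le_mul_of_nonneg_right (min_le_left _ _) (by positivity)).trans (h1 k)
  refine ⟨min c₁ c₂, C₁ + C₂ + C₃ + C₄, hc, by positivity, hq, fun k hk => ?_⟩
  have hkR := norm_le_of_mem_brillouin hk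
  have hq0 : 0 ≤ quadForm What k := (by positivity : 0 ≤ min c₁ c₂ * ‖k‖ ^ 2).trans (hq k)
  refine ⟨(mul_le_mul_of_nonneg_right (min_le_right _ _) (by positivity)).trans (h2 k hk),
    (hq k).trans (le_mul_of_one_le_right hq0 (Real.one_le_exp hq0)), ?_, ?_, ?_, ?_, ?_⟩
  · refine (h6 k hkR).1.trans ?_
    gcongr; linarith
  · have := (h6 k hkR).2
    rw [fderiv_fun_sub (hP.differentiable_of_top k) (hS.differentiable_of_top k)] at this
    refine this.trans ?_
    gcongr; linarith
  · have := h5 k hkR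
    rw [h0, sub_zero, pow_one] at this
    refine this.trans ?_
    gcongr; linarith
  · refine (le_abs_self _).trans ((h3 k hkR).trans ?_)
    gcongr; linarith
  · refine (le_abs_self _).trans ((h4 k hkR).trans ?_)
    gcongr; linarith

/-- The difference of the inverses of the symbol, on the Brillouin zone, and of the regularised
quadratic form, on the plane. -/
noncomputable def symbolDefect (A : ℤ × ℤ → ℤ × ℤ → ℝ) (What : Matrix (Fin 2) (Fin 2) ℝ)
    (k : Plane) : ℝ :=
  brillouin.indicator (fun k => (-Rhat A k)⁻¹) k - (regSymbol What k)⁻¹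

lemma IsAdmissible.exists_symbolDefect_bounds (hA : IsAdmissible A What) (i : Fin 2) :
    ∃ c M : ℝ, 0 < c ∧ 0 ≤ M ∧
    (∀ a b, a ≠ 0 → b ≠ 0 →
      |symbolDefect A What (planePoint i a b)| ≤ M * majorant c a * majorant c b) ∧
    ∀ b, b ≠ 0 → ∃ g₁ g₂ : ℝ → ℝ,
      (∀ a ∈ Set.Ioo (-Real.pi) Real.pi, symbolDefect A What (planePoint i a b) = g₁ a) ∧
      (∀ a, Real.pi < |a| → symbolDefect A What (planePoint i a b) = g₂ a) ∧
      (∀ a ∈ Set.Icc (-Real.pi) Real.pi, DifferentiableAt ℝ g₁ a ∧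
        (a ≠ 0 → |g₁ a| ≤ M * majorant c a * majorant c b ∧
          |deriv g₁ a| ≤ M * majorant c a * majorant c b)) ∧
      ∀ a, Real.pi ≤ |a| → DifferentiableAt ℝ g₂ a ∧ |g₂ a| ≤ M * majorant c a * majorant c b ∧
        |deriv g₂ a| ≤ M * majorant c a * majorant c b := by
  obtain ⟨c, C, hc, hC, hQ, hB⟩ := hA.exists_symbol_bounds
  obtain ⟨D, hD, hDq⟩ := exists_abs_deriv_quadForm_le What i
  have hpi := Real.pi_pos
  set M₁ := 2 * Real.pi * (C / c ^ 2) with hM₁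
  set M₂ := C / c ^ 2 + 2 * C ^ 3 / c ^ 4 with hM₂
  set M₃ := 1 / c with hM₃
  set M₄ := D * (1 / c ^ 2 + 1 / c) with hM₄
  have hM₁0 : 0 ≤ M₁ := by positivity
  have hM₂0 : 0 ≤ M₂ := by positivity
  have hM₃0 : 0 ≤ M₃ := by positivity
  have hM₄0 : 0 ≤ M₄ := by positivity
  set M := M₁ + M₂ + M₃ + M₄ with hM
  have hM0 : 0 ≤ M := by positivity
  have hωω : ∀ a b, 0 ≤ majorant c a * majorant c b := fun a b =>
    mul_nonneg (majorant_nonneg _ _) (majorant_nonneg _ _)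
  have hup : ∀ {N a b : ℝ}, N ≤ M → N * (majorant c a * majorant c b) ≤
      M * majorant c a * majorant c b := fun {N a b} h => by
    rw [mul_assoc]; exact mul_le_mul_of_nonneg_right h (hωω a b)
  have hne : ∀ {a b : ℝ}, b ≠ 0 → 0 < ‖planePoint i a b‖ := fun {a b} hb =>
    (abs_pos.2 hb).trans_le (abs_le_norm_planePoint i a b).2
  -- the two branches
  have inner_val : ∀ a b, |a| ≤ Real.pi → |b| ≤ Real.pi → a ≠ 0 → b ≠ 0 →
      |(-Rhat A (planePoint i a b))⁻¹ - (regSymbol What (planePoint i a b))⁻¹| ≤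
        M * majorant c a * majorant c b := fun a b ha hb ha0 hb0 => by
    have hk := (planePoint_mem_brillouin i a b).2 ⟨ha, hb⟩
    obtain ⟨h1, h2, h3, -⟩ := hB _ hk
    have h := abs_one_div_sub_one_div_le hc (hne (a := a) hb0) h1 h2 h3
    rw [one_div, one_div] at h
    have h4 := one_div_norm_le_majorant (c := c) i ha hb ha0 hb0
    have h5 := norm_le_of_mem_brillouin hk
    refine h.trans (le_trans ?_ (hup (N := M₁) (by linarith)))
    have h6 : C / c ^ 2 ≤ M₁ * (1 / ‖planePoint i a b‖) := by
      rw [hM₁, mul_one_div, le_div_iff₀ (hne hb0), mul_comm]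
      exact mul_le_mul_of_nonneg_right h5 (by positivity)
    exact h6.trans (mul_le_mul_of_nonneg_left h4 hM₁0)
  have outer_val : ∀ a b, Real.pi ≤ |a| ∨ Real.pi ≤ |b| →
      |-(regSymbol What (planePoint i a b))⁻¹| ≤ M * majorant c a * majorant c b := fun a b hab => by
    have hr : 1 ≤ ‖planePoint i a b‖ := by
      obtain ⟨h1, h2⟩ := abs_le_norm_planePoint i a b
      rcases hab with h | h <;> linarith [Real.pi_gt_three]
    have h := exp_neg_div_le hc hr (hQ _)
    have e : (regSymbol What (planePoint i a b))⁻¹ =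
        Real.exp (-quadForm What (planePoint i a b)) / quadForm What (planePoint i a b) := by
      rw [regSymbol, mul_inv, Real.exp_neg]; ring
    rw [abs_neg, e]
    refine h.trans (le_trans ?_ (hup (N := M₃) (by linarith)))
    exact mul_le_mul_of_nonneg_left (exp_neg_norm_sq_le_majorant i a b) hM₃0
  have outer_deriv : ∀ a b, b ≠ 0 ∨ a ≠ 0 →
      DifferentiableAt ℝ (fun a => -(regSymbol What (planePoint i a b))⁻¹) a ∧
      (Real.pi ≤ |a| ∨ Real.pi ≤ |b| →
        |deriv (fun a => -(regSymbol What (planePoint i a b))⁻¹) a| ≤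
          M * majorant c a * majorant c b) := fun a b hab0 => by
    have hr0 : 0 < ‖planePoint i a b‖ := by
      rcases hab0 with h | h
      · exact hne h
      · exact (abs_pos.2 h).trans_le (abs_le_norm_planePoint i a b).1
    have hq := hasDerivAt_quadForm_planePoint (What := What) i a b
    have hq0 : 0 < quadForm What (planePoint i a b) :=
      (by positivity : 0 < c * ‖planePoint i a b‖ ^ 2).trans_le (hQ _)
    have hd := ((hq.mul hq.exp).inv (mul_pos hq0 (Real.exp_pos _)).ne').neg
    have hd' : HasDerivAt (fun a => -(regSymbol What (planePoint i a b))⁻¹)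
        (-(What i i * (2 * a) + (What i (i + 1) + What (i + 1) i) * b) *
          (1 + quadForm What (planePoint i a b)) * Real.exp (-quadForm What (planePoint i a b)) /
            quadForm What (planePoint i a b) ^ 2) a := by
      refine hd.congr_deriv ?_
      rw [Real.exp_neg]
      have := Real.exp_pos (quadForm What (planePoint i a b))
      simp only [Pi.mul_apply]
      field_simp
      ring
    refine ⟨hd'.differentiableAt, fun hab => ?_⟩
    rw [hd'.deriv]
    have hr : 1 ≤ ‖planePoint i a b‖ := by
      obtain ⟨h1, h2⟩ := abs_le_norm_planePoint i a b
      rcases hab with h | h <;> linarith [Real.pi_gt_three]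
    refine (abs_deriv_exp_neg_div_le hc hr (hQ _) (hDq a b)).trans
      (le_trans ?_ (hup (N := M₄) (by linarith)))
    exact mul_le_mul_of_nonneg_left (exp_neg_norm_sq_le_majorant i a b) hM₄0
  have inner_deriv : ∀ a b, |a| ≤ Real.pi → |b| ≤ Real.pi → b ≠ 0 →
      DifferentiableAt ℝ (fun a => (-Rhat A (planePoint i a b))⁻¹ -
        (regSymbol What (planePoint i a b))⁻¹) a ∧ (a ≠ 0 →
      |deriv (fun a => (-Rhat A (planePoint i a b))⁻¹ -
        (regSymbol What (planePoint i a b))⁻¹) a| ≤ M * majorant c a * majorant c b) :=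
      fun a b ha hb hb0 => by
    obtain ⟨h1, h2, h3, h4, h5, h6, h7⟩ := hB _ ((planePoint_mem_brillouin i a b).2 ⟨ha, hb⟩)
    have hr := hne (a := a) hb0
    have hpos : 0 < c * ‖planePoint i a b‖ ^ 2 := by positivity
    have hP := ((hA.contDiff_Rhat.neg.differentiable_of_top (planePoint i a b)).hasFDerivAt).comp_hasDerivAt
      a (hasDerivAt_planePoint i a b)
    have hS := (((contDiff_regSymbol (What := What)).differentiable_of_top
      (planePoint i a b)).hasFDerivAt).comp_hasDerivAt a (hasDerivAt_planePoint i a b)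
    have hd := (hP.inv (hpos.trans_le h1).ne').sub (hS.inv (hpos.trans_le h2).ne')
    refine ⟨hd.differentiableAt, fun ha0 => ?_⟩
    have hd2 := hd.deriv
    have hsingle : ∀ T : Plane →L[ℝ] ℝ, |T (EuclideanSpace.single i 1)| ≤ ‖T‖ := fun T => by
      have := T.le_opNorm (EuclideanSpace.single i 1)
      simpa using this
    have key := abs_deriv_one_div_sub_one_div_le hc hr h1 h2 h3
      (p' := fderiv ℝ (fun k => -Rhat A k) (planePoint i a b) (EuclideanSpace.single i 1))
      (q' := fderiv ℝ (regSymbol What) (planePoint i a b) (EuclideanSpace.single i 1))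
      ((hsingle (_ - _)).trans h4) ((hsingle _).trans h5) h6 h7
    refine (le_of_eq (congrArg _ hd2)).trans (key.trans (le_trans ?_ (hup (N := M₂) (by linarith))))
    exact mul_le_mul_of_nonneg_left (one_div_norm_le_majorant i ha hb ha0 hb0) hM₂0
  have hin : ∀ {a b : ℝ}, |a| ≤ Real.pi → |b| ≤ Real.pi → symbolDefect A What (planePoint i a b) =
      (-Rhat A (planePoint i a b))⁻¹ - (regSymbol What (planePoint i a b))⁻¹ := fun ha hb => by
    rw [symbolDefect, Set.indicator_of_mem ((planePoint_mem_brillouin i _ _).2 ⟨ha, hb⟩)]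
  have hout : ∀ {a b : ℝ}, Real.pi < |a| ∨ Real.pi < |b| →
      symbolDefect A What (planePoint i a b) = -(regSymbol What (planePoint i a b))⁻¹ :=
      fun {a b} h => by
    rw [symbolDefect, Set.indicator_of_notMem, zero_sub]
    rw [planePoint_mem_brillouin]
    rintro ⟨h1, h2⟩
    rcases h with h | h <;> linarith
  refine ⟨c, M, hc, hM0, fun a b ha0 hb0 => ?_, fun b hb0 => ?_⟩
  · by_cases h : |a| ≤ Real.pi ∧ |b| ≤ Real.pi
    · rw [hin h.1 h.2]; exact inner_val a b h.1 h.2 ha0 hb0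
    · have h' : Real.pi < |a| ∨ Real.pi < |b| := by
        by_contra hcon; push Not at hcon; exact h hcon
      rw [hout h']
      exact outer_val a b (h'.imp le_of_lt le_of_lt)
  · by_cases hb : |b| ≤ Real.pi
    · refine ⟨fun a => (-Rhat A (planePoint i a b))⁻¹ - (regSymbol What (planePoint i a b))⁻¹,
        fun a => -(regSymbol What (planePoint i a b))⁻¹, fun a ha => hin (abs_le.2 ⟨ha.1.le, ha.2.le⟩) hb,
        fun a ha => hout (Or.inl ha), fun a ha => ?_, fun a ha => ?_⟩
      · have ha' := abs_le.2 (Set.mem_Icc.1 ha)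
        exact ⟨(inner_deriv a b ha' hb hb0).1, fun ha0 => ⟨inner_val a b ha' hb ha0 hb0,
          (inner_deriv a b ha' hb hb0).2 ha0⟩⟩
      · exact ⟨(outer_deriv a b (Or.inl hb0)).1, outer_val a b (Or.inl ha),
          (outer_deriv a b (Or.inl hb0)).2 (Or.inl ha)⟩
    · rw [not_le] at hb
      refine ⟨fun a => -(regSymbol What (planePoint i a b))⁻¹,
        fun a => -(regSymbol What (planePoint i a b))⁻¹, fun a ha => hout (Or.inr hb),
        fun a ha => hout (Or.inl ha), fun a ha => ?_, fun a ha => ?_⟩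
      · exact ⟨(outer_deriv a b (Or.inl hb0)).1, fun _ => ⟨outer_val a b (Or.inr hb.le),
          (outer_deriv a b (Or.inl hb0)).2 (Or.inr hb.le)⟩⟩
      · exact ⟨(outer_deriv a b (Or.inl hb0)).1, outer_val a b (Or.inl ha),
          (outer_deriv a b (Or.inl hb0)).2 (Or.inl ha)⟩

lemma IsAdmissible.measurable_symbolDefect (hA : IsAdmissible A What) :
    Measurable (symbolDefect A What) :=
  ((hA.contDiff_Rhat.continuous.measurable.neg.inv).indicator measurableSet_brillouin).sub
    contDiff_regSymbol.continuous.measurable.inv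

lemma IsAdmissible.integrable_symbolDefect (hA : IsAdmissible A What) :
    Integrable (symbolDefect A What) := by
  obtain ⟨c, M, hc, hM, h, -⟩ := hA.exists_symbolDefect_bounds 0
  rw [← integrable_planePoint 0]
  refine Integrable.mono' (((integrable_majorant hc).const_mul M).mul_prod (integrable_majorant hc))
    (hA.measurable_symbolDefect.comp (measurable_planePoint 0)).aestronglyMeasurable ?_
  have h1 : ∀ᵐ z : ℝ × ℝ, z.1 ≠ 0 :=
    Measure.quasiMeasurePreserving_fst.ae (p := fun a => a ≠ 0) (by simp [ae_iff])
  have h2 : ∀ᵐ z : ℝ × ℝ, z.2 ≠ 0 :=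
    Measure.quasiMeasurePreserving_snd.ae (p := fun a => a ≠ 0) (by simp [ae_iff])
  filter_upwards [h1, h2] with z hz1 hz2
  exact h z.1 z.2 hz1 hz2

lemma IsAdmissible.exists_abs_integral_cos_symbolDefect_le (hA : IsAdmissible A What) :
    ∃ K, 0 ≤ K ∧ ∀ x : Plane, x ≠ 0 →
      |∫ k, Real.cos (inner ℝ k x) * symbolDefect A What k| ≤ K / ‖x‖ := by
  have hmain : ∀ i : Fin 2, ∃ K, 0 ≤ K ∧ ∀ x : Plane, x i ≠ 0 →
      |∫ k, Real.cos (inner ℝ k x) * symbolDefect A What k| ≤ K / |x i| := fun i => by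
    obtain ⟨c, M, hc, hM, h1, h2⟩ := hA.exists_symbolDefect_bounds i
    have hI : 0 ≤ ∫ s, majorant c s := integral_nonneg (majorant_nonneg c)
    refine ⟨3 * (4 * M + M * ∫ s, majorant c s) * (∫ s, majorant c s), by positivity,
      fun x hx => ?_⟩
    have h := abs_integral_cos_mul_prod_le (G := fun z => symbolDefect A What (planePoint i z.1 z.2))
      Real.pi_pos hM (hA.measurable_symbolDefect.comp (measurable_planePoint i))
      (integrable_majorant hc) (majorant_nonneg c) (fun s hs => majorant_le_two hc hs) h1 h2
      (x i) hx (fun b => x (i + 1) * b) (by fun_prop)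
    rw [← integral_planePoint i]
    simp_rw [inner_planePoint]
    exact h
  obtain ⟨K₀, hK₀, h0⟩ := hmain 0
  obtain ⟨K₁, hK₁, h1⟩ := hmain 1
  refine ⟨2 * (K₀ + K₁), by positivity, fun x hx => ?_⟩
  have hx' : 0 < ‖x‖ := norm_pos_iff.2 hx
  have hn : ‖x‖ ≤ |x 0| + |x 1| := by
    refine abs_le_of_sq_le_sq' ?_ (by positivity) |>.2
    rw [EuclideanSpace.norm_sq_eq, Fin.sum_univ_two, Real.norm_eq_abs, Real.norm_eq_abs]
    nlinarith [abs_nonneg (x 0), abs_nonneg (x 1)]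
  have hfin : ∀ (K : ℝ) (y : ℝ), 0 ≤ K → K ≤ K₀ + K₁ → ‖x‖ ≤ 2 * |y| →
      K / |y| ≤ 2 * (K₀ + K₁) / ‖x‖ := fun K y hK hK' hy => by
    have : 0 < |y| := by linarith
    rw [div_le_div_iff₀ this hx']
    nlinarith
  rcases le_total |x 0| |x 1| with h | h
  · have hy : ‖x‖ ≤ 2 * |x 1| := by linarith
    exact (h1 x (abs_pos.1 (by linarith))).trans (hfin K₁ _ hK₁ (by linarith) hy)
  · have hy : ‖x‖ ≤ 2 * |x 0| := by linarith
    exact (h0 x (abs_pos.1 (by linarith))).trans (hfin K₀ _ hK₀ (by linarith) hy)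

end

/-! ### The lattice potential -/

section
variable {A : ℤ × ℤ → ℤ × ℤ → ℝ} {What V : Matrix (Fin 2) (Fin 2) ℝ} {v w : ℝ}

/-- `(1 - cos ⟨k, p⟩) / (-R̂(k))`. -/
noncomputable def potentialIntegrand (A : ℤ × ℤ → ℤ × ℤ → ℝ) (p : ℤ × ℤ) (k : Plane) : ℝ :=
  (1 - Real.cos (inner ℝ k (latticePoint p))) / (-Rhat A k)

/-- The integral of `(1 - cos ⟨k, p⟩) / (-R̂(k))` over the Brillouin zone. -/
noncomputable def latticePotential (A : ℤ × ℤ → ℤ × ℤ → ℝ) (p : ℤ × ℤ) : ℝ :=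
  ∫ k in brillouin, potentialIntegrand A p k

lemma latticePotential_zero : latticePotential A 0 = 0 := by
  have : latticePoint (0 : ℤ × ℤ) = 0 := latticePoint_zero
  simp [latticePotential, potentialIntegrand, this]

lemma re_covSummand (y₁ y₂ y₃ y₄ : ℤ × ℤ) (k : Plane) :
    (covSummand A y₁ y₂ y₃ y₄ k).re = potentialIntegrand A (y₁ - y₃) k +
      potentialIntegrand A (y₂ - y₄) k - potentialIntegrand A (y₁ - y₄) k -
      potentialIntegrand A (y₃ - y₂) k := by
  have h : (wave k y₁ - wave k y₂) * (wave (-k) y₃ - wave (-k) y₄) =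
      wave k (y₁ - y₃) - wave k (y₁ - y₄) - wave k (y₂ - y₃) + wave k (y₂ - y₄) := by
    simp only [← wave_mul_wave_neg]; ring
  have h23 : Real.cos (inner ℝ k (latticePoint (y₂ - y₃))) =
      Real.cos (inner ℝ k (latticePoint (y₃ - y₂))) := by
    rw [← neg_sub y₃ y₂, latticePoint_neg, inner_neg_right, Real.cos_neg]
  rw [covSummand, h, Complex.div_ofReal_re, Complex.add_re, Complex.sub_re, Complex.sub_re,
    re_wave, re_wave, re_wave, re_wave, h23]
  simp only [potentialIntegrand, div_neg]
  ring

lemma IsAdmissible.integrableOn_potentialIntegrand (hA : IsAdmissible A What) (p : ℤ × ℤ) :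
    IntegrableOn (potentialIntegrand A p) brillouin := by
  have h := ((hA.integrableOn_covSummand p 0 p 0).re).const_mul (-(1 / 2 : ℝ))
  refine h.congr (ae_of_all _ fun k => ?_)
  have h2 := re_covSummand (A := A) p 0 p 0 k
  have h0 : potentialIntegrand A 0 k = 0 := by
    have : latticePoint (0 : ℤ × ℤ) = 0 := latticePoint_zero
    simp [potentialIntegrand, this]
  simp only [sub_self, sub_zero, h0] at h2
  simp only [RCLike.re_eq_complex_re, h2]
  ring

lemma IsAdmissible.limitCov_eq (hA : IsAdmissible A What) (v : ℝ) (y₁ y₂ y₃ y₄ : ℤ × ℤ) :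
    limitCov A v y₁ y₂ y₃ y₄ = ((v / (2 * Real.pi) ^ 2 * (latticePotential A (y₁ - y₄) +
      latticePotential A (y₃ - y₂) - latticePotential A (y₁ - y₃) -
      latticePotential A (y₂ - y₄)) : ℝ) : ℂ) := by
  have him : (limitCov A v y₁ y₂ y₃ y₄).im = 0 := by
    have ht := hA.tendsto_torusCov v y₁ y₂ y₃ y₄ (m := fun n => n + 2) (m₂ := fun _ => 1)
      (tendsto_add_atTop_nat 2) (fun n => ⟨one_pos, by omega⟩)
    have ht2 := (Complex.continuous_im.tendsto _).comp ht
    refine tendsto_nhds_unique (ht2.congr fun n => ?_) tendsto_const_nhds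
    rw [Function.comp_apply, ← ofReal_re_torusCov, Complex.ofReal_im]
  have hI := hA.integrableOn_covSummand y₁ y₂ y₃ y₄
  have hp := hA.integrableOn_potentialIntegrand
  have hre : (∫ k in brillouin, covSummand A y₁ y₂ y₃ y₄ k).re =
      latticePotential A (y₁ - y₃) + latticePotential A (y₂ - y₄) -
        latticePotential A (y₁ - y₄) - latticePotential A (y₃ - y₂) := by
    rw [← RCLike.re_eq_complex_re, ← integral_re hI]
    simp only [RCLike.re_eq_complex_re, re_covSummand]
    have i1 : IntegrableOn (fun k => potentialIntegrand A (y₁ - y₃) k +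
      potentialIntegrand A (y₂ - y₄) k) brillouin := (hp _).add (hp _)
    have i2 : IntegrableOn (fun k => potentialIntegrand A (y₁ - y₃) k +
      potentialIntegrand A (y₂ - y₄) k - potentialIntegrand A (y₁ - y₄) k) brillouin :=
      i1.sub (hp _)
    rw [integral_sub i2 (hp _), integral_sub i1 (hp _), integral_add (hp _) (hp _)]
    rfl
  have hc : -((v : ℂ) / (2 * (Real.pi : ℂ)) ^ 2) = ((-(v / (2 * Real.pi) ^ 2) : ℝ) : ℂ) := by
    push_cast; ring
  refine Complex.ext ?_ ?_
  · rw [limitCov, hc, Complex.re_ofReal_mul, hre, Complex.ofReal_re]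
    ring
  · rw [him, Complex.ofReal_im]

lemma exists_normV_lower_bound (hw : 0 < w) (hw2 : w ^ 2 = What.det) (hV : V * What * Vᵀ = -1) :
    ∃ c, 0 < c ∧ ∀ x : Plane, c * ‖x‖ ≤ normV V x := by
  have hdet : IsUnit V.det := by
    have := abs_det_mul hw hw2 hV
    rw [isUnit_iff_ne_zero]
    intro h; rw [h] at this; simp at this
  set T := (planeMap V⁻¹).toContinuousLinearMap
  refine ⟨(‖T‖ + 1)⁻¹, by positivity, fun x => ?_⟩
  rw [inv_mul_le_iff₀ (by positivity), normV_eq]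
  have h : T (planeMap V x) = x := by
    simp only [T, LinearMap.coe_toContinuousLinearMap', planeMap_apply, Matrix.mulVec_mulVec,
      Matrix.nonsing_inv_mul _ hdet, Matrix.one_mulVec]
  have h2 := T.le_opNorm (planeMap V x)
  rw [h] at h2
  nlinarith [norm_nonneg (planeMap V x)]

lemma normV_zero : normV V 0 = 0 := by rw [normV_eq, map_zero, norm_zero]

lemma normV_nonneg (x : Plane) : 0 ≤ normV V x := norm_nonneg _

lemma one_le_norm_latticePoint {p : ℤ × ℤ} (hp : p ≠ 0) : 1 ≤ ‖latticePoint p‖ := by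
  have h : (1 : ℝ) ≤ ‖latticePoint p‖ ^ 2 := by
    rw [EuclideanSpace.norm_sq_eq, Fin.sum_univ_two]
    simp only [latticePoint, Real.norm_eq_abs, sq_abs]
    simp only [Matrix.cons_val_zero, Matrix.cons_val_one]
    have : 1 ≤ p.1 ^ 2 + p.2 ^ 2 := by
      by_contra hcon
      have h1 : p.1 ^ 2 = 0 := by nlinarith [sq_nonneg p.1, sq_nonneg p.2]
      have h2 : p.2 ^ 2 = 0 := by nlinarith [sq_nonneg p.1, sq_nonneg p.2]
      exact hp (Prod.ext (by simpa using h1) (by simpa using h2))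
    exact_mod_cast this
  nlinarith [norm_nonneg (latticePoint p)]

lemma latticePoint_ne_zero {p : ℤ × ℤ} (hp : p ≠ 0) : latticePoint p ≠ 0 := by
  intro h
  have := one_le_norm_latticePoint hp
  rw [h, norm_zero] at this
  linarith

/-- The logarithmic asymptotics of the lattice potential. -/
lemma IsAdmissible.exists_abs_latticePotential_sub_le (hA : IsAdmissible A What) (hw : 0 < w)
    (hw2 : w ^ 2 = What.det) (hV : V * What * Vᵀ = -1) :
    ∃ c K : ℝ, 0 ≤ K ∧ ∀ p : ℤ × ℤ, p ≠ 0 →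
      |latticePotential A p - 2 * Real.pi / w * Real.log (normV V (latticePoint p)) - c| ≤
        K / ‖latticePoint p‖ := by
  obtain ⟨hGi, c, hc⟩ := exists_abs_integral_quadForm_sub_le hw hw2 hV
  obtain ⟨K, hK, hK'⟩ := hA.exists_abs_integral_cos_symbolDefect_le
  obtain ⟨d, hd, hd'⟩ := exists_normV_lower_bound hw hw2 hV
  refine ⟨c + ∫ k, symbolDefect A What k, 4 * Real.pi / w / d ^ 2 + K, by positivity,
    fun p hp => ?_⟩
  set x := latticePoint p
  have hx1 : 1 ≤ ‖x‖ := one_le_norm_latticePoint hp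
  have hx0 : x ≠ 0 := latticePoint_ne_zero hp
  have hVx : 0 < normV V x := (by positivity : 0 < d * ‖x‖).trans_le (hd' x)
  have hH := hA.integrable_symbolDefect
  have hHc : Integrable fun k => Real.cos (inner ℝ k x) * symbolDefect A What k :=
    hH.bdd_mul (c := 1) (by fun_prop : Measurable fun k : Plane =>
      Real.cos (inner ℝ k x)).aestronglyMeasurable (ae_of_all _ fun _ => Real.abs_cos_le_one _)
  have e : latticePotential A p = (∫ k, (1 - Real.cos (inner ℝ k x)) *
      (Real.exp (-quadForm What k) / quadForm What k)) + ((∫ k, symbolDefect A What k) -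
      ∫ k, Real.cos (inner ℝ k x) * symbolDefect A What k) := by
    have hsub : Integrable fun k => symbolDefect A What k -
      Real.cos (inner ℝ k x) * symbolDefect A What k := hH.sub hHc
    rw [latticePotential, ← integral_indicator measurableSet_brillouin, ← integral_sub hH hHc,
      ← integral_add (hGi x) hsub]
    refine integral_congr_ae (ae_of_all _ fun k => ?_)
    have e1 : Real.exp (-quadForm What k) / quadForm What k = (regSymbol What k)⁻¹ := by
      rw [regSymbol, mul_inv, Real.exp_neg]; ring
    simp only [e1, symbolDefect]
    by_cases hk : k ∈ brillouin
    · simp only [Set.indicator_of_mem hk, potentialIntegrand]; ring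
    · simp only [Set.indicator_of_notMem hk]; ring
  have h1 := hc x hVx.ne'
  have h2 := hK' x hx0
  have h3 : 4 * Real.pi / w / normV V x ^ 2 ≤ 4 * Real.pi / w / d ^ 2 / ‖x‖ := by
    rw [div_div _ (d ^ 2)]
    refine div_le_div_of_nonneg_left (by positivity) (by positivity) ?_
    calc d ^ 2 * ‖x‖ ≤ d ^ 2 * ‖x‖ ^ 2 := by gcongr; nlinarith
      _ = (d * ‖x‖) ^ 2 := by ring
      _ ≤ _ := by gcongr; exact hd' x
  rw [e, add_div]
  set G := ∫ k, (1 - Real.cos (inner ℝ k x)) * (Real.exp (-quadForm What k) / quadForm What k)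
  set H := ∫ k, symbolDefect A What k
  set N := ∫ k, Real.cos (inner ℝ k x) * symbolDefect A What k
  have e2 : G + (H - N) - 2 * Real.pi / w * Real.log (normV V x) - (c + H) =
      (G - 2 * Real.pi / w * Real.log (normV V x) - c) + -N := by ring
  rw [e2]
  refine (abs_add_le _ _).trans (add_le_add (h1.trans h3) ?_)
  rwa [abs_neg]

/-- The covariance kernel: the lattice potential with its prefactor. -/
noncomputable def covKernel (A : ℤ × ℤ → ℤ × ℤ → ℝ) (v : ℝ) (p : ℤ × ℤ) : ℝ :=
  v / (2 * Real.pi) ^ 2 * latticePotential A p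

lemma one_div_le_two_div_one_add {r : ℝ} (hr : 1 ≤ r) : 1 / r ≤ 2 / (1 + r) := by
  rw [div_le_div_iff₀ (by linarith) (by linarith)]; linarith

lemma IsAdmissible.exists_abs_covKernel_sub_le (hA : IsAdmissible A What) (hv : 0 < v) (hw : 0 < w)
    (hw2 : w ^ 2 = What.det) (hV : V * What * Vᵀ = -1) :
    ∃ c K : ℝ, 0 ≤ K ∧ ∀ p : ℤ × ℤ,
      |covKernel A v p - v / (2 * Real.pi * w) * Real.log (1 + normV V (latticePoint p)) - c| ≤
        K / (1 + ‖latticePoint p‖) := by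
  obtain ⟨c, K, hK, h⟩ := hA.exists_abs_latticePotential_sub_le hw hw2 hV
  obtain ⟨d, hd, hd'⟩ := exists_normV_lower_bound hw hw2 hV
  have hpi := Real.pi_pos
  set s := v / (2 * Real.pi) ^ 2 with hs
  set u := v / (2 * Real.pi * w) with hu
  have hs0 : 0 < s := by positivity
  have hu0 : 0 < u := by positivity
  refine ⟨s * c, |s * c| + 2 * (s * K + u / d), by positivity, fun p => ?_⟩
  by_cases hp : p = 0
  · have h0 : latticePoint p = 0 := by rw [hp]; exact latticePoint_zero
    rw [h0, normV_zero, norm_zero, hp, covKernel, latticePotential_zero]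
    simp only [add_zero, Real.log_one, mul_zero, sub_zero, zero_sub, abs_neg, div_one]
    linarith [(by positivity : 0 ≤ 2 * (s * K + u / d))]
  set x := latticePoint p
  have hx1 : 1 ≤ ‖x‖ := one_le_norm_latticePoint hp
  have hVx : 0 < normV V x := (by positivity : 0 < d * ‖x‖).trans_le (hd' x)
  have h1 := mul_le_mul_of_nonneg_left (h p hp) hs0.le
  have h2 : |Real.log (1 + normV V x) - Real.log (normV V x)| ≤ 1 / (d * ‖x‖) := by
    rw [← Real.log_div (by positivity) hVx.ne', add_div, div_self hVx.ne',
      abs_of_nonneg (Real.log_nonneg (by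
        have : 0 < 1 / normV V x := by positivity
        linarith))]
    have := Real.log_le_sub_one_of_pos (x := 1 / normV V x + 1) (by positivity)
    refine this.trans ?_
    rw [add_sub_cancel_right]
    exact div_le_div_of_nonneg_left zero_le_one (by positivity) (hd' x)
  have e : covKernel A v p - u * Real.log (1 + normV V x) - s * c =
      s * (latticePotential A p - 2 * Real.pi / w * Real.log (normV V x) - c) -
        u * (Real.log (1 + normV V x) - Real.log (normV V x)) := by
    have : s * (2 * Real.pi / w) = u := by rw [hs, hu]; field_simp
    rw [covKernel, ← this]; ring
  rw [e]
  refine (abs_sub _ _).trans ?_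
  rw [abs_mul, abs_mul, abs_of_pos hs0, abs_of_pos hu0]
  have h3 := one_div_le_two_div_one_add hx1
  calc s * |latticePotential A p - 2 * Real.pi / w * Real.log (normV V x) - c| +
        u * |Real.log (1 + normV V x) - Real.log (normV V x)|
      ≤ s * (K / ‖x‖) + u * (1 / (d * ‖x‖)) := by gcongr
    _ = (s * K + u / d) * (1 / ‖x‖) := by field_simp
    _ ≤ (s * K + u / d) * (2 / (1 + ‖x‖)) := by gcongr
    _ = 2 * (s * K + u / d) / (1 + ‖x‖) := by ring
    _ ≤ _ := by
      gcongr
      linarith [abs_nonneg (s * c)]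

lemma latNormV_eq (y z : ℤ × ℤ) : latNormV V y z = normV V (latticePoint (y - z)) := by
  rw [latNormV, latticePoint_sub]

lemma latDist_eq (y z : ℤ × ℤ) : latDist y z = ‖latticePoint (y - z)‖ := by
  rw [latDist, latticePoint_sub]

lemma abs_log_mul_sub_log_le {a b m d : ℝ} (ha : 0 ≤ a) (hb : 0 ≤ b) (hd : 0 < d) (hm : 0 ≤ m)
    (h : (a = 0 ∧ b = 0) ∨ (d * (1 + m) ≤ a ∧ d * (1 + m) ≤ b)) :
    |Real.log ((1 + a) * (1 + b)) - Real.log (1 + a * b)| ≤ 2 / d / (1 + m) := by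
  rcases h with ⟨rfl, rfl⟩ | ⟨h1, h2⟩
  · simp; positivity
  have h0 : 0 < d * (1 + m) := by positivity
  have ha0 := h0.trans_le h1
  have hb0 := h0.trans_le h2
  have hab : 0 < 1 + a * b := by positivity
  have e : (1 + a) * (1 + b) / (1 + a * b) = (a + b) / (1 + a * b) + 1 := by field_simp; ring
  have hpos : 0 < (a + b) / (1 + a * b) := by positivity
  rw [← Real.log_div (by positivity) hab.ne', e, abs_of_nonneg (Real.log_nonneg (by linarith))]
  refine (Real.log_le_sub_one_of_pos (by positivity)).trans ?_
  rw [add_sub_cancel_right]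
  calc (a + b) / (1 + a * b) ≤ (a + b) / (a * b) := by gcongr; linarith
    _ = 1 / a + 1 / b := by field_simp; ring
    _ ≤ 1 / (d * (1 + m)) + 1 / (d * (1 + m)) := by gcongr
    _ = _ := by field_simp; ring

/-- The asymptotics of the infinite volume covariances. -/
theorem IsAdmissible.exists_limitCov_bounds (hA : IsAdmissible A What) (hv : 0 < v) (hw : 0 < w)
    (hw2 : w ^ 2 = What.det) (hV : V * What * Vᵀ = -1) :
    ∃ K : ℝ, ∀ y₁ y₂ y₃ y₄ : ℤ × ℤ,
      ((y₁ = y₃ ↔ y₂ = y₄) → (y₁ = y₄ ↔ y₂ = y₃) →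
        ‖limitCov A v y₁ y₂ y₃ y₄ - ((v / (2 * Real.pi * w) *
            Real.log ((1 + latNormV V y₁ y₄ * latNormV V y₃ y₂) /
              (1 + latNormV V y₁ y₃ * latNormV V y₂ y₄)) : ℝ) : ℂ)‖
          ≤ K / (1 + minDist y₁ y₂ y₃ y₄)) ∧
      ‖limitCov A v y₁ y₂ y₃ y₄ - ((v / (2 * Real.pi * w) *
          Real.log (((1 + latNormV V y₁ y₄) * (1 + latNormV V y₃ y₂)) /
            ((1 + latNormV V y₁ y₃) * (1 + latNormV V y₂ y₄))) : ℝ) : ℂ)‖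
        ≤ K / (1 + minDist y₁ y₂ y₃ y₄) := by
  obtain ⟨c, K, hK, h⟩ := hA.exists_abs_covKernel_sub_le hv hw hw2 hV
  obtain ⟨d, hd, hd'⟩ := exists_normV_lower_bound hw hw2 hV
  have hpi := Real.pi_pos
  set u := v / (2 * Real.pi * w) with hu
  have hu0 : 0 < u := by positivity
  refine ⟨4 * K + 8 * (u / d), fun y₁ y₂ y₃ y₄ => ?_⟩
  set m := minDist y₁ y₂ y₃ y₄ with hm
  have hm0 : 0 ≤ m := le_min (le_min (norm_nonneg _) (norm_nonneg _))
    (le_min (norm_nonneg _) (norm_nonneg _))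
  have m13 : m ≤ ‖latticePoint (y₁ - y₃)‖ := by
    rw [← latDist_eq]; exact (min_le_left _ _).trans (min_le_left _ _)
  have m24 : m ≤ ‖latticePoint (y₂ - y₄)‖ := by
    rw [← latDist_eq]; exact (min_le_left _ _).trans (min_le_right _ _)
  have m14 : m ≤ ‖latticePoint (y₁ - y₄)‖ := by
    rw [← latDist_eq]; exact (min_le_right _ _).trans (min_le_left _ _)
  have m32 : m ≤ ‖latticePoint (y₃ - y₂)‖ := by
    rw [← neg_sub, latticePoint_neg, norm_neg, ← latDist_eq]
    exact (min_le_right _ _).trans (min_le_right _ _)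
  have hE : ∀ p : ℤ × ℤ, m ≤ ‖latticePoint p‖ → |covKernel A v p -
      u * Real.log (1 + normV V (latticePoint p)) - c| ≤ K / (1 + m) := fun p hp =>
    (h p).trans (by gcongr)
  have hlim : limitCov A v y₁ y₂ y₃ y₄ = ((covKernel A v (y₁ - y₄) + covKernel A v (y₃ - y₂) -
      covKernel A v (y₁ - y₃) - covKernel A v (y₂ - y₄) : ℝ) : ℂ) := by
    rw [hA.limitCov_eq]
    congr 1
    simp only [covKernel]; ring
  simp only [latNormV_eq]
  have hn : ∀ p : ℤ × ℤ, 0 ≤ normV V (latticePoint p) := fun p => normV_nonneg _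
  have b14 := hE _ m14
  have b32 := hE _ m32
  have b13 := hE _ m13
  have b24 := hE _ m24
  have n14 := hn (y₁ - y₄)
  have n32 := hn (y₃ - y₂)
  have n13 := hn (y₁ - y₃)
  have n24 := hn (y₂ - y₄)
  have hnz : ∀ p : ℤ × ℤ, p ≠ 0 → m ≤ ‖latticePoint p‖ →
      d / 2 * (1 + m) ≤ normV V (latticePoint p) := fun p hp hmp => by
    have h1 := one_le_norm_latticePoint hp
    have h2 := hd' (latticePoint p)
    nlinarith
  have hz : normV V (latticePoint (0 : ℤ × ℤ)) = 0 := by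
    rw [show latticePoint (0 : ℤ × ℤ) = 0 from latticePoint_zero, normV_zero]
  rw [hlim, ← Complex.ofReal_sub, ← Complex.ofReal_sub, Complex.norm_real, Complex.norm_real,
    Real.norm_eq_abs, Real.norm_eq_abs]
  have hdich : ∀ p q : ℤ × ℤ, (p = 0 ↔ q = 0) → m ≤ ‖latticePoint p‖ → m ≤ ‖latticePoint q‖ →
      |Real.log ((1 + normV V (latticePoint p)) * (1 + normV V (latticePoint q))) -
        Real.log (1 + normV V (latticePoint p) * normV V (latticePoint q))| ≤
        2 / (d / 2) / (1 + m) := fun p q hpq hp hq => by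
    refine abs_log_mul_sub_log_le (hn p) (hn q) (by positivity) hm0 ?_
    by_cases h0 : p = 0
    · left
      rw [h0, hpq.1 h0]
      exact ⟨hz, hz⟩
    · right
      exact ⟨hnz p h0 hp, hnz q (fun h => h0 (hpq.2 h)) hq⟩
  have main : |covKernel A v (y₁ - y₄) + covKernel A v (y₃ - y₂) -
      covKernel A v (y₁ - y₃) - covKernel A v (y₂ - y₄) - u *
        Real.log (((1 + normV V (latticePoint (y₁ - y₄))) * (1 + normV V (latticePoint (y₃ - y₂)))) /
          ((1 + normV V (latticePoint (y₁ - y₃))) * (1 + normV V (latticePoint (y₂ - y₄)))))| ≤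
      4 * K / (1 + m) := by
    rw [Real.log_div (by positivity) (by positivity), Real.log_mul (by positivity) (by positivity),
      Real.log_mul (by positivity) (by positivity)]
    have e : 4 * K / (1 + m) = 4 * (K / (1 + m)) := by ring
    rw [e]
    rw [abs_le] at b14 b32 b13 b24 ⊢
    constructor <;> linarith [b14.1, b14.2, b32.1, b32.2, b13.1, b13.2, b24.1, b24.2]
  have hsum : (4 * K + 8 * (u / d)) / (1 + m) = 4 * K / (1 + m) + 8 * (u / d) / (1 + m) := add_div _ _ _
  have hud : 0 ≤ 8 * (u / d) / (1 + m) := by positivity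
  refine ⟨fun h1 h2 => ?_, main.trans (by rw [hsum]; linarith)⟩
  have c1 := hdich (y₁ - y₄) (y₃ - y₂) (by
    rw [sub_eq_zero, sub_eq_zero, h2, eq_comm]) m14 m32
  have c2 := hdich (y₁ - y₃) (y₂ - y₄) (by rw [sub_eq_zero, sub_eq_zero, h1]) m13 m24
  rw [Real.log_div (by positivity) (by positivity)] at main ⊢
  have e : 8 * (u / d) / (1 + m) = u * (2 / (d / 2) / (1 + m)) + u * (2 / (d / 2) / (1 + m)) := by
    field_simp; ring
  rw [hsum, e]
  have c1' := mul_le_mul_of_nonneg_left c1 hu0.le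
  have c2' := mul_le_mul_of_nonneg_left c2 hu0.le
  rw [← abs_of_pos hu0, ← abs_mul, abs_of_pos hu0] at c1' c2'
  rw [abs_le] at c1' c2' main ⊢
  constructor <;> linarith [c1'.1, c1'.2, c2'.1, c2'.2, main.1, main.2]

end

/-! ### Integrability of the logarithmic kernel -/

lemma integrableOn_log_norm (R : ℝ) :
    IntegrableOn (fun z : Plane => 1 + |Real.log ‖z‖|) (Metric.ball 0 R) := by
  rw [integrableOn_fun_norm_addHaar (volume : Measure Plane) (f := fun r => 1 + |Real.log r|)]
  rw [finrank_euclideanSpace_fin]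
  have hcont : Continuous fun y : ℝ => y + |Real.log y * y| := by
    have := Real.continuous_mul_log
    simp_rw [mul_comm (Real.log _)]
    fun_prop
  have h : IntegrableOn (fun y : ℝ => y + |Real.log y * y|) (Set.Ioo 0 R) :=
    (hcont.integrableOn_Icc (a := 0) (b := R)).mono_set Set.Ioo_subset_Icc_self
  refine h.congr_fun (fun y hy => ?_) measurableSet_Ioo
  simp only [Nat.add_one_sub_one, pow_one, smul_eq_mul, abs_mul, abs_of_pos hy.1]
  ring

/-- `1 + |log |x - y||` on a bounded set. -/
noncomputable def logMajorant (R : ℝ) (z : Plane × Plane) : ℝ :=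
  (Metric.closedBall (0 : Plane) R).indicator 1 z.2 *
    (Metric.ball (0 : Plane) (2 * R + 1)).indicator (fun z => 1 + |Real.log ‖z‖|) (z.1 - z.2)

lemma integrable_logMajorant (R : ℝ) : Integrable (logMajorant R) := by
  have h1 : Integrable ((Metric.closedBall (0 : Plane) R).indicator (1 : Plane → ℝ)) :=
    (integrable_indicator_iff Metric.isClosed_closedBall.measurableSet).2
      (integrableOn_const (C := (1 : ℝ)) (isCompact_closedBall _ _).measure_lt_top.ne)
  have h2 : Integrable ((Metric.ball (0 : Plane) (2 * R + 1)).indicator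
      fun z => 1 + |Real.log ‖z‖|) :=
    (integrable_indicator_iff Metric.isOpen_ball.measurableSet).2 (integrableOn_log_norm _)
  exact h1.convolution_integrand (ContinuousLinearMap.mul ℝ ℝ) h2

lemma logMajorant_nonneg (R : ℝ) (z : Plane × Plane) : 0 ≤ logMajorant R z :=
  mul_nonneg (Set.indicator_nonneg (fun _ _ => zero_le_one) _)
    (Set.indicator_nonneg (fun _ _ => by positivity) _)

lemma logMajorant_eq {R : ℝ} {z : Plane × Plane} (h1 : ‖z.1‖ ≤ R) (h2 : ‖z.2‖ ≤ R) :
    logMajorant R z = 1 + |Real.log ‖z.1 - z.2‖| := by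
  have h3 : ‖z.1 - z.2‖ < 2 * R + 1 := by
    have := norm_sub_le z.1 z.2
    linarith
  rw [logMajorant, Set.indicator_of_mem (by simpa using h2), Set.indicator_of_mem (by simpa using h3)]
  simp

lemma ae_fst_ne_snd : ∀ᵐ z : Plane × Plane, z.1 ≠ z.2 := by
  have hs : MeasurableSet {z : Plane × Plane | z.1 = z.2} :=
    measurableSet_eq_fun measurable_fst measurable_snd
  rw [ae_iff]
  simp only [ne_eq, not_not]
  rw [Measure.volume_eq_prod, Measure.measure_prod_null hs]
  refine ae_of_all _ fun x => ?_
  have : (Prod.mk x ⁻¹' {z : Plane × Plane | z.1 = z.2}) = {x} := by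
    ext y; simp [eq_comm]
  simp only [this, Pi.zero_apply]
  exact measure_singleton x

lemma abs_log_le_of_mem_Icc {a b c : ℝ} (ha : 0 < a) (hab : a ≤ b) (hbc : b ≤ c) (hc : 1 ≤ c) :
    |Real.log b| ≤ |Real.log a| + Real.log c := by
  have h1 := Real.log_le_log ha hab
  have h2 := Real.log_le_log (ha.trans_le hab) hbc
  have h3 := Real.log_nonneg hc
  rw [abs_le]
  constructor
  · linarith [neg_abs_le (Real.log a)]
  · linarith [abs_nonneg (Real.log a)]

section
variable {V : Matrix (Fin 2) (Fin 2) ℝ} {φ : Plane → ℝ}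

lemma continuous_normV : Continuous (normV V) :=
  ((planeMap V).toContinuousLinearMap.continuous).norm

lemma normV_smul {t : ℝ} (ht : 0 ≤ t) (x : Plane) : normV V (t • x) = t * normV V x := by
  rw [normV_eq, map_smul, norm_smul, Real.norm_of_nonneg ht, normV_eq]

lemma exists_normV_upper_bound (V : Matrix (Fin 2) (Fin 2) ℝ) :
    ∃ D, 0 ≤ D ∧ ∀ x : Plane, normV V x ≤ D * ‖x‖ :=
  ⟨‖(planeMap V).toContinuousLinearMap‖, norm_nonneg _, fun x =>
    (planeMap V).toContinuousLinearMap.le_opNorm x⟩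

lemma exists_norm_le_of_ne_zero (hφc : HasCompactSupport φ) :
    ∃ R, 0 ≤ R ∧ ∀ x, φ x ≠ 0 → ‖x‖ ≤ R := by
  obtain ⟨R, hR⟩ := hφc.isCompact.isBounded.exists_norm_le
  exact ⟨max R 0, le_max_right _ _, fun x hx =>
    (hR x (subset_tsupport _ hx)).trans (le_max_left _ _)⟩

lemma integrable_logEnergy {d : ℝ} (hd : 0 < d) (hd' : ∀ x : Plane, d * ‖x‖ ≤ normV V x)
    (hφ : Continuous φ) (hφc : HasCompactSupport φ) : Integrable (logEnergy V φ) := by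
  obtain ⟨R, hR0, hR⟩ := exists_norm_le_of_ne_zero hφc
  obtain ⟨D, hD0, hD⟩ := exists_normV_upper_bound V
  obtain ⟨B, hB⟩ := hφc.exists_bound_of_continuous hφ
  have hB0 : 0 ≤ B := (norm_nonneg _).trans (hB 0)
  set L := |Real.log d| + Real.log (1 + D * (2 * R)) with hL
  have hL0 : 0 ≤ L := add_nonneg (abs_nonneg _) (Real.log_nonneg (by
    have : 0 ≤ D * (2 * R) := by positivity
    linarith))
  refine Integrable.mono' ((integrable_logMajorant R).const_mul (B * B * (L + 1))) ?_ ?_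
  · have h1 : Measurable (normV V) := continuous_normV.measurable
    have h2 : Measurable φ := hφ.measurable
    exact (((h2.comp measurable_fst).mul (h2.comp measurable_snd)).mul
      (Real.measurable_log.comp (h1.comp (measurable_fst.sub measurable_snd)))).aestronglyMeasurable
  filter_upwards [ae_fst_ne_snd] with z hz
  have hpos : 0 ≤ B * B * (L + 1) * logMajorant R z := mul_nonneg (by positivity)
    (logMajorant_nonneg _ _)
  by_cases h1 : φ z.1 = 0
  · rw [logEnergy, h1]; simpa using hpos
  by_cases h2 : φ z.2 = 0
  · rw [logEnergy, h2]; simpa using hpos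
  have r1 := hR _ h1
  have r2 := hR _ h2
  rw [logMajorant_eq r1 r2]
  have hzn : 0 < ‖z.1 - z.2‖ := norm_pos_iff.2 (sub_ne_zero.2 hz)
  have hz2 : ‖z.1 - z.2‖ ≤ 2 * R := (norm_sub_le _ _).trans (by linarith)
  have h3 : |Real.log (normV V (z.1 - z.2))| ≤ (L + 1) * (1 + |Real.log ‖z.1 - z.2‖|) := by
    have h4 := abs_log_le_of_mem_Icc (a := d * ‖z.1 - z.2‖) (by positivity) (hd' _)
      (c := 1 + D * (2 * R)) ((hD _).trans (by nlinarith)) (by nlinarith)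
    rw [Real.log_mul hd.ne' hzn.ne'] at h4
    have h5 := abs_add_le (Real.log d) (Real.log ‖z.1 - z.2‖)
    nlinarith [abs_nonneg (Real.log ‖z.1 - z.2‖)]
  rw [logEnergy, norm_mul, norm_mul, mul_assoc (B * B)]
  exact mul_le_mul (mul_le_mul (hB _) (hB _) (norm_nonneg _) hB0) h3 (norm_nonneg _) (by positivity)

/-! ### Riemann sums -/

/-- The lattice point of the scaled lattice in the cell of `x`. -/
noncomputable def cellPoint (δ : ℝ) (x : Plane) : Plane := δ • latticePoint (cellIndex δ x)

lemma norm_cellPoint_sub_le {δ : ℝ} (hδ : 0 < δ) (x : Plane) : ‖cellPoint δ x - x‖ ≤ 2 * δ := by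
  have h : ∀ y : ℝ, |δ * ⌊y / δ⌋ - y| ≤ δ := fun y => by
    have := abs_mul_floor_sub_le hδ y (θ := 0) (by simp)
    rwa [zero_add] at this
  refine abs_le_of_sq_le_sq' ?_ (by positivity) |>.2
  rw [EuclideanSpace.norm_sq_eq, Fin.sum_univ_two]
  have e0 : (cellPoint δ x - x) 0 = δ * ⌊x 0 / δ⌋ - x 0 := by
    simp [cellPoint, cellIndex, latticePoint]
  have e1 : (cellPoint δ x - x) 1 = δ * ⌊x 1 / δ⌋ - x 1 := by
    simp [cellPoint, cellIndex, latticePoint]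
  rw [e0, e1, Real.norm_eq_abs, Real.norm_eq_abs]
  have h0 := h (x 0)
  have h1 := h (x 1)
  nlinarith [abs_nonneg (δ * ⌊x 0 / δ⌋ - x 0), abs_nonneg (δ * ⌊x 1 / δ⌋ - x 1)]

lemma tendsto_cellPoint (x : Plane) : Tendsto (fun δ => cellPoint δ x) (𝓝[>] 0) (𝓝 x) := by
  rw [tendsto_iff_norm_sub_tendsto_zero]
  have h : Tendsto (fun δ : ℝ => 2 * δ) (𝓝[>] 0) (𝓝 0) := by
    have : Tendsto (fun δ : ℝ => 2 * δ) (𝓝 0) (𝓝 (2 * 0)) :=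
      (continuous_const.mul continuous_id).tendsto 0
    rw [mul_zero] at this
    exact this.mono_left nhdsWithin_le_nhds
  refine squeeze_zero' (Eventually.of_forall fun _ => norm_nonneg _) ?_ h
  filter_upwards [self_mem_nhdsWithin] with δ hδ
  exact norm_cellPoint_sub_le hδ x

lemma measurable_cellPoint (δ : ℝ) : Measurable (cellPoint δ) :=
  (Measurable.of_discrete (f := fun p => δ • latticePoint p)).comp (measurable_cellIndex δ)

lemma finite_setOf_scaled_ne_zero (hφc : HasCompactSupport φ) {δ : ℝ} (hδ : 0 < δ) :
    {p : ℤ × ℤ | φ (δ • latticePoint p) ≠ 0}.Finite := by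
  obtain ⟨R, hR0, hR⟩ := exists_norm_le_of_ne_zero hφc
  refine (Set.finite_Icc ((-⌈R / δ⌉, -⌈R / δ⌉) : ℤ × ℤ) (⌈R / δ⌉, ⌈R / δ⌉)).subset fun p hp => ?_
  have h := hR _ hp
  rw [norm_smul, Real.norm_of_nonneg hδ.le] at h
  have hn : ‖latticePoint p‖ ≤ R / δ := by rw [le_div_iff₀ hδ]; linarith
  have hc := Int.le_ceil (R / δ)
  have key : ∀ i, |latticePoint p i| ≤ ⌈R / δ⌉ := fun i => by
    have := PiLp.norm_apply_le (latticePoint p) i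
    rw [Real.norm_eq_abs] at this
    linarith
  have h0 : |(p.1 : ℝ)| ≤ ⌈R / δ⌉ := by simpa [latticePoint] using key 0
  have h1 : |(p.2 : ℝ)| ≤ ⌈R / δ⌉ := by simpa [latticePoint] using key 1
  rw [abs_le] at h0 h1
  refine ⟨⟨?_, ?_⟩, ⟨?_, ?_⟩⟩
  · exact_mod_cast h0.1
  · exact_mod_cast h1.1
  · exact_mod_cast h0.2
  · exact_mod_cast h1.2

lemma exists_finset_scaled (hφc : HasCompactSupport φ) {δ : ℝ} (hδ : 0 < δ) :
    ∃ s : Finset (ℤ × ℤ), ∀ p ∉ s, φ (δ • latticePoint p) = 0 := by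
  refine ⟨(finite_setOf_scaled_ne_zero hφc hδ).toFinset, fun p hp => ?_⟩
  simpa using hp

/-- The Riemann sum of a function of mean zero is of the order of the mesh. -/
lemma exists_abs_riemannSum_le (hφ : ContDiff ℝ (⊤ : ℕ∞) φ) (hφc : HasCompactSupport φ)
    (h0 : ∫ x, φ x = 0) : ∃ C, 0 ≤ C ∧ ∀ δ : ℝ, 0 < δ → δ ≤ 1 → ∀ s : Finset (ℤ × ℤ),
      (∀ p ∉ s, φ (δ • latticePoint p) = 0) →
      |∑ p ∈ s, δ ^ 2 * φ (δ • latticePoint p)| ≤ C * δ ∧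
      ∑ p ∈ s, |δ ^ 2 * φ (δ • latticePoint p)| ≤ C := by
  obtain ⟨R, hR0, hR⟩ := exists_norm_le_of_ne_zero hφc
  obtain ⟨B, hB⟩ := hφc.exists_bound_of_continuous hφ.continuous
  have hB0 : 0 ≤ B := (norm_nonneg _).trans (hB 0)
  obtain ⟨L, hL⟩ := hφ.lipschitzWith_of_hasCompactSupport hφc (by simp)
  set D := Metric.closedBall (0 : Plane) (R + 2)
  have hDfin : volume D ≠ ⊤ := (isCompact_closedBall _ _).measure_lt_top.ne
  set m := (volume : Measure Plane).real D
  have hDm : MeasurableSet D := Metric.isClosed_closedBall.measurableSet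
  have hind : ∀ c : ℝ, Integrable (D.indicator fun _ => c) ∧ ∫ x, D.indicator (fun _ => c) x = c * m :=
    fun c => ⟨(integrable_indicator_iff hDm).2 (integrableOn_const hDfin), by
      rw [integral_indicator hDm, setIntegral_const, smul_eq_mul, mul_comm]⟩
  refine ⟨2 * L * m + B * m, by positivity, fun δ hδ hδ1 s hs => ?_⟩
  have hball : ∀ x, x ∉ D → φ x = 0 ∧ φ (cellPoint δ x) = 0 := fun x hx => by
    have hx' : R + 2 < ‖x‖ := by simpa [D] using hx
    constructor
    · by_contra h
      have := hR _ h
      linarith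
    · by_contra h
      have h1 := hR _ h
      have h2 := norm_cellPoint_sub_le hδ x
      have h3 := norm_sub_norm_le x (cellPoint δ x)
      rw [norm_sub_rev] at h3
      linarith
  have hφi : Integrable φ := hφ.continuous.integrable_of_hasCompactSupport hφc
  have hm : Measurable fun x => φ (cellPoint δ x) :=
    hφ.continuous.measurable.comp (measurable_cellPoint δ)
  have hci : Integrable fun x => φ (cellPoint δ x) := by
    refine Integrable.mono' (hind B).1 hm.aestronglyMeasurable (ae_of_all _ fun x => ?_)
    by_cases hx : x ∈ D
    · rw [Set.indicator_of_mem hx]; exact hB _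
    · rw [Set.indicator_of_notMem hx, (hball x hx).2, norm_zero]
  constructor
  · have e : ∑ p ∈ s, δ ^ 2 * φ (δ • latticePoint p) = ∫ x, (φ (cellPoint δ x) - φ x) := by
      rw [integral_sub hci hφi, h0, sub_zero, ← Finset.mul_sum, ← smul_eq_mul]
      exact (integral_cellIndex hδ s (fun p => φ (δ • latticePoint p)) hs).symm
    rw [e, ← Real.norm_eq_abs]
    refine (norm_integral_le_of_norm_le (hind (L * (2 * δ))).1 (ae_of_all _ fun x => ?_)).trans ?_
    · by_cases hx : x ∈ D
      · rw [Set.indicator_of_mem hx]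
        exact (hL.norm_sub_le _ _).trans
          (mul_le_mul_of_nonneg_left (norm_cellPoint_sub_le hδ x) L.coe_nonneg)
      · rw [Set.indicator_of_notMem hx, (hball x hx).1, (hball x hx).2]; simp
    · rw [(hind _).2]
      have : 0 ≤ B * m * δ := by positivity
      nlinarith
  · have e : ∑ p ∈ s, |δ ^ 2 * φ (δ • latticePoint p)| = ∫ x, |φ (cellPoint δ x)| := by
      simp_rw [abs_mul, abs_of_pos (by positivity : 0 < δ ^ 2)]
      rw [← Finset.mul_sum, ← smul_eq_mul]
      exact (integral_cellIndex hδ s (fun p => |φ (δ • latticePoint p)|)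
        (fun p hp => by simp [hs p hp])).symm
    rw [e]
    refine (integral_mono_of_nonneg (ae_of_all _ fun _ => abs_nonneg _) (hind B).1
      (ae_of_all _ fun x => ?_)).trans ?_
    · by_cases hx : x ∈ D
      · rw [Set.indicator_of_mem hx]; exact hB _
      · rw [Set.indicator_of_notMem hx]
        simp [(hball x hx).2]
    · rw [(hind _).2]
      have : 0 ≤ 2 * L * m := by positivity
      linarith

lemma sum_sum_eq_integral {δ : ℝ} (hδ : 0 < δ) (h : ℤ × ℤ → ℝ)
    (s : Finset (ℤ × ℤ)) (hs : ∀ p ∉ s, φ (δ • latticePoint p) = 0)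
    (hI : Integrable fun z : Plane × Plane => φ (cellPoint δ z.1) * φ (cellPoint δ z.2) *
      h (cellIndex δ z.1 - cellIndex δ z.2)) :
    ∑ p ∈ s, ∑ q ∈ s, δ ^ 2 * φ (δ • latticePoint p) * (δ ^ 2 * φ (δ • latticePoint q)) * h (p - q) =
      ∫ z : Plane × Plane, φ (cellPoint δ z.1) * φ (cellPoint δ z.2) *
        h (cellIndex δ z.1 - cellIndex δ z.2) := by
  rw [Measure.volume_eq_prod, integral_prod _ hI]
  have inner : ∀ x : Plane, ∫ y, φ (cellPoint δ x) * φ (cellPoint δ y) *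
      h (cellIndex δ x - cellIndex δ y) = (fun p => δ ^ 2 * ∑ q ∈ s, φ (δ • latticePoint p) *
        φ (δ • latticePoint q) * h (p - q)) (cellIndex δ x) := fun x =>
    integral_cellIndex hδ s (fun q => φ (cellPoint δ x) * φ (δ • latticePoint q) *
      h (cellIndex δ x - q)) (fun q hq => by simp [hs q hq])
  simp_rw [inner]
  rw [integral_cellIndex hδ s (fun p => δ ^ 2 * ∑ q ∈ s, φ (δ • latticePoint p) *
        φ (δ • latticePoint q) * h (p - q)) (fun p hp => by simp [hs p hp]), smul_eq_mul,
    Finset.mul_sum]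
  refine Finset.sum_congr rfl fun p _ => ?_
  rw [← mul_assoc, Finset.mul_sum]
  exact Finset.sum_congr rfl fun q _ => by ring

end

/-! ### The continuum limit of the variance -/

section
variable {V : Matrix (Fin 2) (Fin 2) ℝ} {φ : Plane → ℝ}

/-- The quadratic form of the covariances of `ξ_p - ξ_0`, for a covariance kernel `κ`. -/
noncomputable def pinnedVariance (φ : Plane → ℝ) (κ : ℤ × ℤ → ℝ) (δ : ℝ) (s : Finset (ℤ × ℤ)) : ℝ :=
  ∑ p ∈ s, ∑ q ∈ s, δ ^ 2 * φ (δ • latticePoint p) * (δ ^ 2 * φ (δ • latticePoint q)) *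
    (κ p + κ q - κ (p - q))

lemma pinnedVariance_shift (κ : ℤ × ℤ → ℝ) (C δ : ℝ) (s : Finset (ℤ × ℤ)) :
    pinnedVariance φ κ δ s =
      -(∑ p ∈ s, ∑ q ∈ s, δ ^ 2 * φ (δ • latticePoint p) * (δ ^ 2 * φ (δ • latticePoint q)) *
        (κ (p - q) - C)) +
      (2 * (∑ p ∈ s, δ ^ 2 * φ (δ • latticePoint p)) *
        (∑ p ∈ s, δ ^ 2 * φ (δ • latticePoint p) * (κ p - C)) +
      C * (∑ p ∈ s, δ ^ 2 * φ (δ • latticePoint p)) ^ 2) := by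
  set a : ℤ × ℤ → ℝ := fun p => δ ^ 2 * φ (δ • latticePoint p)
  set S := ∑ p ∈ s, a p
  set H := ∑ p ∈ s, a p * (κ p - C)
  have e1 : H * S = ∑ p ∈ s, ∑ q ∈ s, a p * a q * (κ p - C) := by
    rw [Finset.sum_mul_sum]
    exact Finset.sum_congr rfl fun p _ => Finset.sum_congr rfl fun q _ => by ring
  have e2 : S * H = ∑ p ∈ s, ∑ q ∈ s, a p * a q * (κ q - C) := by
    rw [Finset.sum_mul_sum]
    exact Finset.sum_congr rfl fun p _ => Finset.sum_congr rfl fun q _ => by ring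
  have e3 : C * (S * S) = ∑ p ∈ s, ∑ q ∈ s, a p * a q * C := by
    rw [Finset.sum_mul_sum, Finset.mul_sum]
    refine Finset.sum_congr rfl fun p _ => ?_
    rw [Finset.mul_sum]
    exact Finset.sum_congr rfl fun q _ => by ring
  have e4 : 2 * S * H + C * S ^ 2 = H * S + S * H + C * (S * S) := by ring
  rw [e4, e1, e2, e3, pinnedVariance]
  simp only [← Finset.sum_add_distrib, ← Finset.sum_neg_distrib]
  exact Finset.sum_congr rfl fun p _ => Finset.sum_congr rfl fun q _ => by ring

lemma log_add_normV_smul {δ : ℝ} (hδ : 0 < δ) (p : ℤ × ℤ) :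
    Real.log (δ + normV V (δ • latticePoint p)) =
      Real.log δ + Real.log (1 + normV V (latticePoint p)) := by
  have := normV_nonneg (V := V) (latticePoint p)
  rw [normV_smul hδ.le, ← Real.log_mul hδ.ne' (by positivity)]
  congr 1; ring

theorem tendsto_pinnedVariance {κ : ℤ × ℤ → ℝ} {u c K d : ℝ} (hu : 0 ≤ u) (hK : 0 ≤ K)
    (hd : 0 < d) (hd' : ∀ x : Plane, d * ‖x‖ ≤ normV V x)
    (hκ : ∀ p, |κ p - u * Real.log (1 + normV V (latticePoint p)) - c| ≤
      K / (1 + ‖latticePoint p‖))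
    (hφ : ContDiff ℝ (⊤ : ℕ∞) φ) (hφc : HasCompactSupport φ) (h0 : ∫ x, φ x = 0)
    (s : ℝ → Finset (ℤ × ℤ)) (hs : ∀ δ, 0 < δ → ∀ p ∉ s δ, φ (δ • latticePoint p) = 0) :
    Tendsto (fun δ => pinnedVariance φ κ δ (s δ)) (𝓝[>] 0)
      (𝓝 (-(u * ∫ z, logEnergy V φ z))) := by
  obtain ⟨R, hR0, hR⟩ := exists_norm_le_of_ne_zero hφc
  obtain ⟨D, hD0, hD⟩ := exists_normV_upper_bound V
  obtain ⟨B, hB⟩ := hφc.exists_bound_of_continuous hφ.continuous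
  have hB0 : 0 ≤ B := (norm_nonneg _).trans (hB 0)
  obtain ⟨C, hC0, hC⟩ := exists_abs_riemannSum_le hφ hφc h0
  set E : ℤ × ℤ → ℝ := fun p => κ p - u * Real.log (1 + normV V (latticePoint p)) - c with hE
  have hEK : ∀ p, |E p| ≤ K := fun p => (hκ p).trans (div_le_self hK (by
    linarith [norm_nonneg (latticePoint p)]))
  set h : ℝ → ℤ × ℤ → ℝ := fun δ p => κ p - (c - u * Real.log δ) with hh
  have h_eq : ∀ {δ : ℝ}, 0 < δ → ∀ p, h δ p =
      u * Real.log (δ + normV V (δ • latticePoint p)) + E p := fun {δ} hδ p => by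
    simp only [hh, hE]
    rw [log_add_normV_smul hδ]; ring
  set L := Real.log (1 + D * (2 * R + 4)) with hL
  have hL1 : 1 ≤ 1 + D * (2 * R + 4) := by
    have : 0 ≤ D * (2 * R + 4) := by positivity
    linarith
  have hL0 : 0 ≤ L := Real.log_nonneg hL1
  -- the remainder
  have hrem : Tendsto (fun δ => 2 * (∑ p ∈ s δ, δ ^ 2 * φ (δ • latticePoint p)) *
        (∑ p ∈ s δ, δ ^ 2 * φ (δ • latticePoint p) * h δ p) +
      (c - u * Real.log δ) * (∑ p ∈ s δ, δ ^ 2 * φ (δ • latticePoint p)) ^ 2) (𝓝[>] 0) (𝓝 0) := by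
    have hlim : Tendsto (fun δ : ℝ => (2 * C ^ 2 * (u * L + K) + |c| * C ^ 2) * δ +
        (3 * C ^ 2 * u) * |δ * Real.log δ|) (𝓝[>] 0) (𝓝 0) := by
      have hc : Continuous fun δ : ℝ => (2 * C ^ 2 * (u * L + K) + |c| * C ^ 2) * δ +
          (3 * C ^ 2 * u) * |δ * Real.log δ| := by
        have := Real.continuous_mul_log
        fun_prop
      have := hc.tendsto 0
      simp only [mul_zero, zero_mul, abs_zero, add_zero] at this
      exact this.mono_left nhdsWithin_le_nhds
    refine squeeze_zero_norm' ?_ hlim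
    filter_upwards [self_mem_nhdsWithin, Ioc_mem_nhdsGT one_pos] with δ hδ hδ1
    have hδ0 : (0 : ℝ) < δ := hδ
    obtain ⟨hS, hA⟩ := hC δ hδ0 hδ1.2 (s δ) (hs δ hδ0)
    set S := ∑ p ∈ s δ, δ ^ 2 * φ (δ • latticePoint p)
    have hH : |∑ p ∈ s δ, δ ^ 2 * φ (δ • latticePoint p) * h δ p| ≤
        C * (u * (|Real.log δ| + L) + K) := by
      refine (Finset.abs_sum_le_sum_abs _ _).trans ?_
      refine le_trans ?_ (mul_le_mul_of_nonneg_right hA (by positivity))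
      rw [Finset.sum_mul]
      refine Finset.sum_le_sum fun p _ => ?_
      rw [abs_mul]
      by_cases hp : φ (δ • latticePoint p) = 0
      · simp [hp]
      refine mul_le_mul_of_nonneg_left ?_ (abs_nonneg _)
      have hpR := hR _ hp
      have hn := normV_nonneg (V := V) (δ • latticePoint p)
      have h1 := abs_log_le_of_mem_Icc (a := δ) (b := δ + normV V (δ • latticePoint p))
        (c := 1 + D * (2 * R + 4)) hδ0 (by linarith) (by
          have := hD (δ • latticePoint p)
          have h2 := mul_le_mul_of_nonneg_left hpR hD0
          nlinarith [hδ1.2]) hL1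
      rw [h_eq hδ0]
      refine (abs_add_le _ _).trans (add_le_add ?_ (hEK p))
      rw [abs_mul, abs_of_nonneg hu]
      exact mul_le_mul_of_nonneg_left h1 hu
    rw [Real.norm_eq_abs]
    refine (abs_add_le _ _).trans ?_
    have hcu : |c - u * Real.log δ| ≤ |c| + u * |Real.log δ| := by
      refine (abs_sub _ _).trans ?_
      rw [abs_mul, abs_of_nonneg hu]
    rw [abs_mul, abs_mul, abs_two, abs_mul, abs_pow]
    have e : |δ * Real.log δ| = δ * |Real.log δ| := by rw [abs_mul, abs_of_pos hδ0]
    rw [e]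
    have l0 := abs_nonneg (Real.log δ)
    calc 2 * |S| * |∑ p ∈ s δ, δ ^ 2 * φ (δ • latticePoint p) * h δ p| +
          |c - u * Real.log δ| * |S| ^ 2
        ≤ 2 * (C * δ) * (C * (u * (|Real.log δ| + L) + K)) +
          (|c| + u * |Real.log δ|) * (C * δ) ^ 2 := by gcongr
      _ ≤ 2 * (C * δ) * (C * (u * (|Real.log δ| + L) + K)) +
          (|c| + u * |Real.log δ|) * (C ^ 2 * δ) := by
        have : (C * δ) ^ 2 ≤ C ^ 2 * δ := by
          have h1 := mul_le_mul_of_nonneg_left hδ1.2 (by positivity : 0 ≤ C ^ 2 * δ)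
          nlinarith
        gcongr
      _ = _ := by ring
  -- the double integral
  set F : ℝ → Plane × Plane → ℝ := fun δ z => φ (cellPoint δ z.1) * φ (cellPoint δ z.2) *
    h δ (cellIndex δ z.1 - cellIndex δ z.2) with hF
  have hsubpt : ∀ (δ : ℝ) (z : Plane × Plane), δ • latticePoint (cellIndex δ z.1 - cellIndex δ z.2) =
      cellPoint δ z.1 - cellPoint δ z.2 := fun δ z => by
    rw [latticePoint_sub, smul_sub]; rfl
  have hFm : ∀ δ, Measurable (F δ) := fun δ => by
    have h1 : Measurable φ := hφ.continuous.measurable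
    have h2 : Measurable fun z : Plane × Plane => h δ (cellIndex δ z.1 - cellIndex δ z.2) :=
      (Measurable.of_discrete (f := fun r : (ℤ × ℤ) × (ℤ × ℤ) => h δ (r.1 - r.2))).comp
        (((measurable_cellIndex δ).comp measurable_fst).prodMk
          ((measurable_cellIndex δ).comp measurable_snd))
    exact ((h1.comp ((measurable_cellPoint δ).comp measurable_fst)).mul
      (h1.comp ((measurable_cellPoint δ).comp measurable_snd))).mul h2
  set d' := min d (1 / 4) with hd'd
  have hd'0 : 0 < d' := lt_min hd (by norm_num)
  set M := B * B * (u * (1 + |Real.log d'| + Real.log (1 + D * (2 * (R + 2) + 4))) + K) with hM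
  have hL2 : 1 ≤ 1 + D * (2 * (R + 2) + 4) := by
    have : 0 ≤ D * (2 * (R + 2) + 4) := by positivity
    linarith
  have hL20 : 0 ≤ Real.log (1 + D * (2 * (R + 2) + 4)) := Real.log_nonneg hL2
  have hM0 : 0 ≤ M := by positivity
  have hbound : ∀ δ : ℝ, 0 < δ → δ ≤ 1 → ∀ z : Plane × Plane, z.1 ≠ z.2 →
      ‖F δ z‖ ≤ M * logMajorant (R + 2) z := fun δ hδ hδ1 z hz => by
    have hpos : 0 ≤ M * logMajorant (R + 2) z := mul_nonneg hM0 (logMajorant_nonneg _ _)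
    by_cases h1 : φ (cellPoint δ z.1) = 0
    · simp only [hF, h1]; simpa using hpos
    by_cases h2 : φ (cellPoint δ z.2) = 0
    · simp only [hF, h2]; simpa using hpos
    have r1 := hR _ h1
    have r2 := hR _ h2
    have n1 := norm_cellPoint_sub_le hδ z.1
    have n2 := norm_cellPoint_sub_le hδ z.2
    have z1 : ‖z.1‖ ≤ R + 2 := by
      have := norm_sub_norm_le z.1 (cellPoint δ z.1)
      rw [norm_sub_rev] at this; linarith
    have z2 : ‖z.2‖ ≤ R + 2 := by
      have := norm_sub_norm_le z.2 (cellPoint δ z.2)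
      rw [norm_sub_rev] at this; linarith
    rw [logMajorant_eq z1 z2]
    set y := cellPoint δ z.1 - cellPoint δ z.2 with hy
    have hzy : ‖z.1 - z.2‖ ≤ 4 * δ + ‖y‖ := by
      have e : z.1 - z.2 = y - ((cellPoint δ z.1 - z.1) - (cellPoint δ z.2 - z.2)) := by
        rw [hy]; abel
      have t1 := norm_sub_le y ((cellPoint δ z.1 - z.1) - (cellPoint δ z.2 - z.2))
      have t2 := norm_sub_le (cellPoint δ z.1 - z.1) (cellPoint δ z.2 - z.2)
      rw [← e] at t1
      linarith
    have hy2 : ‖y‖ ≤ 2 * (R + 2) := (norm_sub_le _ _).trans (by linarith)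
    have hzn : 0 < ‖z.1 - z.2‖ := norm_pos_iff.2 (sub_ne_zero.2 hz)
    have hlow : d' * ‖z.1 - z.2‖ ≤ δ + normV V y := by
      have t1 : d' * (4 * δ) ≤ δ := by
        have := mul_le_mul_of_nonneg_right (min_le_right d (1 / 4)) (by positivity : 0 ≤ 4 * δ)
        linarith
      have t2 : d' * ‖y‖ ≤ normV V y :=
        (mul_le_mul_of_nonneg_right (min_le_left _ _) (norm_nonneg _)).trans (hd' y)
      have t3 := mul_le_mul_of_nonneg_left hzy hd'0.le
      linarith
    have hup : δ + normV V y ≤ 1 + D * (2 * (R + 2) + 4) := by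
      have t1 := (hD y).trans (mul_le_mul_of_nonneg_left hy2 hD0)
      nlinarith
    have h3 := abs_log_le_of_mem_Icc (by positivity) hlow hup hL2
    rw [Real.log_mul hd'0.ne' hzn.ne'] at h3
    have h4 := abs_add_le (Real.log d') (Real.log ‖z.1 - z.2‖)
    have hhb : |h δ (cellIndex δ z.1 - cellIndex δ z.2)| ≤
        (u * (1 + |Real.log d'| + Real.log (1 + D * (2 * (R + 2) + 4))) + K) *
          (1 + |Real.log ‖z.1 - z.2‖|) := by
      rw [h_eq hδ, hsubpt]
      refine (abs_add_le _ _).trans ?_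
      rw [abs_mul, abs_of_nonneg hu]
      have h5 := hEK (cellIndex δ z.1 - cellIndex δ z.2)
      have l0 := abs_nonneg (Real.log ‖z.1 - z.2‖)
      have l1 := abs_nonneg (Real.log d')
      calc u * |Real.log (δ + normV V y)| + |E (cellIndex δ z.1 - cellIndex δ z.2)|
          ≤ u * (|Real.log d'| + |Real.log ‖z.1 - z.2‖| +
              Real.log (1 + D * (2 * (R + 2) + 4))) + K := by gcongr; linarith
        _ ≤ u * ((1 + |Real.log d'| + Real.log (1 + D * (2 * (R + 2) + 4))) *
              (1 + |Real.log ‖z.1 - z.2‖|)) + K * (1 + |Real.log ‖z.1 - z.2‖|) := by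
            gcongr
            · nlinarith [mul_nonneg l1 l0, mul_nonneg hL20 l0]
            · nlinarith
        _ = _ := by ring
    simp only [hF]
    rw [norm_mul, norm_mul, hM, mul_assoc (B * B)]
    exact mul_le_mul (mul_le_mul (hB _) (hB _) (norm_nonneg _) hB0) hhb (norm_nonneg _)
      (by positivity)
  have hMi : Integrable fun z => M * logMajorant (R + 2) z :=
    (integrable_logMajorant (R + 2)).const_mul M
  have hbound' : ∀ δ : ℝ, 0 < δ → δ ≤ 1 → ∀ᵐ z : Plane × Plane,
      ‖F δ z‖ ≤ M * logMajorant (R + 2) z := fun δ hδ hδ1 => by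
    filter_upwards [ae_fst_ne_snd] with z hz using hbound δ hδ hδ1 z hz
  have hmain : Tendsto (fun δ => ∫ z, F δ z) (𝓝[>] 0) (𝓝 (u * ∫ z, logEnergy V φ z)) := by
    rw [← integral_const_mul]
    refine tendsto_integral_filter_of_dominated_convergence _
      (Eventually.of_forall fun δ => (hFm δ).aestronglyMeasurable) ?_ hMi ?_
    · filter_upwards [self_mem_nhdsWithin, Ioc_mem_nhdsGT one_pos] with δ hδ hδ1
      exact hbound' δ hδ hδ1.2
    filter_upwards [ae_fst_ne_snd] with z hz
    have t1 := tendsto_cellPoint z.1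
    have t2 := tendsto_cellPoint z.2
    have hzn : 0 < ‖z.1 - z.2‖ := norm_pos_iff.2 (sub_ne_zero.2 hz)
    have hVz : 0 < normV V (z.1 - z.2) := (by positivity : 0 < d * ‖z.1 - z.2‖).trans_le (hd' _)
    have tδ : Tendsto (fun δ : ℝ => δ) (𝓝[>] 0) (𝓝 0) := tendsto_id.mono_left nhdsWithin_le_nhds
    have ty := t1.sub t2
    have tlog : Tendsto (fun δ => Real.log (δ + normV V (cellPoint δ z.1 - cellPoint δ z.2)))
        (𝓝[>] 0) (𝓝 (Real.log (normV V (z.1 - z.2)))) := by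
      refine Tendsto.log ?_ hVz.ne'
      have := tδ.add ((continuous_normV (V := V)).tendsto _ |>.comp ty)
      rwa [zero_add] at this
    have tE : Tendsto (fun δ => E (cellIndex δ z.1 - cellIndex δ z.2)) (𝓝[>] 0) (𝓝 0) := by
      have hlim : Tendsto (fun δ => K * δ / (δ + ‖cellPoint δ z.1 - cellPoint δ z.2‖)) (𝓝[>] 0)
          (𝓝 (K * 0 / (0 + ‖z.1 - z.2‖))) :=
        (tδ.const_mul K).div (tδ.add ty.norm) (by rw [zero_add]; exact hzn.ne')
      rw [mul_zero, zero_div] at hlim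
      refine squeeze_zero_norm' ?_ hlim
      filter_upwards [self_mem_nhdsWithin] with δ hδ
      have hδ0 : (0 : ℝ) < δ := hδ
      refine (hκ _).trans (le_of_eq ?_)
      rw [← hsubpt, norm_smul, Real.norm_of_nonneg hδ0.le]
      field_simp
    have tF := ((hφ.continuous.tendsto _).comp t1).mul ((hφ.continuous.tendsto _).comp t2) |>.mul
      ((tlog.const_mul u).add tE)
    have e : φ z.1 * φ z.2 * (u * Real.log (normV V (z.1 - z.2)) + 0) = u * logEnergy V φ z := by
      rw [logEnergy]; ring
    rw [e] at tF
    refine tF.congr' ?_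
    filter_upwards [self_mem_nhdsWithin] with δ hδ
    simp only [hF, Function.comp_apply]
    rw [h_eq hδ, hsubpt]
  have := hmain.neg.add hrem
  rw [add_zero] at this
  refine this.congr' ?_
  filter_upwards [self_mem_nhdsWithin, Ioc_mem_nhdsGT one_pos] with δ hδ hδ1
  have hδ0 : (0 : ℝ) < δ := hδ
  have hFi : Integrable (F δ) := Integrable.mono' hMi (hFm δ).aestronglyMeasurable
    (hbound' δ hδ0 hδ1.2)
  rw [pinnedVariance_shift κ (c - u * Real.log δ)]
  congr 2
  exact (sum_sum_eq_integral hδ0 (h δ) (s δ) (hs δ hδ0) hFi).symm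

end

/-! ### Convergence in law of the smoothed field -/

/-- The centred Gaussian law of a given variance. -/
noncomputable def centredGaussian (s : ℝ≥0) : ProbabilityMeasure ℝ := ⟨gaussianReal 0 s, inferInstance⟩

lemma continuous_centredGaussian : Continuous centredGaussian := by
  rw [continuous_iff_seqContinuous]
  intro x a hx
  rw [ProbabilityMeasure.tendsto_iff_tendsto_charFun]
  intro t
  simp only [Function.comp_apply, centredGaussian, ProbabilityMeasure.coe_mk, charFun_gaussianReal]
  have hc : Continuous fun s : ℝ≥0 =>
      Complex.exp ((t : ℂ) * ((0 : ℝ) : ℂ) * Complex.I - ((s : ℝ) : ℂ) * (t : ℂ) ^ 2 / 2) := by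
    fun_prop
  exact (hc.tendsto a).comp hx

lemma tendstoInDistribution_centredGaussian {ι : Type*} {l : Filter ι} {Ω : ι → Type*}
    [∀ i, MeasurableSpace (Ω i)] {μ : ∀ i, Measure (Ω i)} [∀ i, IsProbabilityMeasure (μ i)]
    {X : ∀ i, Ω i → ℝ} {σ : ι → ℝ≥0} {σ₀ : ℝ≥0} (hX : ∀ i, AEMeasurable (X i) (μ i))
    (h : ∀ i, (μ i).map (X i) = gaussianReal 0 (σ i)) (hσ : Tendsto σ l (𝓝 σ₀)) :
    TendstoInDistribution X l id μ (gaussianReal 0 σ₀) := by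
  refine ⟨hX, aemeasurable_id, ?_⟩
  have e1 : (fun i => (⟨(μ i).map (X i), Measure.isProbabilityMeasure_map (hX i)⟩ :
      ProbabilityMeasure ℝ)) = fun i => centredGaussian (σ i) :=
    funext fun i => Subtype.ext (h i)
  have e2 : (⟨(gaussianReal 0 σ₀).map id, Measure.isProbabilityMeasure_map aemeasurable_id⟩ :
      ProbabilityMeasure ℝ) = centredGaussian σ₀ := Subtype.ext Measure.map_id
  rw [e1, e2]
  exact (continuous_centredGaussian.tendsto _).comp hσ

section
variable {A : ℤ × ℤ → ℤ × ℤ → ℝ} {What V : Matrix (Fin 2) (Fin 2) ℝ} {φ : Plane → ℝ}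

lemma smoothedField_eq {δ : ℝ} {s : Finset (ℤ × ℤ)} (hs : ∀ p ∉ s, φ (δ • latticePoint p) = 0)
    {m m₂ : ℕ} (g : GradientSpace m m₂) : smoothedField φ δ g =
      ∑ p ∈ s, δ ^ 2 * φ (δ • latticePoint p) * g (toTorus m m₂ p, toTorus m m₂ 0) := by
  rw [smoothedField, tsum_eq_sum (s := s) (fun p hp => by rw [hs p hp, zero_mul]), Finset.mul_sum]
  exact Finset.sum_congr rfl fun p _ => by ring

lemma measurable_smoothedField (hφc : HasCompactSupport φ) {δ : ℝ} (hδ : 0 < δ) {m m₂ : ℕ} :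
    Measurable fun g : GradientSpace m m₂ => smoothedField φ δ g := by
  obtain ⟨s, hs⟩ := exists_finset_scaled hφc hδ
  simp_rw [smoothedField_eq hs]
  exact Finset.measurable_sum _ fun p _ => (measurable_pi_apply _).const_mul _

/-- The variance of the smoothed field on the torus. -/
noncomputable def torusVariance (A : ℤ × ℤ → ℤ × ℤ → ℝ) (v : ℝ) (φ : Plane → ℝ) (δ : ℝ)
    (s : Finset (ℤ × ℤ)) (m m₂ : ℕ) : ℝ :=
  ∑ p ∈ s, ∑ q ∈ s, δ ^ 2 * φ (δ • latticePoint p) * (δ ^ 2 * φ (δ • latticePoint q)) *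
    (torusCov A v m m₂ p 0 q 0).re

lemma IsAdmissible.map_smoothedField (hA : IsAdmissible A What) {v : ℝ} (hv : 0 ≤ v) {δ : ℝ}
    {s : Finset (ℤ × ℤ)} (hs : ∀ p ∉ s, φ (δ • latticePoint p) = 0) (m m₂ : ℕ) [NeZero m] :
    (stationaryLaw A v m m₂).map (fun g => smoothedField φ δ g) =
      gaussianReal 0 (torusVariance A v φ δ s m m₂).toNNReal ∧
      0 ≤ torusVariance A v φ δ s m m₂ := by
  set μ := stationaryLaw A v m m₂
  set a : ℤ × ℤ → ℝ := fun p => δ ^ 2 * φ (δ • latticePoint p) with ha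
  let T : ℤ × ℤ → StrongDual ℝ (GradientSpace m m₂) := fun p =>
    ContinuousLinearMap.proj (toTorus m m₂ p, toTorus m m₂ 0)
  have hT : ∀ p g, T p g = g (toTorus m m₂ p, toTorus m m₂ 0) := fun _ _ => rfl
  let L : StrongDual ℝ (GradientSpace m m₂) := ∑ p ∈ s, a p • T p
  have hL : (fun g => smoothedField φ δ g) = L := by
    funext g
    rw [smoothedField_eq hs]
    simp [L, ha, hT]
  have hmem : ∀ p, MemLp (fun g => a p * T p g) 2 μ := fun p =>
    (IsGaussian.memLp_dual μ (T p) 2 (by simp)).const_mul (a p)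
  have hvar : Var[L; μ] = torusVariance A v φ δ s m m₂ := by
    have e : (L : GradientSpace m m₂ → ℝ) = fun g => ∑ p ∈ s, a p * T p g := by
      funext g; simp [L]
    rw [e, variance_fun_sum' fun p _ => hmem p, torusVariance]
    refine Finset.sum_congr rfl fun p _ => Finset.sum_congr rfl fun q _ => ?_
    rw [covariance_const_mul_left, covariance_const_mul_right, ← mul_assoc]
    congr 1
    rw [← hA.covariance_stationaryLaw hv, Complex.ofReal_re]
    rfl
  have hmean : μ[L] = 0 := by
    have e : (L : GradientSpace m m₂ → ℝ) = fun g => ∑ p ∈ s, a p * T p g := by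
      funext g; simp [L]
    rw [e, integral_finsetSum _ fun p _ => (hmem p).integrable (by norm_num)]
    refine Finset.sum_eq_zero fun p _ => ?_
    have h0 : ∫ g, T p g ∂μ = 0 := integral_stationaryLaw v _
    rw [integral_const_mul, h0, mul_zero]
  rw [hL, IsGaussian.map_eq_gaussianReal, hmean, hvar]
  exact ⟨rfl, hvar ▸ variance_nonneg _ _⟩

lemma IsAdmissible.tendsto_torusVariance (hA : IsAdmissible A What) (v δ : ℝ)
    (s : Finset (ℤ × ℤ)) {m m₂ : ℕ → ℕ} (hm : Tendsto m atTop atTop)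
    (hlt : ∀ n, 0 < m₂ n ∧ m₂ n < m n) :
    Tendsto (fun n => torusVariance A v φ δ s (m n) (m₂ n)) atTop
      (𝓝 (pinnedVariance φ (covKernel A v) δ s)) := by
  refine tendsto_finsetSum _ fun p _ => tendsto_finsetSum _ fun q _ => Tendsto.const_mul _ ?_
  have h := (Complex.continuous_re.tendsto _).comp (hA.tendsto_torusCov v p 0 q 0 hm hlt)
  rw [hA.limitCov_eq, Complex.ofReal_re] at h
  have e : covKernel A v p + covKernel A v q - covKernel A v (p - q) =
      v / (2 * Real.pi) ^ 2 * (latticePotential A (p - 0) + latticePotential A (q - 0) -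
        latticePotential A (p - q) - latticePotential A (0 - 0)) := by
    simp only [covKernel, sub_zero, latticePotential_zero]
    ring
  rw [e]
  exact h

lemma IsAdmissible.pinnedVariance_nonneg (hA : IsAdmissible A What) {v : ℝ} (hv : 0 ≤ v) {δ : ℝ}
    {s : Finset (ℤ × ℤ)} (hs : ∀ p ∉ s, φ (δ • latticePoint p) = 0) :
    0 ≤ pinnedVariance φ (covKernel A v) δ s :=
  ge_of_tendsto' (hA.tendsto_torusVariance (m := fun n => n + 2) (m₂ := fun _ => 1) v δ s
    (tendsto_add_atTop_nat 2) (fun _ => ⟨one_pos, by omega⟩))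
    fun n => (hA.map_smoothedField hv hs (n + 2) 1).2

/-- The stationary law as a probability measure, for all `m`. -/
noncomputable def stationaryProbability (A : ℤ × ℤ → ℤ × ℤ → ℝ) (v : ℝ) (m m₂ : ℕ) :
    ProbabilityMeasure (GradientSpace m m₂) :=
  ⟨if h : m ≠ 0 then haveI : NeZero m := ⟨h⟩; stationaryLaw A v m m₂ else Measure.dirac 0, by
    split_ifs <;> infer_instance⟩

lemma coe_stationaryProbability (v : ℝ) (m m₂ : ℕ) [hm : NeZero m] :
    (stationaryProbability A v m m₂ : Measure (GradientSpace m m₂)) = stationaryLaw A v m m₂ :=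
  dif_pos hm.ne

theorem IsAdmissible.tendstoInDistribution_smoothedField (hA : IsAdmissible A What) {v : ℝ}
    (hv : 0 ≤ v) (hφc : HasCompactSupport φ) {δ : ℝ} (hδ : 0 < δ)
    {s : Finset (ℤ × ℤ)} (hs : ∀ p ∉ s, φ (δ • latticePoint p) = 0) {m m₂ : ℕ → ℕ}
    (hm : Tendsto m atTop atTop) (hlt : ∀ n, 0 < m₂ n ∧ m₂ n < m n) :
    TendstoInDistribution (fun n (g : GradientSpace (m n) (m₂ n)) => smoothedField φ δ g) atTop id
      (fun n => (stationaryProbability A v (m n) (m₂ n) : Measure (GradientSpace (m n) (m₂ n))))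
      (centredGaussian (pinnedVariance φ (covKernel A v) δ s).toNNReal : Measure ℝ) := by
  refine tendstoInDistribution_centredGaussian
    (fun n => (measurable_smoothedField hφc hδ).aemeasurable) (fun n => ?_)
    ((continuous_real_toNNReal.tendsto _).comp (hA.tendsto_torusVariance (φ := φ) v δ s hm hlt))
  have : NeZero (m n) := ⟨((hlt n).1.trans (hlt n).2).ne'⟩
  rw [coe_stationaryProbability]
  exact (hA.map_smoothedField hv hs (m n) (m₂ n)).1

end

/-- The stationary measure of the gradients of the linear system of SDEs, its infinite volume
limit, and the convergence to the massless Gaussian free field. -/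
theorem theorem4p4 (A : ℤ × ℤ → ℤ × ℤ → ℝ) (What V : Matrix (Fin 2) (Fin 2) ℝ) (v w : ℝ)
    (hA : IsAdmissible A What) (hv : 0 < v) (hw : 0 < w) (hw2 : w ^ 2 = What.det)
    (hV : V * What * Vᵀ = -1) :
    ∃ μ : (m m₂ : ℕ) → ProbabilityMeasure (GradientSpace m m₂),
      -- existence and uniqueness of the stationary measure, mean and covariances
      (∀ (m m₂ : ℕ) [NeZero m], 0 < m₂ → m₂ < m →
        IsStationaryGradientLaw A v m m₂ (μ m m₂ : Measure (GradientSpace m m₂)) ∧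
        (∀ (Ω : Type) [MeasurableSpace Ω] (P : Measure Ω) [IsProbabilityMeasure P]
          (W : Torus m m₂ → ℝ≥0 → Ω → ℝ) (ξ : ℝ≥0 → Ω → Torus m m₂ → ℝ)
          (ν : Measure (GradientSpace m m₂)), IsSolution P A v m m₂ W ξ →
          (∀ t, P.map (fun ω => fieldGradient (ξ t ω)) = ν) →
          ν = (μ m m₂ : Measure (GradientSpace m m₂))) ∧
        IsGaussian (μ m m₂ : Measure (GradientSpace m m₂)) ∧
        (∀ p p' : Torus m m₂,
          ∫ g, g (p, p') ∂(μ m m₂ : Measure (GradientSpace m m₂)) = 0) ∧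
        ∀ y₁ y₂ y₃ y₄ : ℤ × ℤ,
          ((cov[fun g => g (toTorus m m₂ y₁, toTorus m m₂ y₂),
              fun g => g (toTorus m m₂ y₃, toTorus m m₂ y₄);
              (μ m m₂ : Measure (GradientSpace m m₂))] : ℝ) : ℂ) =
            torusCov A v m m₂ y₁ y₂ y₃ y₄) ∧
      -- the infinite volume limit of the covariances
      (∀ y₁ y₂ y₃ y₄ : ℤ × ℤ,
        IntegrableOn (covSummand A y₁ y₂ y₃ y₄) brillouin ∧
        ∀ m m₂ : ℕ → ℕ, Tendsto m atTop atTop → (∀ n, 0 < m₂ n ∧ m₂ n < m n) →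
          Tendsto (fun n => torusCov A v (m n) (m₂ n) y₁ y₂ y₃ y₄) atTop
            (𝓝 (limitCov A v y₁ y₂ y₃ y₄))) ∧
      -- the asymptotics of the limit covariances
      (∃ K : ℝ, ∀ y₁ y₂ y₃ y₄ : ℤ × ℤ,
        ((y₁ = y₃ ↔ y₂ = y₄) → (y₁ = y₄ ↔ y₂ = y₃) →
          ‖limitCov A v y₁ y₂ y₃ y₄ - ((v / (2 * Real.pi * w) *
              Real.log ((1 + latNormV V y₁ y₄ * latNormV V y₃ y₂) /
                (1 + latNormV V y₁ y₃ * latNormV V y₂ y₄)) : ℝ) : ℂ)‖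
            ≤ K / (1 + minDist y₁ y₂ y₃ y₄)) ∧
        ‖limitCov A v y₁ y₂ y₃ y₄ - ((v / (2 * Real.pi * w) *
            Real.log (((1 + latNormV V y₁ y₄) * (1 + latNormV V y₃ y₂)) /
              ((1 + latNormV V y₁ y₃) * (1 + latNormV V y₂ y₄))) : ℝ) : ℂ)‖
          ≤ K / (1 + minDist y₁ y₂ y₃ y₄)) ∧
      -- convergence to the massless Gaussian free field
      (∀ φ : Plane → ℝ, ContDiff ℝ (⊤ : ℕ∞) φ → HasCompactSupport φ → ∫ x, φ x = 0 →
        Integrable (logEnergy V φ) ∧ 0 ≤ gffVariance v w V φ ∧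
        ∃ ν : ℝ → ProbabilityMeasure ℝ,
          (∀ δ : ℝ, 0 < δ → ∀ m m₂ : ℕ → ℕ, Tendsto m atTop atTop →
            (∀ n, 0 < m₂ n ∧ m₂ n < m n) →
            TendstoInDistribution
              (fun n (g : GradientSpace (m n) (m₂ n)) => smoothedField φ δ g) atTop id
              (fun n => (μ (m n) (m₂ n) : Measure (GradientSpace (m n) (m₂ n))))
              (ν δ : Measure ℝ)) ∧
          TendstoInDistribution (fun (_ : ℝ) (x : ℝ) => x) (𝓝[>] 0) id
            (fun δ => (ν δ : Measure ℝ)) (gaussianReal 0 (gffVariance v w V φ).toNNReal)) := by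
  have hv0 := hv.le
  refine ⟨stationaryProbability A v, ?_, fun y₁ y₂ y₃ y₄ =>
    ⟨hA.integrableOn_covSummand _ _ _ _, fun m m₂ hm hlt => hA.tendsto_torusCov v _ _ _ _ hm hlt⟩,
    hA.exists_limitCov_bounds hv hw hw2 hV, ?_⟩
  · intro m m₂ _ _ _
    rw [coe_stationaryProbability]
    exact ⟨hA.isStationaryGradientLaw hv0, fun Ω _ P _ W ξ ν hsol hν =>
      hA.eq_stationaryLaw hv0 hsol hν, inferInstance, fun p p' => integral_stationaryLaw v (p, p'),
      hA.covariance_stationaryLaw hv0⟩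
  · intro φ hφ hφc h0
    obtain ⟨d, hd, hd'⟩ := exists_normV_lower_bound hw hw2 hV
    obtain ⟨c, K, hK, hκ⟩ := hA.exists_abs_covKernel_sub_le hv hw hw2 hV
    have hs : ∀ δ : ℝ, ∃ s : Finset (ℤ × ℤ), 0 < δ → ∀ p ∉ s, φ (δ • latticePoint p) = 0 := by
      intro δ
      by_cases hδ : 0 < δ
      · obtain ⟨s, hs⟩ := exists_finset_scaled hφc hδ
        exact ⟨s, fun _ => hs⟩
      · exact ⟨∅, fun h => absurd h hδ⟩
    choose s hs using hs
    have hlim : Tendsto (fun δ => pinnedVariance φ (covKernel A v) δ (s δ)) (𝓝[>] 0)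
        (𝓝 (gffVariance v w V φ)) := by
      have := tendsto_pinnedVariance (by positivity : 0 ≤ v / (2 * Real.pi * w)) hK hd hd' hκ hφ hφc
        h0 s hs
      rwa [← neg_mul] at this
    refine ⟨integrable_logEnergy hd hd' hφ.continuous hφc, ?_, fun δ =>
      centredGaussian (pinnedVariance φ (covKernel A v) δ (s δ)).toNNReal, fun δ hδ m m₂ hm hlt =>
      hA.tendstoInDistribution_smoothedField hv0 hφc hδ (hs δ hδ) hm hlt, ?_⟩
    · refine ge_of_tendsto hlim ?_
      filter_upwards [self_mem_nhdsWithin] with δ hδ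
      exact hA.pinnedVariance_nonneg hv0 (hs δ hδ)
    · exact tendstoInDistribution_centredGaussian (fun _ => aemeasurable_id)
        (fun _ => Measure.map_id) ((continuous_real_toNNReal.tendsto _).comp hlim)
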